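/- **Conventions.** A chain $[e_1,\dots,e_r]=e_1-1/(e_2-1/(\cdots-1/e_r))$ of positive integers is a Hirzebruch–Jung fraction if $[e_i,\dots,e_r]>0$ for $i\ge 2$ and $[e_1,\dots,e_r]\ge 0$. A framed triangulated polygon is a triangulated convex $(s+1)$-gon, $s\ge 2$, with vertices numbered $0,1,\dots,s$ counterclockwise, vertex $0$ being the hidden vertex. The index $b_i$ of vertex $i$ is the number of diagonals at $i$ plus one; we write the polygon as its extended zero chain $[b_1,\dots,b_s\mid b_0]$. A WW-decomposition of $[k_1,\dots,k_s]$ (all $k_i\ge2$) is a fraction $[k_1,\dots,k_\alpha-1,\dots,k_\beta-1,\dots,k_s]=0$ with $\alpha<\beta$; its hidden index is $3(s-1)$ minus the sum of its entries. For coprime $0<q<m$ the singularity $\frac1m(1,q)$ is a basic wormhole singularity if its dual fraction $\frac{m}{m-q}=[k_1,\dots,k_s]$, $k_i\ge 2$, has at least two different WW-decompositions and their (common) hidden index is greater than $1$. A framed triangulated polygon is a basic wormhole triangulation if $[b_1,\dots,b_s]$ is a WW-decomposition of the dual fraction of some basic wormhole singularity; two such polygons are companions if they come from different WW-decompositions of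 the same dual fraction. The weights of a framed triangulated polygon are the entries greater than $2$ of $(b_1,\dots,b_s,b_0)$, in this order $x_1,\dots,x_n$; for $i<n$, $y_i$ is the number of entries strictly between $x_i$ and $x_{i+1}$, and $y_n$ is the number of all remaining non-weight entries. An accordion triangulation is a triangulated polygon with at least four sides that is built as follows: first draw a diagonal cutting off one vertex; then repeatedly draw a diagonal that shares one end with the previous diagonal and whose other end is the next vertex outwards from the other end of the previous diagonal. Fix $n\ge 2$ and read all subscripts modulo $n$. For integers $x_1,\dots,x_n\ge 3$ and $0\le m\le n-1$ let $\mathscr P^m_x$ denote a framed accordion triangulation with weights $x_1,\dots,x_n$ in this order, with hidden index $x_n$, and such that the diagonals from the hidden vertex are exactly those joining it to vertices lying (weakly) between $x_m$ and $x_{m+1}$ (with $x_0=x_n$). Let $S_m$ be the system $$y_i=x_{n-i+m}-k_i^{(m)}\qquad(1\le i\le n),$$ where $k_i^{(m)}=3$ except that $k_i^{(m)}=1$ for $i\equiv\frac{n-1}2+\lceil\frac m2\rceil$ and $i\equiv n+\lfloor\frac m2\rfloor$ if $n$ is odd, and for $i\equiv\frac n2+\lfloor\frac m2\rfloor$ and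 $i\equiv n+\lfloor\frac m2\rfloor$ if $n$ is even. The unknowns of $S_0\cup S_m$ are the integers $x_i,y_i$. **Statement.** Let $n\ge 2$. *Step I.* For all $x_1,\dots,x_n\ge3$ and $0\le m\le n-1$ there is exactly one $\mathscr P^m_x$, and its numbers $x_i,y_i$ satisfy $S_m$. *Step II.* Let $1\le m\le n-1$ and $d=\gcd(n,m)$. The system $S_0\cup S_m$ is consistent if and only if $d\mid n-\lfloor\frac m2\rfloor$ or $d\mid\frac n2-\lfloor\frac m2\rfloor$ (for $n$ even), respectively $d\mid n-\lceil\frac m2\rceil$ or $d\mid\frac{n-1}2-\lfloor\frac m2\rfloor$ (for $n$ odd). * If it is inconsistent, then for no $x_1,\dots,x_n\ge 3$ are $\mathscr P^0_x$ and $\mathscr P^m_x$ companions. * If it is consistent, then each choice of integers $x_1,\dots,x_d$ extends uniquely to (the $x$-part of) a solution; these solutions are exactly the $x$ that satisfy $$x_{i+jm}=x_i-\sum_{l=0}^{j-1}\bigl(k^{(0)}_{n-(i+lm)}-k^{(m)}_{n-(i+lm)}\bigr)\qquad(1\le i\le d,\ 1\le j\le n/d);$$ there are solutions with all $x_i\ge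 3$. For $x_1,\dots,x_n\ge3$, the polygons $\mathscr P^0_x$ and $\mathscr P^m_x$ are companions if and only if $x$ comes from a solution, and then both are basic wormhole triangulations. *Step III.* Let $x_1,\dots,x_n\ge3$ come from a solution of $S_0\cup S_m$ for some $1\le m\le n-1$. Then $\mathscr P^0_x$ and $\mathscr P^m_x$ have the same number of vertices, and applying one and the same cyclic permutation to the extended zero chains of both, such that the new hidden index is greater than $1$ in both, always gives the extended zero chains of a pair of companions. Call the ordered pairs $(Q,Q')$ obtained in this way the produced pairs. The mirror image of $[b_1,\dots,b_s\mid b_0]$ is $[b_s,\dots,b_1\mid b_0]$. *Output.* A pair $(Q,Q')$ consists of companions with $n$ weights if and only if $(Q,Q')$ is produced, or $(Q',Q)$ is produced, or the pair of the mirror images of $Q$ and $Q'$ is produced. The basic wormhole triangulations with $n$ weights are exactly the members of these pairs. Mirror images are not needed for odd $n$: if $Q,Q'$ are companions with $n$ weights and $n$ is odd, or in $Q$ some weight is immediately followed (counterclockwise) by a vertex of index $1$, then $(Q,Q')$ is produced. -/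

import Mathlib

namespace Wormhole

/-! ## Hirzebruch-Jung continued fractions and WW-decompositions -/

/-- The value `e₁ - 1/(e₂ - 1/(⋯ - 1/e_r))`.  The empty tail contributes `0⁻¹ = 0`, so that
`hjValue [e] = e`. -/
def hjValue : List ℤ → ℚ
  | [] => 0
  | e :: l => (e : ℚ) - (hjValue l)⁻¹

/-- The nonempty collection `e₁, …, e_r` of positive integers admits a Hirzebruch-Jung continued
fraction: `[e_i, …, e_r] > 0` for `i ≥ 2` and `[e₁, …, e_r] ≥ 0`. -/
def IsHJFraction (e : List ℤ) : Prop :=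
  e ≠ [] ∧ (∀ a ∈ e, 0 < a) ∧ 0 ≤ hjValue e ∧
    ∀ i, 0 < i → i < e.length → 0 < hjValue (e.drop i)

/-- Zero continued fractions. -/
def IsZeroFraction (e : List ℤ) : Prop :=
  IsHJFraction e ∧ hjValue e = 0

/-- `k` is a WW-sequence (entries greater than one) and `b` is one of its WW-decompositions:
the zero continued fraction obtained from `k` by subtracting `1` at two different positions. -/
def IsWWDecomposition (k b : List ℤ) : Prop :=
  (∀ a ∈ k, 1 < a) ∧ IsZeroFraction b ∧
    ∃ α β : ℕ, α < β ∧ β < k.length ∧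
      b = (k.modify α (fun a => a - 1)).modify β (fun a => a - 1)

/-- The hidden index `b₀ = 3(s-1) - ∑ bᵢ` of a zero continued fraction `[b₁, …, b_s]`. -/
def hiddenOfZeroFraction (b : List ℤ) : ℤ :=
  3 * ((b.length : ℤ) - 1) - b.sum

/-! ## Wormhole singularities -/

/-- `k` is the dual chain of the cyclic quotient singularity `1/m (1,q)`, that is
`m/(m-q) = [k₁, …, k_s]` with all `kᵢ ≥ 2`. -/
def IsDualChain (m q : ℕ) (k : List ℤ) : Prop :=
  IsHJFraction k ∧ (∀ a ∈ k, 2 ≤ a) ∧ hjValue k = (m : ℚ) / ((m : ℚ) - (q : ℚ))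

/-- `1/m (1,q)` is a basic wormhole singularity: the dual chain has at least two different
WW-decompositions, and its WW-index (the hidden index of its WW-decompositions) is greater
than one. -/
def IsBasicWormholeSingularity (m q : ℕ) : Prop :=
  0 < q ∧ q < m ∧ Nat.Coprime m q ∧
    ∃ k : List ℤ, IsDualChain m q k ∧
      (∃ b b' : List ℤ, b ≠ b' ∧ IsWWDecomposition k b ∧ IsWWDecomposition k b') ∧
      ∀ b : List ℤ, IsWWDecomposition k b → 1 < hiddenOfZeroFraction b

/-! ## Framed triangulated polygons -/

/-- `(i, j)` with `i < j` is a diagonal of the convex polygon with vertices `0, …, s` in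
counterclockwise order (its sides are `(i, i+1)` and `(0, s)`). -/
def IsDiagonal (s : ℕ) (p : ℕ × ℕ) : Prop :=
  p.1 + 2 ≤ p.2 ∧ p.2 ≤ s ∧ ¬(p.1 = 0 ∧ p.2 = s)

/-- Two diagonals meet in the interior of the polygon. -/
def Crosses (p q : ℕ × ℕ) : Prop :=
  (p.1 < q.1 ∧ q.1 < p.2 ∧ p.2 < q.2) ∨ (q.1 < p.1 ∧ p.1 < q.2 ∧ q.2 < p.2)

/-- A triangulation of the convex `(s+1)`-gon with vertices `0, …, s`, given by a set of pairwise
non-crossing diagonals to which no further diagonal can be added.  The frame is the choice of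
vertex `0` as the hidden vertex. -/
@[ext]
structure FramedTriangulation where
  s : ℕ
  two_le : 2 ≤ s
  diagonals : Finset (ℕ × ℕ)
  isDiagonal : ∀ p ∈ diagonals, IsDiagonal s p
  nonCrossing : ∀ p ∈ diagonals, ∀ q ∈ diagonals, ¬ Crosses p q
  maximal : ∀ p, IsDiagonal s p → (∀ q ∈ diagonals, ¬ Crosses p q) → p ∈ diagonals

namespace FramedTriangulation

/-- The index of the vertex `v`: the number of diagonals from `v`, plus one. -/
def index (P : FramedTriangulation) (v : ℕ) : ℤ :=
  ((P.diagonals.filter (fun p => p.1 = v ∨ p.2 = v)).card : ℤ) + 1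

/-- The hidden index `b₀`. -/
def hidden (P : FramedTriangulation) : ℤ := P.index 0

/-- The chain `[b₁, …, b_s]`. -/
def chain (P : FramedTriangulation) : List ℤ :=
  (List.range P.s).map (fun k => P.index (k + 1))

/-- The extended zero chain `[b₁, …, b_s ∣ b₀]`, as the vector `(b₁, …, b_s, b₀)`. -/
def extChain (P : FramedTriangulation) : List ℤ := P.chain ++ [P.hidden]

/-- The entry at position `1 ≤ k ≤ s+1` of `(b₁, …, b_s, b₀)`; position `s+1` is the hidden
vertex `0`. -/
def entry (P : FramedTriangulation) (k : ℕ) : ℤ := P.index (k % (P.s + 1))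

/-- The increasing list `j₁ < ⋯ < j_n` of the positions of the weights (the entries greater
than `2`) in `(b₁, …, b_s, b₀)`. -/
def weightPositions (P : FramedTriangulation) : List ℕ :=
  (List.range' 1 (P.s + 1)).filter (fun k => 2 < P.entry k)

/-- The weights `x₁, …, x_n`, in the order of the vector `(b₁, …, b_s, b₀)`. -/
def weights (P : FramedTriangulation) : List ℤ := P.weightPositions.map P.entry

/-- The position `j_i` of the `i`-th weight, for `1 ≤ i ≤ n`, and `j₀ = 0`.  When the hidden vertex
is the last weight `x_n`, one has `j_n = s+1`, and `x₀ = x_n` is also found at `j₀ = 0`. -/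
def weightPos (P : FramedTriangulation) (i : ℕ) : ℕ := (0 :: P.weightPositions).getD i 0

/-- The label `y_i` of the edge from `x_i` to `x_{i+1}` in the coherent graph, `1 ≤ i ≤ n`. -/
def edgeLabel (P : FramedTriangulation) (i : ℕ) : ℤ :=
  if i < P.weights.length then (P.weightPos (i + 1) : ℤ) - P.weightPos i - 1
  else (P.s : ℤ) + 1 - P.weights.length -
    ∑ j ∈ Finset.Ico 1 P.weights.length, ((P.weightPos (j + 1) : ℤ) - P.weightPos j - 1)

/-- The unordered pair of vertices `u, v` (taken modulo `N`), smaller representative first. -/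
def mkDiagonal (N u v : ℕ) : ℕ × ℕ := (min (u % N) (v % N), max (u % N) (v % N))

/-- Accordion triangulations of `s+1 ≥ 4` sides with base at the vertex `a`.  The first diagonal
`ℓ₀` joins `a` and `a+2`.  After `J` steps `ℓ_J` joins `a - p J` and `a + 2 + (J - p J)`; the next
diagonal keeps one of these two ends and moves the other one to its outer neighbour. -/
def IsAccordion (P : FramedTriangulation) : Prop :=
  3 ≤ P.s ∧ ∃ a : ℕ, ∃ p : ℕ → ℕ, a ≤ P.s ∧ p 0 = 0 ∧
    (∀ J, p (J + 1) = p J ∨ p (J + 1) = p J + 1) ∧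
    P.diagonals = (Finset.range (P.s - 2)).image
      (fun J => mkDiagonal (P.s + 1) (a + (P.s + 1) - p J) (a + 2 + (J - p J)))

/-- The diagonals from the hidden vertex go to the pair `(x_m, x_{m+1})`, where the hidden vertex is
the last weight `x_n = x₀`: they are exactly the diagonals joining it with a vertex lying (weakly)
between `x_m` and `x_{m+1}`. -/
def HiddenDiagonalsGoTo (P : FramedTriangulation) (m : ℕ) : Prop :=
  ∀ k, (0, k) ∈ P.diagonals ↔
    IsDiagonal P.s (0, k) ∧ P.weightPos m ≤ k ∧ k ≤ P.weightPos (m + 1)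

/-- `P` is the triangulation `𝒫^m_{x₁,…,x_n}`: a framed accordion triangulation with weights
`x₁, …, x_n` in this order, with hidden index `x_n`, such that the diagonals from `x_n` go to the
pair `(x_m, x_{m+1})`.  Subscripts are taken modulo `n`. -/
def IsCoherentRotation (n m : ℕ) (x : ZMod n → ℤ) (P : FramedTriangulation) : Prop :=
  P.IsAccordion ∧ P.weights = (List.range n).map (fun i => x ((i + 1 : ℕ) : ZMod n)) ∧
    2 < P.hidden ∧ P.HiddenDiagonalsGoTo m

/-- `P` and `Q` represent different WW-decompositions of the dual fraction of one and the same
basic wormhole singularity. -/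
def IsCompanion (P Q : FramedTriangulation) : Prop :=
  ∃ m q : ℕ, IsBasicWormholeSingularity m q ∧ ∃ k : List ℤ, IsDualChain m q k ∧
    IsWWDecomposition k P.chain ∧ IsWWDecomposition k Q.chain ∧ P.chain ≠ Q.chain

/-- `P` represents a WW-decomposition of the dual fraction of a basic wormhole singularity. -/
def IsBasicWormhole (P : FramedTriangulation) : Prop :=
  ∃ m q : ℕ, IsBasicWormholeSingularity m q ∧ ∃ k : List ℤ, IsDualChain m q k ∧
    IsWWDecomposition k P.chain

/-- `Q` has the extended zero chain of `P` after the cyclic permutation by `r` places. -/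
def IsCyclicChange (r : ℕ) (P Q : FramedTriangulation) : Prop :=
  Q.extChain = P.extChain.rotate r

/-- `Q` is the mirror image of `P`: the chain read backwards, with the same hidden index. -/
def IsMirror (P Q : FramedTriangulation) : Prop :=
  Q.chain = P.chain.reverse ∧ Q.hidden = P.hidden

/-- Somewhere in the cyclic (counterclockwise) order a weight is immediately followed by a vertex
of index one, that is, the underlying polygon admits a standard frame. -/
def AdmitsStandardFrame (P : FramedTriangulation) : Prop :=
  ∃ k, 2 < P.entry k ∧ P.entry (k + 1) = 1

end FramedTriangulation

/-! ## The linear systems -/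

/-- The numbers `k_i^{(m)}`, with `i` modulo `n`: two special positions have the value `1`, all
others `3`. -/
def kNumber (n m : ℕ) (i : ZMod n) : ℤ :=
  if n % 2 = 1 then
    if i = (((n - 1) / 2 + (m + 1) / 2 : ℕ) : ZMod n) ∨ i = ((n + m / 2 : ℕ) : ZMod n) then 1 else 3
  else
    if i = ((n / 2 + m / 2 : ℕ) : ZMod n) ∨ i = ((n + m / 2 : ℕ) : ZMod n) then 1 else 3

/-- The system `S_m : y_i = x_{(n-i)+m} - k_i^{(m)}`, with subscripts modulo `n`. -/
def SystemS (n m : ℕ) (x y : ZMod n → ℤ) : Prop :=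
  ∀ i : ZMod n, y i = x ((n : ZMod n) - i + (m : ZMod n)) - kNumber n m i

/-- `x` is the `x`-part of a solution of `S_0 ∪ S_m`. -/
def SolvesUnion (n m : ℕ) (x : ZMod n → ℤ) : Prop :=
  ∃ y : ZMod n → ℤ, SystemS n 0 x y ∧ SystemS n m x y

/-- The system `S_0 ∪ S_m` is consistent. -/
def IsConsistent (n m : ℕ) : Prop := ∃ x : ZMod n → ℤ, SolvesUnion n m x

/-- The arithmetic test for the consistency of `S_0 ∪ S_m`. -/
def ConsistencyTest (n m : ℕ) : Prop :=
  if n % 2 = 1 then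
    (Nat.gcd n m : ℤ) ∣ (n : ℤ) - ((m + 1) / 2 : ℕ) ∨
      (Nat.gcd n m : ℤ) ∣ ((n - 1) / 2 : ℕ) - ((m / 2 : ℕ) : ℤ)
  else
    (Nat.gcd n m : ℤ) ∣ (n : ℤ) - (m / 2 : ℕ) ∨
      (Nat.gcd n m : ℤ) ∣ (n / 2 : ℕ) - ((m / 2 : ℕ) : ℤ)

/-- The explicit parametric description, with parameters `x₁, …, x_d`, `d = gcd(n,m)`:
`x_{i+jm} = x_i - ∑_{l<j} (k^{(0)}_{n-(i+lm)} - k^{(m)}_{n-(i+lm)})`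
for `1 ≤ i ≤ d` and `1 ≤ j ≤ n/d`. -/
def ParametricFormula (n m : ℕ) (x : ZMod n → ℤ) : Prop :=
  ∀ i ∈ Finset.Icc 1 (Nat.gcd n m), ∀ j ∈ Finset.Icc 1 (n / Nat.gcd n m),
    x ((i + j * m : ℕ) : ZMod n) = x (i : ZMod n) -
      ∑ l ∈ Finset.range j,
        (kNumber n 0 ((n : ZMod n) - ((i + l * m : ℕ) : ZMod n)) -
          kNumber n m ((n : ZMod n) - ((i + l * m : ℕ) : ZMod n)))

open FramedTriangulation in
/-- The ordered pair `(Q, Q')` is produced by the cyclic changes of frame: it is obtained from a pair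
`(𝒫^0_x, 𝒫^m_x)`, where `1 ≤ m ≤ n-1`, all `x_i ≥ 3` and `x` comes from a solution of `S_0 ∪ S_m`,
by applying one and the same cyclic permutation to both extended zero chains, in such a way that the
new hidden index is greater than one in both. -/
def IsProduced (n : ℕ) (Q Q' : FramedTriangulation) : Prop :=
  ∃ (m : ℕ) (x : ZMod n → ℤ) (P P' : FramedTriangulation) (r : ℕ),
    1 ≤ m ∧ m ≤ n - 1 ∧ (∀ i, 3 ≤ x i) ∧ SolvesUnion n m x ∧
    IsCoherentRotation n 0 x P ∧ IsCoherentRotation n m x P' ∧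
    IsCyclicChange r P Q ∧ IsCyclicChange r P' Q' ∧ 1 < Q.hidden ∧ 1 < Q'.hidden

open FramedTriangulation in
/-- The pair `(Q, Q')` is on the final list: up to exchanging its members, or up to taking the mirror
images of both, it is produced by the cyclic changes of frame. -/
def IsListedPair (n : ℕ) (Q Q' : FramedTriangulation) : Prop :=
  IsProduced n Q Q' ∨ IsProduced n Q' Q ∨
    ∃ R R' : FramedTriangulation, IsMirror Q R ∧ IsMirror Q' R' ∧ IsProduced n R R'

end Wormhole

/-! ### Ears: cutting off and gluing on triangles. -/

namespace Wormhole

namespace FramedTriangulation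

/-! Everything is read off the index function of a triangulation, regarded as a function `lind` on ℤ
of period N = s + 1. Cutting off ears one at a time shows that this function determines the
triangulation (`eq_of_index_eq`) and that the zero continued fractions are exactly the chains of
triangulations (`isZeroFraction_chain`, `exists_chain_eq`). A triangulation with more than three
sides has at least two ears, and the dual chain has no entry 1. So, for hidden index greater than 1,
being a WW-decomposition means having exactly two ears, and the dual chain is recovered by raising
each 1 to 2 (`isWWDecomposition_iff`). Companions are therefore distinct two-eared triangulations
whose index functions agree after this replacement (`IsTwin`, `isCompanion_iff`). This relation is
compatible with reflections, and with common rotations as long as the hidden indices stay greater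
than 1.

Two-eared triangulations are accordions. Listing the diagonals of an accordion by their width T
gives a staircase u, where u T is the first end and u T + T the second. Reading a diagonal from its
other end gives the symmetry u (-T) = u T + T. The columns of u with several points are the weights,
and the symmetry forces the fan of the i-th weight to face exactly the gap between the weights c - i
and c - i + 1, for one integer c, the type (`exists_fiber_of_staircase`, `IsCoherent`). Counting the
fan gives each gap as the opposite weight minus a constant; the constant is smaller at the gaps
containing an ear, and these are located by congruences for 2g - c modulo n. This is the system S_m,
with c = m. The type matters only modulo n, and relabelling the weights by t lowers it by 2t. So
only the types 0 and 1 have to be constructed, and a triangulation is determined by its type, its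
weights and the position of one weight (`IsCoherent.eq`).

Twins have the same weights at the same positions. Once the first has type 0 and the second type m,
this says that the common gaps solve S_0 and S_m (`IsCoherentRotation.isTwin_iff`). Eliminating y
leaves a difference equation along a ↦ a + m, whose orbits are the classes modulo d = gcd(n, m). Its
right-hand side consists of four point masses, and it is solvable exactly when masses of opposite
sign can be paired within orbits (`isConsistent_iff`).

Every companion pair is reached because the type of its first member can be made even and then moved
to 0 by a rotation. For odd n one may add n to the type. For even n an odd type means that the ears
precede weights, and a reflection turns this around (`isListedPair_iff`). -/

theorem index_eq_one_iff (P : FramedTriangulation) (v : ℕ) :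
    P.index v = 1 ↔ ∀ p ∈ P.diagonals, p.1 ≠ v ∧ p.2 ≠ v := by
  unfold index
  simp only [add_eq_right, Nat.cast_eq_zero, Finset.card_eq_zero, Finset.filter_eq_empty_iff,
    not_or]

theorem one_le_index (P : FramedTriangulation) (v : ℕ) : 1 ≤ P.index v := by
  unfold index; omega

/-- A chord of width 2 cuts off an ear. Under a wider chord there is always a shorter diagonal, so
induction on the width applies. The second alternative treats the side (0, s) like a diagonal, which
gives an ear away from that side. -/
theorem exists_ear_between (P : FramedTriangulation) (l r : ℕ)
    (h : (l, r) ∈ P.diagonals ∨ (l = 0 ∧ r = P.s ∧ 3 ≤ P.s)) :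
    ∃ e, l < e ∧ e < r ∧ P.index e = 1 := by
  induction hw : r - l using Nat.strong_induction_on generalizing l r with
  | _ w ih =>
  have hlr : l + 2 ≤ r ∧ r ≤ P.s := by
    rcases h with h | h
    · have := P.isDiagonal _ h; exact ⟨this.1, this.2.1⟩
    · omega
  by_cases h2 : r = l + 2
  · subst h2
    have hm : (l, l + 2) ∈ P.diagonals := by
      rcases h with h | h
      · exact h
      · omega
    refine ⟨l + 1, by omega, by omega, ?_⟩
    rw [index_eq_one_iff]
    rintro ⟨u, v⟩ hp
    have h1 := P.nonCrossing _ hp _ hm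
    have h3 := P.isDiagonal _ hp
    simp only [Crosses, IsDiagonal] at h1 h3 ⊢
    omega
  by_cases hin : ∃ q ∈ P.diagonals, l ≤ q.1 ∧ q.2 ≤ r ∧ q ≠ (l, r)
  · obtain ⟨⟨u, v⟩, hq, hl, hr, hne⟩ := hin
    have h3 := P.isDiagonal _ hq
    simp only [IsDiagonal, ne_eq, Prod.mk.injEq] at h3 hl hr hne
    obtain ⟨e, h4, h5, h6⟩ := ih (v - u) (by omega) u v (Or.inl hq) rfl
    exact ⟨e, by omega, by omega, h6⟩
  · push Not at hin
    -- With nothing strictly below (l, r), no diagonal can cross (l, l + 2), so maximality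
    -- contradicts the emptiness.
    have hm : (l, l + 2) ∈ P.diagonals := by
      apply P.maximal
      · simp only [IsDiagonal]; omega
      · rintro ⟨u, v⟩ hq hc
        have h3 := P.isDiagonal _ hq
        have h4 := hin _ hq
        have h5 : (l, r) ∈ P.diagonals → ¬ Crosses (u, v) (l, r) := fun h => P.nonCrossing _ hq _ h
        have h6 : l ≤ u → v ≤ r → u = l ∧ v = r := by simpa using h4
        clear h4 hin ih
        simp only [Crosses, IsDiagonal] at h3 hc h5
        rcases h with h | h
        · have := h5 h; omega
        · omega
    have := hin _ hm le_rfl (by simp; omega)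
    simp at this
    omega

/-- The relabelling of the vertices when a new vertex `i` is inserted. -/
def skip (i v : ℕ) : ℕ := if v < i then v else v + 1

theorem skip_injective (i : ℕ) : Function.Injective (skip i) := by
  intro a b h
  unfold skip at h
  split_ifs at h <;> omega

theorem skip_ne (i v : ℕ) : skip i v ≠ i := by
  unfold skip; split_ifs <;> omega

theorem crosses_skip (i : ℕ) (p q : ℕ × ℕ) :
    Crosses (Prod.map (skip i) (skip i) p) (Prod.map (skip i) (skip i) q) ↔ Crosses p q := by
  have h : ∀ a b, skip i a < skip i b ↔ a < b := by
    intro a b; unfold skip; split_ifs <;> omega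
  simp only [Crosses, Prod.map, h]

theorem prod_skip_injective (i : ℕ) : Function.Injective (Prod.map (skip i) (skip i)) :=
  (skip_injective i).prodMap (skip_injective i)

/-- The triangulation obtained by gluing a triangle to the side `(i-1, i)`; the new vertex is
called `i`. -/
def insertEar (P : FramedTriangulation) (i : ℕ) (h1 : 1 ≤ i) (h2 : i ≤ P.s) :
    FramedTriangulation where
  s := P.s + 1
  two_le := by have := P.two_le; omega
  diagonals := insert (i - 1, i + 1) (P.diagonals.image (Prod.map (skip i) (skip i)))
  isDiagonal := by
    have h0 := P.two_le
    intro p hp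
    rw [Finset.mem_insert, Finset.mem_image] at hp
    rcases hp with rfl | ⟨⟨u, v⟩, hq, rfl⟩
    · simp only [IsDiagonal]; omega
    · have := P.isDiagonal _ hq
      simp only [IsDiagonal, Prod.map, skip] at this ⊢
      split_ifs <;> (try simp only [false_and, not_false_eq_true, and_true]) <;> omega
  nonCrossing := by
    have key : ∀ p ∈ P.diagonals, ¬ Crosses (i - 1, i + 1) (Prod.map (skip i) (skip i) p) ∧
        ¬ Crosses (Prod.map (skip i) (skip i) p) (i - 1, i + 1) := by
      rintro ⟨u, v⟩ hq
      have h3 := skip_ne i u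
      have h4 := skip_ne i v
      simp only [Crosses, Prod.map]
      omega
    intro p hp q hq
    rw [Finset.mem_insert, Finset.mem_image] at hp hq
    rcases hp with rfl | ⟨p, hp, rfl⟩ <;> rcases hq with rfl | ⟨q, hq, rfl⟩
    · simp only [Crosses]; omega
    · exact (key q hq).1
    · exact (key p hp).2
    · rw [crosses_skip]; exact P.nonCrossing p hp q hq
  maximal := by
    rintro ⟨u, v⟩ hp hc
    replace hp : IsDiagonal (P.s + 1) (u, v) := hp
    rw [Finset.mem_insert, Finset.mem_image]
    by_cases h : (u, v) = (i - 1, i + 1)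
    · exact Or.inl h
    right
    have h3 := hc _ (Finset.mem_insert_self _ _)
    have hu : u ≠ i := by
      rintro rfl
      simp only [Crosses, IsDiagonal] at h3 hp; omega
    have hv : v ≠ i := by
      rintro rfl
      simp only [Crosses, IsDiagonal] at h3 hp; omega
    refine ⟨(if u < i then u else u - 1, if v < i then v else v - 1), ?_, ?_⟩
    · have e : (u, v) = Prod.map (skip i) (skip i)
          (if u < i then u else u - 1, if v < i then v else v - 1) := by
        simp only [Prod.map, skip, Prod.mk.injEq]
        constructor <;> split_ifs <;> omega
      apply P.maximal
      · simp only [IsDiagonal, Prod.mk.injEq] at hp h ⊢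
        split_ifs <;> omega
      · intro q hq hcr
        rw [← crosses_skip i, ← e] at hcr
        exact hc _ (Finset.mem_insert_of_mem (Finset.mem_image_of_mem _ hq)) hcr
    · simp only [Prod.map, skip, Prod.mk.injEq]
      constructor <;> split_ifs <;> omega

theorem insertEar_s (P : FramedTriangulation) (i : ℕ) (h1 : 1 ≤ i) (h2 : i ≤ P.s) :
    (P.insertEar i h1 h2).s = P.s + 1 := rfl

theorem index_insertEar_self (P : FramedTriangulation) (i : ℕ) (h1 : 1 ≤ i) (h2 : i ≤ P.s) :
    (P.insertEar i h1 h2).index i = 1 := by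
  rw [index_eq_one_iff]
  intro p hp
  simp only [insertEar, Finset.mem_insert, Finset.mem_image] at hp
  rcases hp with rfl | ⟨⟨u, v⟩, hq, rfl⟩
  · simp only; omega
  · exact ⟨skip_ne i u, skip_ne i v⟩

/-- Relabelling is injective and preserves the old diagonals at each vertex. The only new diagonal
is the side to which the triangle is glued, with old ends i - 1 and i. -/
theorem index_insertEar_skip (P : FramedTriangulation) (i : ℕ) (h1 : 1 ≤ i) (h2 : i ≤ P.s)
    (w : ℕ) : (P.insertEar i h1 h2).index (skip i w) =
      P.index w + if w = i - 1 ∨ w = i then 1 else 0 := by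
  have hni : (i - 1, i + 1) ∉ P.diagonals.image (Prod.map (skip i) (skip i)) := by
    rw [Finset.mem_image]
    rintro ⟨⟨u, v⟩, hq, h⟩
    have := P.isDiagonal _ hq
    simp only [IsDiagonal, Prod.map, skip, Prod.mk.injEq] at this h
    split_ifs at h <;> omega
  have hcard : ((P.diagonals.image (Prod.map (skip i) (skip i))).filter
      (fun p => p.1 = skip i w ∨ p.2 = skip i w)).card =
      (P.diagonals.filter (fun p => p.1 = w ∨ p.2 = w)).card := by
    rw [Finset.filter_image, Finset.card_image_of_injective _ (prod_skip_injective i)]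
    simp only [Prod.map, (skip_injective i).eq_iff]
  have hcond : (i - 1 = skip i w ∨ i + 1 = skip i w) ↔ (w = i - 1 ∨ w = i) := by
    unfold skip; split_ifs <;> omega
  unfold index insertEar
  rw [Finset.filter_insert]
  simp only [hcond]
  split_ifs with h
  · rw [Finset.card_insert_of_notMem (fun h => hni (Finset.mem_of_mem_filter _ h)), hcard]
    push_cast; ring
  · rw [hcard]; ring

/-- A chord crossing (i - 1, i + 1) must end at i, and there is none at an ear. So that chord is a
diagonal by maximality, and cutting along it undoes `insertEar`. -/
theorem exists_eq_insertEar (P : FramedTriangulation) (i : ℕ) (h1 : 1 ≤ i) (h2 : i < P.s)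
    (h3 : 3 ≤ P.s) (hi : P.index i = 1) :
    ∃ (Q : FramedTriangulation) (hQ : i ≤ Q.s), P = Q.insertEar i h1 hQ := by
  rw [index_eq_one_iff] at hi
  have hm : (i - 1, i + 1) ∈ P.diagonals := by
    apply P.maximal
    · simp only [IsDiagonal]; omega
    · rintro ⟨u, v⟩ hq
      have := hi _ hq
      simp only [Crosses] at this ⊢
      omega
  let Q : FramedTriangulation :=
    { s := P.s - 1
      two_le := by omega
      -- Pull back along `skip`; the pair (i - 1, i) is removed because its image is the cutting
      -- diagonal, which becomes a side.
      diagonals := (Finset.range P.s ×ˢ Finset.range P.s).filter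
        (fun p => p ≠ (i - 1, i) ∧ Prod.map (skip i) (skip i) p ∈ P.diagonals)
      isDiagonal := by
        rintro ⟨u, v⟩ hp
        rw [Finset.mem_filter] at hp
        have := P.isDiagonal _ hp.2.2
        have h4 := hp.2.1
        simp only [IsDiagonal, Prod.map, skip, ne_eq, Prod.mk.injEq] at this h4 ⊢
        split_ifs at this <;> omega
      nonCrossing := by
        intro p hp q hq
        rw [Finset.mem_filter] at hp hq
        rw [← crosses_skip i]
        exact P.nonCrossing _ hp.2.2 _ hq.2.2
      maximal := by
        rintro ⟨u, v⟩ hp hc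
        replace hp : IsDiagonal (P.s - 1) (u, v) := hp
        have hp' : (u, v) ≠ (i - 1, i) := by
          simp only [IsDiagonal, ne_eq, Prod.mk.injEq] at hp ⊢
          omega
        rw [Finset.mem_filter]
        refine ⟨?_, hp', ?_⟩
        · simp only [IsDiagonal, Finset.mem_product, Finset.mem_range] at hp ⊢
          omega
        · apply P.maximal
          · simp only [IsDiagonal, Prod.map, skip] at hp ⊢
            split_ifs <;> (try simp only [false_and, not_false_eq_true, and_true]) <;> omega
          · rintro ⟨u', v'⟩ hq hcr
            have hq1 := hi _ hq
            have hq2 := P.isDiagonal _ hq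
            by_cases hq3 : (u', v') = (i - 1, i + 1)
            · rw [hq3] at hcr
              have h4 := skip_ne i u
              have h5 := skip_ne i v
              simp only [Crosses, Prod.map] at hcr
              omega
            · have e : (u', v') = Prod.map (skip i) (skip i)
                  (if u' < i then u' else u' - 1, if v' < i then v' else v' - 1) := by
                simp only [Prod.map, skip, Prod.mk.injEq] at hq1 ⊢
                constructor <;> split_ifs <;> omega
              rw [e] at hcr hq
              rw [crosses_skip] at hcr
              refine hc _ ?_ hcr
              rw [Finset.mem_filter]
              refine ⟨?_, ?_, hq⟩
              · simp only [Finset.mem_product, Finset.mem_range]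
                simp only [IsDiagonal] at hq2 hq1
                constructor <;> split_ifs <;> omega
              · simp only [ne_eq, Prod.mk.injEq] at hq3 hq1 ⊢
                simp only [IsDiagonal] at hq2
                split_ifs <;> omega }
  refine ⟨Q, by change i ≤ P.s - 1; omega, ?_⟩
  ext1
  · change P.s = P.s - 1 + 1; omega
  · ext ⟨u, v⟩
    simp only [insertEar, Finset.mem_insert, Finset.mem_image]
    constructor
    · intro hp
      by_cases hp3 : (u, v) = (i - 1, i + 1)
      · exact Or.inl hp3
      right
      have hq1 := hi _ hp
      have hq2 := P.isDiagonal _ hp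
      have e : Prod.map (skip i) (skip i)
          (if u < i then u else u - 1, if v < i then v else v - 1) = (u, v) := by
        simp only [Prod.map, skip, Prod.mk.injEq] at hq1 ⊢
        constructor <;> split_ifs <;> omega
      refine ⟨_, ?_, e⟩
      rw [Finset.mem_filter, e]
      refine ⟨?_, ?_, hp⟩
      · simp only [Finset.mem_product, Finset.mem_range]
        simp only [IsDiagonal] at hq2 hq1
        constructor <;> split_ifs <;> omega
      · simp only [ne_eq, Prod.mk.injEq] at hp3 hq1 ⊢
        simp only [IsDiagonal] at hq2
        split_ifs <;> omega
    · rintro (h | ⟨q, hq, h⟩)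
      · rw [h]; exact hm
      · rw [← h]; exact (Finset.mem_filter.mp hq).2.2

theorem diagonals_eq_empty (P : FramedTriangulation) (h : P.s = 2) : P.diagonals = ∅ := by
  rw [Finset.eq_empty_iff_forall_notMem]
  rintro ⟨u, v⟩ hp
  have := P.isDiagonal _ hp
  simp only [IsDiagonal] at this
  omega

/-- Every triangulation of a polygon with more than three sides is obtained by inserting an ear
away from the side `(0, s)`. -/
theorem exists_eq_insertEar_of_three_le (P : FramedTriangulation) (h3 : 3 ≤ P.s) :
    ∃ (Q : FramedTriangulation) (i : ℕ) (h1 : 1 ≤ i) (h2 : i ≤ Q.s), P = Q.insertEar i h1 h2 := by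
  obtain ⟨e, h0, h2, he⟩ := P.exists_ear_between 0 P.s (Or.inr ⟨rfl, rfl, h3⟩)
  obtain ⟨Q, hQ, h⟩ := P.exists_eq_insertEar e h0 h2 h3 he
  exact ⟨Q, e, h0, hQ, h⟩

/-- An ear of one triangulation is visible in its indices, hence is an ear of the other. Cutting it
off in both lowers the same indices, and induction applies. -/
theorem eq_of_index_eq (P Q : FramedTriangulation) (hs : P.s = Q.s)
    (h : ∀ v ≤ P.s, P.index v = Q.index v) : P = Q := by
  induction hn : P.s generalizing P Q with
  | zero => have := P.two_le; omega
  | succ n ih =>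
    by_cases h3 : 3 ≤ P.s
    · obtain ⟨e, h0, h2, he⟩ := P.exists_ear_between 0 P.s (Or.inr ⟨rfl, rfl, h3⟩)
      obtain ⟨P', hP', rfl⟩ := P.exists_eq_insertEar e h0 h2 h3 he
      obtain ⟨Q', hQ', rfl⟩ := Q.exists_eq_insertEar e h0 (hs ▸ h2) (hs ▸ h3)
        ((h e h2.le).symm.trans he)
      simp only [insertEar_s] at hs hn
      have : P' = Q' := by
        apply ih P' Q' (by omega) _ (by omega)
        intro v hv
        have := h (skip e v) (by simp only [insertEar_s]; unfold skip; split_ifs <;> omega)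
        rw [index_insertEar_skip, index_insertEar_skip] at this
        linarith
      subst this
      rfl
    · have := P.two_le
      ext1
      · exact hs
      · rw [P.diagonals_eq_empty (by omega), Q.diagonals_eq_empty (by omega)]

end FramedTriangulation

end Wormhole

/-! ### Chains of triangulations and zero continued fractions. -/

namespace Wormhole

namespace FramedTriangulation

theorem chain_eq (P : FramedTriangulation) : P.chain = (List.range' 1 P.s).map P.index := by
  unfold chain
  rw [List.range_eq_range', ← List.map_add_range' (a := 1) 0 P.s 1, List.map_map]
  apply List.map_congr_left
  intro a _
  simp [add_comm]

theorem length_chain (P : FramedTriangulation) : P.chain.length = P.s := by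
  simp [chain]

/-- Here the left neighbour of the new ear is the hidden vertex, so only one entry of the chain
itself goes up. -/
theorem chain_insertEar_one (P : FramedTriangulation) (h2 : 1 ≤ P.s) :
    ∃ v r, P.chain = v :: r ∧ (P.insertEar 1 le_rfl h2).chain = 1 :: (v + 1) :: r := by
  refine ⟨P.index 1, (List.range' 2 (P.s - 1)).map P.index, ?_, ?_⟩
  · rw [chain_eq]
    obtain ⟨k, hk⟩ : ∃ k, P.s = k + 1 := ⟨P.s - 1, by omega⟩
    rw [hk, List.range'_succ]
    rfl
  · rw [chain_eq, insertEar_s]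
    obtain ⟨k, hk⟩ : ∃ k, P.s = k + 1 := ⟨P.s - 1, by omega⟩
    rw [hk, List.range'_succ, List.range'_succ, List.map_cons, List.map_cons,
      index_insertEar_self]
    have h := P.index_insertEar_skip 1 le_rfl h2 1
    simp only [skip, lt_irrefl, if_false] at h
    rw [h]
    congr 2
    rw [← List.map_add_range' (a := 1) 2, List.map_map]
    simp only [add_tsub_cancel_right]
    apply List.map_congr_left
    intro w hw
    rw [List.mem_range'_1] at hw
    have h := P.index_insertEar_skip 1 le_rfl h2 w
    rw [if_neg (by omega), skip, if_neg (by omega)] at h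
    simp only [Function.comp]
    rw [add_comm 1 w, h, add_zero]

/-- Gluing a triangle is the blow-up of the chain between its entries i - 1 and i. -/
theorem chain_insertEar (P : FramedTriangulation) (i : ℕ) (h1 : 2 ≤ i) (h2 : i ≤ P.s) :
    ∃ l u v r, l.length = i - 2 ∧ P.chain = l ++ u :: v :: r ∧
      (P.insertEar i (by omega) h2).chain = l ++ (u + 1) :: 1 :: (v + 1) :: r := by
  refine ⟨(List.range' 1 (i - 2)).map P.index, P.index (i - 1), P.index i,
    (List.range' (i + 1) (P.s - i)).map P.index, by simp, ?_, ?_⟩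
  · rw [chain_eq]
    obtain ⟨j, rfl⟩ : ∃ j, i = j + 2 := ⟨i - 2, by omega⟩
    obtain ⟨k, hk⟩ : ∃ k, P.s = j + (k + 1 + 1) := ⟨P.s - (j + 2), by omega⟩
    have e : j + (k + 1 + 1) - (j + 2) = k := by omega
    rw [hk, e, ← List.range'_append_1, List.range'_succ, List.range'_succ, List.map_append,
      List.map_cons, List.map_cons]
    have e1 : j + 2 - 1 = 1 + j := by omega
    have e2 : j + 2 = 1 + j + 1 := by omega
    have e3 : 1 + j + 1 - 2 = j := by omega
    rw [e1, e2, e3]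
  · rw [chain_eq, insertEar_s]
    obtain ⟨j, rfl⟩ : ∃ j, i = j + 2 := ⟨i - 2, by omega⟩
    obtain ⟨k, hk⟩ : ∃ k, P.s = j + (k + 1 + 1) := ⟨P.s - (j + 2), by omega⟩
    have e : P.s - (j + 2) = k := by omega
    have e0 : P.s + 1 = j + (k + 1 + 1 + 1) := by omega
    rw [e0, e, ← List.range'_append_1, List.range'_succ, List.range'_succ, List.range'_succ,
      List.map_append, List.map_cons, List.map_cons, List.map_cons]
    have a1 := P.index_insertEar_skip (j + 2) (by omega) h2 (1 + j)
    have a2 := P.index_insertEar_self (j + 2) (by omega) h2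
    have a3 := P.index_insertEar_skip (j + 2) (by omega) h2 (j + 2)
    rw [if_pos (by omega), skip, if_pos (by omega)] at a1
    rw [if_pos (by omega), skip, if_neg (by omega)] at a3
    have e1 : j + 2 - 1 = 1 + j := by omega
    have e2 : 1 + j + 1 = j + 2 := by omega
    rw [e1, a1, e2, a2, a3]
    have b1 : (List.range' 1 (j + 2 - 2)).map P.index =
        (List.range' 1 j).map (P.insertEar (j + 2) (by omega) h2).index := by
      apply List.map_congr_left
      intro w hw
      rw [List.mem_range'_1] at hw
      have h := P.index_insertEar_skip (j + 2) (by omega) h2 w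
      rw [if_neg (by omega), skip, if_pos (by omega), add_zero] at h
      exact h.symm
    have b2 : (List.range' (j + 2 + 1) k).map P.index =
        (List.range' (j + 2 + 1 + 1) k).map (P.insertEar (j + 2) (by omega) h2).index := by
      have e3 : j + 2 + 1 + 1 = 1 + (j + 2 + 1) := by omega
      rw [e3, ← List.map_add_range' (a := 1), List.map_map]
      apply List.map_congr_left
      intro w hw
      rw [List.mem_range'_1] at hw
      have h := P.index_insertEar_skip (j + 2) (by omega) h2 w
      rw [if_neg (by omega), skip, if_neg (by omega)] at h
      simp only [Function.comp]
      rw [add_comm 1 w, h, add_zero]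
    rw [b1, b2]

theorem hidden_insertEar (P : FramedTriangulation) (i : ℕ) (h1 : 1 ≤ i) (h2 : i ≤ P.s) :
    (P.insertEar i h1 h2).hidden = P.hidden + if i = 1 then 1 else 0 := by
  have h := P.index_insertEar_skip i h1 h2 0
  rw [skip, if_pos (by omega)] at h
  unfold hidden
  rw [h]
  congr 1
  split_ifs <;> omega

theorem index_of_s_eq_two (P : FramedTriangulation) (h : P.s = 2) (v : ℕ) : P.index v = 1 := by
  unfold index
  rw [P.diagonals_eq_empty h]
  simp

theorem chain_of_s_eq_two (P : FramedTriangulation) (h : P.s = 2) : P.chain = [1, 1] := by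
  simp [chain, h, P.index_of_s_eq_two h, List.range_succ]

theorem pos_of_mem_chain (P : FramedTriangulation) : ∀ a ∈ P.chain, 0 < a := by
  intro a ha
  unfold chain at ha
  rw [List.mem_map] at ha
  obtain ⟨k, _, rfl⟩ := ha
  have := P.one_le_index (k + 1)
  omega

/-- An ear away from the hidden vertex lengthens the chain by 1 and raises its sum by 3, leaving
both sides fixed. An ear at position 1 raises the sum only by 2, and the hidden index absorbs the
difference. -/
theorem hidden_eq (P : FramedTriangulation) : P.hidden = hiddenOfZeroFraction P.chain := by
  unfold hiddenOfZeroFraction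
  rw [length_chain]
  induction hn : P.s generalizing P with
  | zero => have := P.two_le; omega
  | succ n ih =>
    by_cases h3 : 3 ≤ P.s
    · obtain ⟨Q, i, h1, h2, rfl⟩ := P.exists_eq_insertEar_of_three_le h3
      rw [insertEar_s] at hn
      have := ih Q (by omega)
      rw [hidden_insertEar, this]
      by_cases hi : i = 1
      · subst hi
        obtain ⟨v, r, e1, e2⟩ := Q.chain_insertEar_one h2
        rw [e1, e2]
        simp only [List.sum_cons, if_true]
        push_cast; ring
      · obtain ⟨l, u, v, r, -, e1, e2⟩ := Q.chain_insertEar i (by omega) h2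
        rw [e1, e2]
        simp only [List.sum_cons, List.sum_append, if_neg hi]
        push_cast; ring
    · have := P.two_le
      have h2 : P.s = 2 := by omega
      rw [chain_of_s_eq_two P h2, hidden, P.index_of_s_eq_two h2, ← hn, h2]
      norm_num

end FramedTriangulation

/-- The linear recurrence attached to a chain: starting from two consecutive values `α, β`, all
further values `e * β - α` are positive, except for the last one, which vanishes. -/
def VanishingRecurrence : ℚ → ℚ → List ℤ → Prop
  | _, β, [] => β = 0
  | α, β, e :: l => 0 < β ∧ VanishingRecurrence β (e * β - α) l

theorem VanishingRecurrence.nonneg {α β : ℚ} {l : List ℤ} (h : VanishingRecurrence α β l) :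
    0 ≤ β := by
  cases l with
  | nil => exact h.ge
  | cons e l => exact h.1.le

/-- The tails of the continued fraction are the quotients of consecutive terms of the recurrence.
Positivity of the tails becomes positivity of the terms, and no division remains. -/
theorem vanishingRecurrence_iff (l : List ℤ) (hl : l ≠ []) (α β : ℚ) :
    VanishingRecurrence α β l ↔ 0 < β ∧ hjValue l = α / β ∧
      ∀ i, 0 < i → i < l.length → 0 < hjValue (l.drop i) := by
  induction l generalizing α β with
  | nil => exact absurd rfl hl
  | cons e l ih =>
    cases l with
    | nil =>
      simp only [VanishingRecurrence, hjValue, inv_zero, sub_zero, List.length_cons,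
        List.length_nil]
      constructor
      · rintro ⟨h1, h2⟩
        refine ⟨h1, ?_, fun i h3 h4 => by omega⟩
        field_simp; linarith
      · rintro ⟨h1, h2, -⟩
        refine ⟨h1, ?_⟩
        rw [h2]; field_simp; ring
    | cons f l =>
      rw [VanishingRecurrence, ih (by simp)]
      have hdrop : (∀ i, 0 < i → i < (e :: f :: l).length → 0 < hjValue ((e :: f :: l).drop i)) ↔
          0 < hjValue (f :: l) ∧
            ∀ i, 0 < i → i < (f :: l).length → 0 < hjValue ((f :: l).drop i) := by
        constructor
        · intro h
          refine ⟨by simpa using h 1 (by omega) (by simp), fun i h1 h2 => ?_⟩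
          simpa using h (i + 1) (by omega) (by simpa using h2)
        · rintro ⟨h1, h2⟩ i h3 h4
          obtain ⟨j, rfl⟩ : ∃ j, i = j + 1 := ⟨i - 1, by omega⟩
          rw [List.drop_succ_cons]
          rcases Nat.eq_zero_or_pos j with rfl | hj
          · simpa using h1
          · exact h2 j hj (by simpa using h4)
      rw [hdrop]
      have hv : hjValue (e :: f :: l) = e - (hjValue (f :: l))⁻¹ := rfl
      rw [hv]
      constructor
      · rintro ⟨h1, h2, h3, h4⟩
        refine ⟨h1, ?_, ?_, h4⟩
        · rw [h3, inv_div]; field_simp; ring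
        · rw [h3]; positivity
      · rintro ⟨h1, h2, h3, h4⟩
        have h5 : (e : ℚ) * β - α = β * (hjValue (f :: l))⁻¹ := by
          have : (hjValue (f :: l))⁻¹ = e - α / β := by linarith
          rw [this]; field_simp
        refine ⟨h1, ?_, ?_, h4⟩
        · rw [h5]; positivity
        · rw [h5]; field_simp

theorem isZeroFraction_iff (b : List ℤ) :
    IsZeroFraction b ↔ b ≠ [] ∧ (∀ a ∈ b, 0 < a) ∧ VanishingRecurrence 0 1 b := by
  constructor
  · rintro ⟨⟨h1, h2, h3, h4⟩, h5⟩
    refine ⟨h1, h2, ?_⟩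
    rw [vanishingRecurrence_iff b h1]
    exact ⟨one_pos, by rw [h5]; simp, h4⟩
  · rintro ⟨h1, h2, h3⟩
    rw [vanishingRecurrence_iff b h1] at h3
    have h5 : hjValue b = 0 := by rw [h3.2.1]; simp
    exact ⟨⟨h1, h2, h5.ge, h3.2.2⟩, h5⟩

/-- A blow-up inserts into the sequence of values the sum of its two neighbours. This sum is
positive anyway, and the other values do not change. -/
theorem vanishingRecurrence_insert (α β : ℚ) (l : List ℤ) (u v : ℤ) (r : List ℤ) :
    VanishingRecurrence α β (l ++ (u + 1) :: 1 :: (v + 1) :: r) ↔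
      VanishingRecurrence α β (l ++ u :: v :: r) := by
  induction l generalizing α β with
  | nil =>
    simp only [List.nil_append, VanishingRecurrence]
    push_cast
    have e1 : 1 * (((u : ℚ) + 1) * β - α) - β = u * β - α := by ring
    have e2 : ((v : ℚ) + 1) * (u * β - α) - ((u + 1) * β - α) = v * (u * β - α) - β := by ring
    rw [e1, e2]
    constructor
    · rintro ⟨h1, h2, h3, h4⟩; exact ⟨h1, h3, h4⟩
    · rintro ⟨h1, h3, h4⟩; exact ⟨h1, by linarith, h3, h4⟩
  | cons e l ih =>
    simp only [List.cons_append, VanishingRecurrence, ih]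

theorem vanishingRecurrence_cons (v : ℤ) (r : List ℤ) :
    VanishingRecurrence 0 1 (1 :: (v + 1) :: r) ↔ VanishingRecurrence 0 1 (v :: r) := by
  simp only [VanishingRecurrence]
  push_cast
  have e : ((v : ℚ) + 1) * (1 * 1 - 0) - 1 = v * 1 - 0 := by ring
  rw [e]
  norm_num

theorem FramedTriangulation.isZeroFraction_chain (P : FramedTriangulation) :
    IsZeroFraction P.chain := by
  rw [isZeroFraction_iff]
  refine ⟨?_, P.pos_of_mem_chain, ?_⟩
  · intro h
    have h1 := P.length_chain
    have h2 := P.two_le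
    rw [h] at h1
    simp at h1
    omega
  · induction hn : P.s generalizing P with
    | zero => have := P.two_le; omega
    | succ n ih =>
      by_cases h3 : 3 ≤ P.s
      · obtain ⟨Q, i, h1, h2, rfl⟩ := P.exists_eq_insertEar_of_three_le h3
        rw [insertEar_s] at hn
        have := ih Q (by omega)
        by_cases hi : i = 1
        · subst hi
          obtain ⟨v, r, e1, e2⟩ := Q.chain_insertEar_one h2
          rw [e1] at this
          rw [e2, vanishingRecurrence_cons]
          exact this
        · obtain ⟨l, u, v, r, -, e1, e2⟩ := Q.chain_insertEar i (by omega) h2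
          rw [e1] at this
          rw [e2, vanishingRecurrence_insert]
          exact this
      · have := P.two_le
        rw [chain_of_s_eq_two P (by omega)]
        norm_num [VanishingRecurrence]

/-- A vanishing recurrence contains an entry `1` before its last entry. -/
theorem VanishingRecurrence.exists_one {α β : ℚ} {l : List ℤ} (h : VanishingRecurrence α β l)
    (hαβ : α < β) (hα : 0 ≤ α) (hpos : ∀ a ∈ l, 0 < a) :
    ∃ l₁ v r, l = l₁ ++ 1 :: (v + 1) :: r ∧ ∀ l₂ u, l₁ = l₂ ++ [u] → 1 < u := by
  induction l generalizing α β with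
  | nil => simp only [VanishingRecurrence] at h; linarith
  | cons e l ih =>
    obtain ⟨h1, h2⟩ := h
    have he := hpos e (by simp)
    by_cases he1 : e = 1
    · subst he1
      cases l with
      | nil =>
        simp only [VanishingRecurrence] at h2
        push_cast at h2
        linarith
      | cons f l => exact ⟨[], f - 1, l, by simp, by simp⟩
    · have he2 : (2 : ℚ) ≤ e := by exact_mod_cast (show 2 ≤ e by omega)
      -- Entries at least 2 keep the values strictly increasing, so the sequence cannot come down to
      -- 0 before an entry 1 occurs.
      have h3 : β < e * β - α := by nlinarith
      obtain ⟨l₁, v, r, rfl, h6⟩ := ih h2 h3 h1.le (fun a ha => hpos a (by simp [ha]))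
      refine ⟨e :: l₁, v, r, rfl, ?_⟩
      intro l₂ u h
      cases l₂ with
      | nil => simp at h; omega
      | cons a l₂ =>
        simp only [List.cons_append, List.cons.injEq] at h
        exact h6 l₂ u h.2

/-- Blowing down subtracts 1 from two entries. They stay positive because a nonpositive entry would
make the next value of the recurrence nonpositive after u, or negative after v. -/
theorem VanishingRecurrence.pos_of_append {α β : ℚ} {l : List ℤ} {u v : ℤ} {r : List ℤ}
    (h : VanishingRecurrence α β (l ++ u :: v :: r)) (hα : 0 ≤ α) : 0 < u ∧ 0 < v := by
  induction l generalizing α β with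
  | nil =>
    obtain ⟨h1, h2, h3⟩ := h
    have h4 := h3.nonneg
    have hu : (0 : ℚ) < u := by
      by_contra hu
      push Not at hu
      nlinarith
    have hv : (0 : ℚ) < v := by
      by_contra hv
      push Not at hv
      nlinarith
    exact ⟨by exact_mod_cast hu, by exact_mod_cast hv⟩
  | cons e l ih => exact ih h.2 h.1.le

namespace FramedTriangulation

/-- Every zero continued fraction is the chain of a framed triangulation. -/
theorem exists_chain_eq (b : List ℤ) (hb : IsZeroFraction b) :
    ∃ P : FramedTriangulation, P.chain = b := by
  induction hn : b.length generalizing b with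
  | zero => exact absurd (List.length_eq_zero_iff.mp hn) hb.1.1
  | succ n ih =>
    rw [isZeroFraction_iff] at hb
    obtain ⟨h1, h2, h3⟩ := hb
    obtain ⟨l₁, v, r, rfl, h4⟩ := h3.exists_one one_pos le_rfl h2
    -- A leading 1 is an ear next to the hidden vertex; any other one is an interior blow-up.
    rcases List.eq_nil_or_concat l₁ with rfl | ⟨l, u, rfl⟩
    · rw [List.nil_append, vanishingRecurrence_cons] at h3
      cases r with
      -- Two entries, the first being 1: the recurrence forces [1, 1], the chain of the triangle.
      | nil =>
        have hv : v = 0 := by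
          have := h3.2
          simp only [VanishingRecurrence] at this
          have : (v : ℚ) = 0 := by linarith
          exact_mod_cast this
        subst hv
        let T : FramedTriangulation :=
          { s := 2
            two_le := le_rfl
            diagonals := ∅
            isDiagonal := by simp
            nonCrossing := by simp
            maximal := by intro p hp; simp only [IsDiagonal] at hp; omega }
        exact ⟨T, by rw [T.chain_of_s_eq_two rfl]; rfl⟩
      | cons w r =>
        have hpos := VanishingRecurrence.pos_of_append (l := []) h3 le_rfl
        obtain ⟨P, hP⟩ := ih (v :: w :: r) (by
          rw [isZeroFraction_iff]
          refine ⟨by simp, ?_, h3⟩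
          intro a ha
          rcases List.mem_cons.mp ha with rfl | ha
          · exact hpos.1
          · exact h2 a (by simp only [List.nil_append, List.mem_cons] at ha ⊢; tauto)) (by
          simp at hn ⊢; omega)
        have hs := P.two_le
        obtain ⟨v', r', e1, e2⟩ := P.chain_insertEar_one (by omega)
        rw [hP] at e1
        obtain ⟨rfl, rfl⟩ := List.cons.inj e1
        exact ⟨_, e2⟩
    · have hu := h4 l u (by simp)
      obtain ⟨u, rfl⟩ : ∃ u', u = u' + 1 := ⟨u - 1, by ring⟩
      simp only [List.concat_eq_append, List.append_assoc, List.singleton_append] at *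
      rw [vanishingRecurrence_insert] at h3
      have hpos := h3.pos_of_append le_rfl
      obtain ⟨P, hP⟩ := ih (l ++ u :: v :: r) (by
          rw [isZeroFraction_iff]
          refine ⟨by simp, ?_, h3⟩
          intro a ha
          simp only [List.mem_append, List.mem_cons] at ha
          rcases ha with ha | rfl | rfl | ha
          · exact h2 a (by simp [ha])
          · exact hpos.1
          · exact hpos.2
          · exact h2 a (by simp [ha])) (by
          simp at hn ⊢; omega)
      have hs := P.length_chain
      rw [hP] at hs
      simp at hs
      obtain ⟨l', u', v', r', e0, e1, e2⟩ := P.chain_insertEar (l.length + 2) (by omega) (by omega)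
      rw [hP] at e1
      obtain ⟨rfl, e4⟩ := List.append_inj e1 (by omega)
      simp only [List.cons.injEq] at e4
      obtain ⟨rfl, rfl, rfl⟩ := e4
      exact ⟨_, e2⟩

end FramedTriangulation

end Wormhole

set_option linter.unusedSimpArgs false

/-! ### Periodic labels, rotations and reflections. -/

namespace Wormhole

theorem dvd_of_eq_of_dvd {N a b : ℤ} (e : b = a) (h : N ∣ a) : N ∣ b := e ▸ h

namespace FramedTriangulation

/-- The residue of an integer modulo the number of vertices. -/
def res (P : FramedTriangulation) (v : ℤ) : ℕ := (v % ((P.s : ℤ) + 1)).toNat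

/-- The index of a vertex, as a periodic function on the integers. -/
def lind (P : FramedTriangulation) (v : ℤ) : ℤ := P.index (P.res v)

/-- The integers `u, v` represent the two ends of a diagonal. -/
def Joined (P : FramedTriangulation) (u v : ℤ) : Prop :=
  (P.res u, P.res v) ∈ P.diagonals ∨ (P.res v, P.res u) ∈ P.diagonals

theorem res_cast (P : FramedTriangulation) (v : ℤ) :
    (P.res v : ℤ) = v % ((P.s : ℤ) + 1) := by
  unfold res
  exact Int.toNat_of_nonneg (Int.emod_nonneg _ (by omega))

theorem res_le (P : FramedTriangulation) (v : ℤ) : P.res v ≤ P.s := by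
  have h := Int.emod_lt_of_pos v (show (0 : ℤ) < (P.s : ℤ) + 1 by omega)
  rw [← res_cast] at h
  omega

theorem dvd_sub_res (P : FramedTriangulation) (v : ℤ) : ((P.s : ℤ) + 1) ∣ v - P.res v := by
  rw [res_cast]
  exact Int.dvd_self_sub_emod

theorem res_eq_res_iff (P : FramedTriangulation) (u v : ℤ) :
    P.res u = P.res v ↔ ((P.s : ℤ) + 1) ∣ u - v := by
  rw [← Int.natCast_inj, res_cast, res_cast, Int.emod_eq_emod_iff_emod_sub_eq_zero,
    ← Int.dvd_iff_emod_eq_zero]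

theorem res_natCast (P : FramedTriangulation) (k : ℕ) (hk : k ≤ P.s) : P.res k = k := by
  have : (P.res k : ℤ) = k := by
    rw [res_cast]; exact Int.emod_eq_of_lt (by omega) (by omega)
  exact_mod_cast this

theorem res_eq_iff (P : FramedTriangulation) (u : ℤ) (k : ℕ) (hk : k ≤ P.s) :
    P.res u = k ↔ ((P.s : ℤ) + 1) ∣ u - k := by
  rw [← res_eq_res_iff, P.res_natCast k hk]

theorem res_natCast_mod (P : FramedTriangulation) (k : ℕ) : P.res k = k % (P.s + 1) := by
  have : (P.res k : ℤ) = (k % (P.s + 1) : ℕ) := by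
    rw [res_cast]; push_cast; rfl
  exact_mod_cast this

theorem res_add_one (P : FramedTriangulation) (u : ℤ) :
    P.res (u + 1) = if P.res u = P.s then 0 else P.res u + 1 := by
  have h := P.dvd_sub_res u
  have h1 := P.res_le u
  obtain ⟨k, hk⟩ := h
  split_ifs with h2
  · rw [res_eq_iff _ _ _ (by omega)]
    exact ⟨k + 1, by rw [h2] at hk; push_cast; linarith⟩
  · rw [res_eq_iff _ _ _ (by omega)]
    exact ⟨k, by push_cast; linarith⟩

theorem res_neg (P : FramedTriangulation) (u : ℤ) :
    P.res (-u) = if P.res u = 0 then 0 else P.s + 1 - P.res u := by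
  have h := P.dvd_sub_res u
  have h1 := P.res_le u
  obtain ⟨k, hk⟩ := h
  split_ifs with h2
  · rw [res_eq_iff _ _ _ (by omega)]
    exact ⟨-k, by rw [h2] at hk; push_cast at *; linarith⟩
  · rw [res_eq_iff _ _ _ (by omega)]
    refine ⟨-k - 1, ?_⟩
    rw [Nat.cast_sub (by omega)]
    push_cast; linarith

theorem joined_comm (P : FramedTriangulation) (u v : ℤ) : P.Joined u v ↔ P.Joined v u :=
  or_comm

theorem joined_congr (P : FramedTriangulation) {u u' v v' : ℤ} (hu : ((P.s : ℤ) + 1) ∣ u - u')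
    (hv : ((P.s : ℤ) + 1) ∣ v - v') : P.Joined u v ↔ P.Joined u' v' := by
  rw [← res_eq_res_iff] at hu hv
  unfold Joined
  rw [hu, hv]

theorem lind_congr (P : FramedTriangulation) {u v : ℤ} (h : ((P.s : ℤ) + 1) ∣ u - v) :
    P.lind u = P.lind v := by
  rw [← res_eq_res_iff] at h
  unfold lind
  rw [h]

theorem lind_natCast (P : FramedTriangulation) (k : ℕ) (hk : k ≤ P.s) :
    P.lind k = P.index k := by
  rw [lind, res_natCast _ _ hk]

theorem entry_eq_lind (P : FramedTriangulation) (k : ℕ) : P.entry k = P.lind k := by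
  rw [lind, res_natCast_mod, entry]

theorem hidden_eq_lind (P : FramedTriangulation) : P.hidden = P.lind 0 := by
  have := P.lind_natCast 0 (by omega)
  rw [hidden, ← this]
  rfl

theorem one_le_lind (P : FramedTriangulation) (v : ℤ) : 1 ≤ P.lind v := P.one_le_index _

theorem joined_natCast (P : FramedTriangulation) {u v : ℕ} (h : u < v) (hv : v ≤ P.s) :
    P.Joined u v ↔ (u, v) ∈ P.diagonals := by
  rw [Joined, res_natCast _ _ hv, res_natCast _ _ (by omega)]
  refine or_iff_left ?_
  intro h'
  have := P.isDiagonal _ h'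
  simp only [IsDiagonal] at this
  omega

/-- A diagonal at v is determined by its other end, so counting diagonals amounts to counting
neighbours. In this form the index depends only on `Joined`. -/
theorem lind_eq_card (P : FramedTriangulation) (v : ℤ) [DecidablePred fun x : ℕ => P.Joined v x] :
    P.lind v = ((Finset.range (P.s + 1)).filter (fun x : ℕ => P.Joined v x)).card + 1 := by
  unfold lind index
  congr 2
  have key : ∀ p ∈ P.diagonals, p.1 < p.2 ∧ p.2 ≤ P.s := by
    intro p hp
    have := P.isDiagonal p hp
    simp only [IsDiagonal] at this
    omega
  refine Finset.card_bij (fun p _ => if p.1 = P.res v then p.2 else p.1) ?_ ?_ ?_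
  · rintro ⟨x, y⟩ hp
    rw [Finset.mem_filter] at hp ⊢
    obtain ⟨hp, h⟩ := hp
    have := key _ hp
    simp only at h this ⊢
    unfold Joined
    split_ifs with h1
    · subst h1
      rw [P.res_natCast y (by omega)]
      exact ⟨by simp; omega, Or.inl hp⟩
    · have h2 : y = P.res v := by tauto
      subst h2
      rw [P.res_natCast x (by omega)]
      exact ⟨by simp; omega, Or.inr hp⟩
  · rintro ⟨x, y⟩ hp ⟨x', y'⟩ hp' h
    rw [Finset.mem_filter] at hp hp'
    have h1 := key _ hp.1
    have h2 := key _ hp'.1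
    have h3 := hp.2
    have h4 := hp'.2
    simp only [Prod.mk.injEq] at h h1 h2 h3 h4 ⊢
    split_ifs at h <;> omega
  · intro x hx
    rw [Finset.mem_filter, Finset.mem_range] at hx
    obtain ⟨hx, h⟩ := hx
    unfold Joined at h
    rw [P.res_natCast x (by omega)] at h
    rcases h with h | h
    · exact ⟨(P.res v, x), by rw [Finset.mem_filter]; exact ⟨h, Or.inl rfl⟩, by simp⟩
    · have := key _ h
      simp only at this
      exact ⟨(x, P.res v), by rw [Finset.mem_filter]; exact ⟨h, Or.inr rfl⟩, by simp; omega⟩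

/-- A bijection of ℤ compatible with congruence modulo s + 1 carries neighbours to neighbours. The
cases needed are translations and v ↦ -v. -/
theorem lind_eq_of_joined {P Q : FramedTriangulation} (hs : Q.s = P.s) (f g : ℤ → ℤ)
    (hfg : ∀ v, f (g v) = v) (hgf : ∀ v, g (f v) = v)
    (hf : ∀ u v, ((P.s : ℤ) + 1) ∣ u - v → ((P.s : ℤ) + 1) ∣ f u - f v)
    (hg : ∀ u v, ((P.s : ℤ) + 1) ∣ u - v → ((P.s : ℤ) + 1) ∣ g u - g v)
    (hj : ∀ u v, Q.Joined u v ↔ P.Joined (f u) (f v)) (v : ℤ) : Q.lind v = P.lind (f v) := by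
  classical
  rw [lind_eq_card, lind_eq_card, hs]
  congr 2
  refine Finset.card_bij' (fun x _ => P.res (f x)) (fun x _ => P.res (g x)) ?_ ?_ ?_ ?_
  · intro x hx
    rw [Finset.mem_filter, Finset.mem_range] at hx ⊢
    have h1 := P.res_le (f x)
    refine ⟨by omega, ?_⟩
    have h2 := (hj v x).mp hx.2
    refine (P.joined_congr (u := f v) (v := f x) (by simp) (P.dvd_sub_res _)).mp h2
  · intro x hx
    rw [Finset.mem_filter, Finset.mem_range] at hx ⊢
    have h1 := P.res_le (g x)
    refine ⟨by omega, ?_⟩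
    rw [hj]
    refine (P.joined_congr (by simp) ?_).mp hx.2
    have h2 := hf _ _ (P.dvd_sub_res (g x))
    rwa [hfg] at h2
  · intro x hx
    rw [Finset.mem_filter, Finset.mem_range] at hx
    rw [res_eq_iff _ _ _ (by omega)]
    have h2 := hg _ _ (P.dvd_sub_res (f x))
    rw [hgf] at h2
    rw [dvd_sub_comm]
    exact h2
  · intro x hx
    rw [Finset.mem_filter, Finset.mem_range] at hx
    rw [res_eq_iff _ _ _ (by omega)]
    have h2 := hf _ _ (P.dvd_sub_res (g x))
    rw [hfg] at h2
    rw [dvd_sub_comm]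
    exact h2

/-- Transport of a triangulation along a symmetry of the polygon. -/
def transport (P : FramedTriangulation) (φ ψ : ℕ × ℕ → ℕ × ℕ)
    (hφ : ∀ p, IsDiagonal P.s p → IsDiagonal P.s (φ p))
    (hψ : ∀ p, IsDiagonal P.s p → IsDiagonal P.s (ψ p))
    (hφψ : ∀ p, IsDiagonal P.s p → φ (ψ p) = p)
    (hc : ∀ p q, IsDiagonal P.s p → IsDiagonal P.s q → (Crosses (φ p) (φ q) ↔ Crosses p q)) :
    FramedTriangulation where
  s := P.s
  two_le := P.two_le
  diagonals := P.diagonals.image φ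
  isDiagonal := by
    intro p hp
    obtain ⟨q, hq, rfl⟩ := Finset.mem_image.mp hp
    exact hφ q (P.isDiagonal q hq)
  nonCrossing := by
    intro p hp q hq
    obtain ⟨p, hp', rfl⟩ := Finset.mem_image.mp hp
    obtain ⟨q, hq', rfl⟩ := Finset.mem_image.mp hq
    rw [hc p q (P.isDiagonal p hp') (P.isDiagonal q hq')]
    exact P.nonCrossing p hp' q hq'
  maximal := by
    intro p hp h
    refine Finset.mem_image.mpr ⟨ψ p, P.maximal _ (hψ p hp) fun q hq hcr => ?_, hφψ p hp⟩
    rw [← hc _ _ (hψ p hp) (P.isDiagonal q hq), hφψ p hp] at hcr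
    exact h _ (Finset.mem_image_of_mem _ hq) hcr

/-- The same triangulation with the vertex `1` as the hidden vertex. -/
def rotOne (P : FramedTriangulation) : FramedTriangulation :=
  -- All labels drop by one; the old vertex 0 becomes s, so a diagonal at it has its ends exchanged.
  P.transport (fun p => if p.1 = 0 then (p.2 - 1, P.s) else (p.1 - 1, p.2 - 1))
    (fun p => if p.2 = P.s then (0, p.1 + 1) else (p.1 + 1, p.2 + 1))
    (by
      rintro ⟨u, v⟩ h
      simp only [IsDiagonal] at h ⊢
      split_ifs <;> (try simp only [false_and, true_and, not_false_eq_true, and_true]) <;> omega)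
    (by
      rintro ⟨u, v⟩ h
      simp only [IsDiagonal] at h ⊢
      split_ifs <;> (try simp only [false_and, true_and, not_false_eq_true, and_true]) <;> omega)
    (by
      rintro ⟨u, v⟩ h
      simp only [IsDiagonal] at h ⊢
      by_cases h1 : v = P.s <;> simp [h1])
    (by
      rintro ⟨u, v⟩ ⟨u', v'⟩ h h'
      simp only [IsDiagonal, Crosses] at h h' ⊢
      split_ifs <;> (try simp only [false_and, true_and, not_false_eq_true, and_true]) <;> omega)

theorem joined_rotOne (P : FramedTriangulation) (u v : ℤ) :
    P.rotOne.Joined u v ↔ P.Joined (u + 1) (v + 1) := by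
  have key : ∀ x y, x ≤ P.s → y ≤ P.s → ((x, y) ∈ P.rotOne.diagonals ↔
      ((if y = P.s then (0, x + 1) else (x + 1, y + 1)) ∈ P.diagonals)) := by
    intro x y hx hy
    change (x, y) ∈ P.diagonals.image _ ↔ _
    rw [Finset.mem_image]
    constructor
    · rintro ⟨⟨a, b⟩, hab, h⟩
      have h1 := P.isDiagonal _ hab
      simp only [IsDiagonal] at h1 h
      by_cases ha : a = 0
      · rw [if_pos ha, Prod.mk.injEq] at h
        rw [if_pos (by omega)]
        have : (0, x + 1) = (a, b) := by rw [Prod.mk.injEq]; omega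
        rwa [this]
      · rw [if_neg ha, Prod.mk.injEq] at h
        rw [if_neg (by omega)]
        have : (x + 1, y + 1) = (a, b) := by rw [Prod.mk.injEq]; omega
        rwa [this]
    · intro h
      by_cases hy : y = P.s
      · rw [if_pos hy] at h
        exact ⟨_, h, by simp [hy]⟩
      · rw [if_neg hy] at h
        exact ⟨_, h, by simp⟩
  have hr : ∀ w, P.rotOne.res w = P.res w := fun _ => rfl
  have no : ∀ x y, (x, y) ∈ P.diagonals → x + 2 ≤ y := fun x y h => (P.isDiagonal _ h).1
  unfold Joined
  rw [hr, hr, key _ _ (P.res_le _) (P.res_le _), key _ _ (P.res_le _) (P.res_le _),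
    res_add_one, res_add_one]
  have hu := P.res_le u
  have hv := P.res_le v
  split_ifs with h1 h2 h2
  · rw [h1, h2]
    constructor
    · rintro (h | h) <;> exact absurd (P.isDiagonal _ h).2.1 (by simp)
    · rintro (h | h) <;> exact absurd (no _ _ h) (by omega)
  · refine ⟨?_, ?_⟩
    · rintro (h | h)
      · exact Or.inr h
      · have := P.isDiagonal _ h
        simp only [IsDiagonal] at this
        omega
    · rintro (h | h)
      · exact absurd (no _ _ h) (by omega)
      · exact Or.inl h
  · refine ⟨?_, ?_⟩
    · rintro (h | h)
      · have := P.isDiagonal _ h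
        simp only [IsDiagonal] at this
        omega
      · exact Or.inl h
    · rintro (h | h)
      · exact Or.inr h
      · exact absurd (no _ _ h) (by omega)
  · exact Iff.rfl

/-- The polygon can be framed at any of its vertices. -/
theorem exists_rotation (P : FramedTriangulation) (r : ℤ) :
    ∃ Q : FramedTriangulation, Q.s = P.s ∧ ∀ u v, Q.Joined u v ↔ P.Joined (u + r) (v + r) := by
  have key : ∀ k : ℕ, ∃ Q : FramedTriangulation, Q.s = P.s ∧
      ∀ u v, Q.Joined u v ↔ P.Joined (u + k) (v + k) := by
    intro k
    induction k with
    | zero => exact ⟨P, rfl, by simp⟩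
    | succ k ih =>
      obtain ⟨Q, h1, h2⟩ := ih
      refine ⟨Q.rotOne, h1, fun u v => ?_⟩
      rw [joined_rotOne, h2]
      push_cast
      rw [add_assoc, add_assoc, add_comm 1 (k : ℤ)]
  obtain ⟨Q, h1, h2⟩ := key (P.res r)
  refine ⟨Q, h1, fun u v => ?_⟩
  rw [h2]
  apply joined_congr
  · rw [dvd_sub_comm]; exact dvd_of_eq_of_dvd (by ring) (P.dvd_sub_res r)
  · rw [dvd_sub_comm]; exact dvd_of_eq_of_dvd (by ring) (P.dvd_sub_res r)

theorem lind_rotation {P Q : FramedTriangulation} {r : ℤ} (hs : Q.s = P.s)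
    (h : ∀ u v, Q.Joined u v ↔ P.Joined (u + r) (v + r)) (v : ℤ) :
    Q.lind v = P.lind (v + r) :=
  lind_eq_of_joined hs (· + r) (· - r) (by simp) (by simp) (by simp) (by simp) h v

/-- The mirror image of a triangulation. -/
def mirror (P : FramedTriangulation) : FramedTriangulation :=
  P.transport (fun p => if p.1 = 0 then (0, P.s + 1 - p.2) else (P.s + 1 - p.2, P.s + 1 - p.1))
    (fun p => if p.1 = 0 then (0, P.s + 1 - p.2) else (P.s + 1 - p.2, P.s + 1 - p.1))
    (by
      rintro ⟨u, v⟩ h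
      simp only [IsDiagonal] at h ⊢
      split_ifs <;> (try simp only [false_and, true_and, not_false_eq_true, and_true]) <;> omega)
    (by
      rintro ⟨u, v⟩ h
      simp only [IsDiagonal] at h ⊢
      split_ifs <;> (try simp only [false_and, true_and, not_false_eq_true, and_true]) <;> omega)
    (by
      rintro ⟨u, v⟩ h
      simp only [IsDiagonal] at h
      by_cases h1 : u = 0
      · simp [h1]; omega
      · have h2 : P.s + 1 - v ≠ 0 := by omega
        simp only [h1, h2, if_false, Prod.mk.injEq]
        omega)
    (by
      rintro ⟨u, v⟩ ⟨u', v'⟩ h h'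
      simp only [IsDiagonal, Crosses] at h h' ⊢
      split_ifs <;> (try simp only [false_and, true_and, not_false_eq_true, and_true]) <;> omega)

theorem joined_mirror (P : FramedTriangulation) (u v : ℤ) :
    P.mirror.Joined u v ↔ P.Joined (-u) (-v) := by
  have hr : ∀ w, P.mirror.res w = P.res w := fun _ => rfl
  have key : ∀ u v : ℤ, P.mirror.Joined u v → P.Joined (-u) (-v) := by
    have key' : ∀ x y : ℤ, (P.res x, P.res y) ∈ P.mirror.diagonals → P.Joined (-x) (-y) := by
      intro x y hxy
      change (P.res x, P.res y) ∈ P.diagonals.image _ at hxy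
      obtain ⟨⟨a, b⟩, hab, h⟩ := Finset.mem_image.mp hxy
      have h1 := P.isDiagonal _ hab
      have hx := P.res_le x
      have hy := P.res_le y
      unfold Joined
      rw [res_neg, res_neg]
      simp only [IsDiagonal] at h1 h
      by_cases ha : a = 0
      · rw [if_pos ha, Prod.mk.injEq] at h
        left
        rw [if_pos (by omega), if_neg (by omega)]
        have : (0, P.s + 1 - P.res y) = (a, b) := by rw [Prod.mk.injEq]; omega
        rwa [this]
      · rw [if_neg ha, Prod.mk.injEq] at h
        right
        rw [if_neg (by omega), if_neg (by omega)]
        have : (P.s + 1 - P.res y, P.s + 1 - P.res x) = (a, b) := by rw [Prod.mk.injEq]; omega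
        rwa [this]
    intro u v h
    rcases h with h | h
    · exact key' u v h
    · exact (joined_comm _ _ _).mp (key' v u h)
  refine ⟨key u v, fun h => ?_⟩
  have hin : ∀ x y : ℕ, (x, y) ∈ P.diagonals → P.mirror.Joined (-x) (-y) := by
    intro x y hxy
    have h1 := P.isDiagonal _ hxy
    have h2 : _ ∈ P.mirror.diagonals := Finset.mem_image_of_mem _ hxy
    unfold Joined
    simp only [IsDiagonal] at h1
    rw [hr, hr, res_neg, res_neg, res_natCast _ _ (by omega), res_natCast _ _ (by omega)]
    by_cases ha : x = 0
    · left
      rw [if_pos ha, if_neg (by omega)]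
      simpa [ha] using h2
    · right
      rw [if_neg (by omega), if_neg ha]
      simpa [ha] using h2
  have hs : ((P.mirror.s : ℤ) + 1) = (P.s : ℤ) + 1 := rfl
  have e : ∀ w : ℤ, ((P.mirror.s : ℤ) + 1) ∣ -(P.res (-w) : ℤ) - w := by
    intro w
    rw [hs]
    exact dvd_of_eq_of_dvd (by ring) (P.dvd_sub_res (-w))
  rcases h with h | h
  · exact (joined_congr _ (e u) (e v)).mp (hin _ _ h)
  · exact (joined_comm _ _ _).mp ((joined_congr _ (e v) (e u)).mp (hin _ _ h))

theorem lind_mirror (P : FramedTriangulation) (v : ℤ) : P.mirror.lind v = P.lind (-v) :=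
  lind_eq_of_joined (P := P) (Q := P.mirror) rfl (- ·) (- ·) (by simp) (by simp)
    (fun u v h => by
      have := (dvd_neg (α := ℤ)).mpr h
      exact dvd_of_eq_of_dvd (by ring) this)
    (fun u v h => by
      have := (dvd_neg (α := ℤ)).mpr h
      exact dvd_of_eq_of_dvd (by ring) this) P.joined_mirror v

theorem extChain_eq (P : FramedTriangulation) :
    P.extChain = (List.range (P.s + 1)).map (fun k : ℕ => P.lind (k + 1)) := by
  unfold extChain chain
  rw [List.range_succ, List.map_append]
  congr 1
  · apply List.map_congr_left
    intro k hk
    rw [List.mem_range] at hk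
    rw [← P.lind_natCast (k + 1) (by omega)]
    push_cast; rfl
  · rw [hidden_eq_lind, List.map_singleton]
    congr 1
    apply lind_congr
    rw [zero_sub, dvd_neg]

theorem length_extChain (P : FramedTriangulation) : P.extChain.length = P.s + 1 := by
  simp [extChain_eq]

theorem getElem_extChain (P : FramedTriangulation) (k : ℕ) (hk : k < P.extChain.length) :
    P.extChain[k] = P.lind (k + 1) := by
  simp [extChain_eq]

theorem eq_of_lind_eq (P Q : FramedTriangulation) (hs : P.s = Q.s)
    (h : ∀ v, P.lind v = Q.lind v) : P = Q := by
  apply eq_of_index_eq P Q hs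
  intro v hv
  rw [← P.lind_natCast v hv, ← Q.lind_natCast v (hs ▸ hv), h]

theorem lind_eq_lind_res (P : FramedTriangulation) (v : ℤ) :
    P.lind v = P.lind ((P.res (v - 1) : ℤ) + 1) := by
  apply lind_congr
  exact dvd_of_eq_of_dvd (by ring) (P.dvd_sub_res (v - 1))

/-- Position k of the extended chain, counted from 0, carries `lind (k + 1)`, and the last position
is vertex s + 1, that is 0. Rotating the list is thus a translation of the periodic index function.
-/
theorem extChain_rotate_eq_iff (P Q : FramedTriangulation) (r : ℕ) :
    IsCyclicChange r P Q ↔ Q.s = P.s ∧ ∀ v, Q.lind v = P.lind (v + r) := by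
  unfold IsCyclicChange
  constructor
  · intro h
    have hl := congrArg List.length h
    rw [List.length_rotate, length_extChain, length_extChain] at hl
    have hs : Q.s = P.s := by omega
    refine ⟨hs, fun v => ?_⟩
    have hres := Q.res_le (v - 1)
    rw [lind_eq_lind_res, ← Q.getElem_extChain _ (by rw [length_extChain]; omega)]
    simp only [h]
    rw [List.getElem_rotate, getElem_extChain]
    apply lind_congr
    rw [length_extChain]
    push_cast
    have h1 : ((P.s : ℤ) + 1) ∣ ((Q.res (v - 1) : ℤ) + r) % ((P.s : ℤ) + 1)
      - ((Q.res (v - 1) : ℤ) + r) := Int.dvd_emod_sub_self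
    have h2 := Q.dvd_sub_res (v - 1)
    rw [hs] at h2
    exact dvd_of_eq_of_dvd (by ring) (dvd_sub h1 h2)
  · rintro ⟨hs, h⟩
    apply List.ext_getElem
    · rw [List.length_rotate, length_extChain, length_extChain, hs]
    · intro k h1 h2
      rw [getElem_extChain, List.getElem_rotate, getElem_extChain, h]
      apply lind_congr
      rw [length_extChain]
      push_cast
      have h1 : ((P.s : ℤ) + 1) ∣ ((k : ℤ) + r) - ((k : ℤ) + r) % ((P.s : ℤ) + 1) :=
        Int.dvd_self_sub_emod
      exact dvd_of_eq_of_dvd (by ring) h1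

end FramedTriangulation

end Wormhole

/-! ### Accordions from triangulations with two ears. -/

namespace Wormhole

namespace FramedTriangulation

/-- The definition of an accordion in terms of periodic diagonals. -/
def IsLiftedAccordion (P : FramedTriangulation) : Prop :=
  3 ≤ P.s ∧ ∃ (a : ℤ) (p : ℕ → ℕ), p 0 = 0 ∧ (∀ J, p (J + 1) = p J ∨ p (J + 1) = p J + 1) ∧
    ∀ u v, P.Joined u v ↔ ∃ J, J + 2 < P.s ∧
      ((((P.s : ℤ) + 1) ∣ u - (a - p J) ∧ ((P.s : ℤ) + 1) ∣ v - (a + 2 + (J - p J))) ∨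
       (((P.s : ℤ) + 1) ∣ v - (a - p J) ∧ ((P.s : ℤ) + 1) ∣ u - (a + 2 + (J - p J))))

theorem le_of_steps {p : ℕ → ℕ} (h0 : p 0 = 0)
    (h : ∀ J, p (J + 1) = p J ∨ p (J + 1) = p J + 1) (J : ℕ) : p J ≤ J := by
  induction J with
  | zero => omega
  | succ J ih => rcases h J with h | h <;> omega

theorem res_eq_mod_iff (P : FramedTriangulation) (u : ℤ) (k : ℕ) :
    P.res u = k % (P.s + 1) ↔ ((P.s : ℤ) + 1) ∣ u - k := by
  rw [← res_natCast_mod, res_eq_res_iff]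

theorem mem_or_mem_mkDiagonal (x y A B : ℕ) :
    ((min A B, max A B) = (x, y) ∨ (min A B, max A B) = (y, x)) ↔
      ((x = A ∧ y = B) ∨ (y = A ∧ x = B)) := by
  simp only [Prod.mk.injEq]
  omega

/-- The truncated subtractions in the definition are genuine because p J ≤ J, and the summand s + 1
disappears modulo s + 1. The integer base can be replaced by its residue. -/
theorem isAccordion_iff (P : FramedTriangulation) : P.IsAccordion ↔ P.IsLiftedAccordion := by
  constructor
  · rintro ⟨h3, a, p, ha, h0, hp, hD⟩
    refine ⟨h3, a, p, h0, hp, fun u v => ?_⟩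
    unfold Joined
    rw [hD, Finset.mem_image, Finset.mem_image, ← exists_or]
    apply exists_congr
    intro J
    rw [← and_or_left, Finset.mem_range, mkDiagonal, mem_or_mem_mkDiagonal, res_eq_mod_iff,
      res_eq_mod_iff, res_eq_mod_iff, res_eq_mod_iff]
    have hJ := le_of_steps h0 hp J
    have h1 : J < P.s - 2 ↔ J + 2 < P.s := by omega
    rw [h1]
    apply and_congr_right
    intro h2
    have e1 : ∀ w : ℤ, ((P.s : ℤ) + 1) ∣ w - ((a + (P.s + 1) - p J : ℕ) : ℤ) ↔
        ((P.s : ℤ) + 1) ∣ w - (a - p J) := by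
      intro w
      rw [Nat.cast_sub (by omega)]
      push_cast
      rw [show w - ((a : ℤ) + (P.s + 1) - p J) = w - (a - p J) - (P.s + 1) by ring,
        dvd_sub_self_right]
    have e2 : ((a + 2 + (J - p J) : ℕ) : ℤ) = a + 2 + (J - p J) := by
      rw [Nat.cast_add, Nat.cast_sub hJ]; push_cast; ring
    rw [e1, e1, e2]
  · rintro ⟨h3, a, p, h0, hp, hD⟩
    refine ⟨h3, P.res a, p, P.res_le a, h0, hp, ?_⟩
    have hmk : ∀ J, J + 2 < P.s → ∀ x y, x ≤ P.s → y ≤ P.s →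
        (((((P.s : ℤ) + 1) ∣ (x : ℤ) - (a - p J) ∧ ((P.s : ℤ) + 1) ∣ (y : ℤ) - (a + 2 + (J - p J))) ∨
        (((P.s : ℤ) + 1) ∣ (y : ℤ) - (a - p J) ∧
          ((P.s : ℤ) + 1) ∣ (x : ℤ) - (a + 2 + (J - p J)))) ↔
        (mkDiagonal (P.s + 1) (P.res a + (P.s + 1) - p J) (P.res a + 2 + (J - p J)) = (x, y) ∨
        mkDiagonal (P.s + 1) (P.res a + (P.s + 1) - p J) (P.res a + 2 + (J - p J)) = (y, x))) := by
      intro J h2 x y hx hy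
      have hJ := le_of_steps h0 hp J
      rw [mkDiagonal, mem_or_mem_mkDiagonal]
      have e1 : ∀ w : ℕ, w ≤ P.s → (w = (P.res a + (P.s + 1) - p J) % (P.s + 1) ↔
          ((P.s : ℤ) + 1) ∣ (w : ℤ) - (a - p J)) := by
        intro w hw
        rw [← P.res_natCast w hw, res_eq_mod_iff, Nat.cast_sub (by omega), P.res_natCast w hw]
        push_cast
        obtain ⟨k, hk⟩ := P.dvd_sub_res a
        rw [show (w : ℤ) - ((P.res a : ℤ) + (P.s + 1) - p J) =
          w - (a - p J) + (P.s + 1) * (k - 1) by linarith]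
        exact dvd_add_left (Dvd.intro _ rfl)
      have e2 : ∀ w : ℕ, w ≤ P.s → (w = (P.res a + 2 + (J - p J)) % (P.s + 1) ↔
          ((P.s : ℤ) + 1) ∣ (w : ℤ) - (a + 2 + (J - p J))) := by
        intro w hw
        rw [← P.res_natCast w hw, res_eq_mod_iff, Nat.cast_add, Nat.cast_sub hJ,
          P.res_natCast w hw]
        push_cast
        obtain ⟨k, hk⟩ := P.dvd_sub_res a
        rw [show (w : ℤ) - ((P.res a : ℤ) + 2 + (J - p J)) =
          w - (a + 2 + (J - p J)) + (P.s + 1) * k by linarith]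
        exact dvd_add_left (Dvd.intro _ rfl)
      rw [e1 x hx, e1 y hy, e2 x hx, e2 y hy]
    have hlt : ∀ p ∈ P.diagonals, p.1 < p.2 ∧ p.2 ≤ P.s := by
      intro p hp
      have := P.isDiagonal p hp
      simp only [IsDiagonal] at this
      omega
    ext ⟨x, y⟩
    rw [Finset.mem_image]
    constructor
    · intro hxy
      have h1 := hlt _ hxy
      simp only at h1
      have h2 := (P.joined_natCast h1.1 h1.2).mpr hxy
      rw [hD] at h2
      obtain ⟨J, hJ, h2⟩ := h2
      rw [hmk J hJ x y (by omega) h1.2] at h2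
      refine ⟨J, by simp; omega, ?_⟩
      rcases h2 with h2 | h2
      · exact h2
      · simp only [mkDiagonal, Prod.mk.injEq] at h2; omega
    · rintro ⟨J, hJ, h⟩
      rw [Finset.mem_range] at hJ
      have h0x : x ≤ y ∧ y ≤ P.s := by
        simp only [mkDiagonal, Prod.mk.injEq] at h
        have h1 := Nat.mod_lt (P.res a + (P.s + 1) - p J) (show 0 < P.s + 1 by omega)
        have h2 := Nat.mod_lt (P.res a + 2 + (J - p J)) (show 0 < P.s + 1 by omega)
        omega
      have h1 : P.Joined x y :=
        (hD x y).mpr ⟨J, by omega, (hmk J (by omega) x y (by omega) h0x.2).mpr (Or.inl h)⟩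
      unfold Joined at h1
      rw [P.res_natCast x (by omega), P.res_natCast y (by omega)] at h1
      rcases h1 with h1 | h1
      · exact h1
      · have := hlt _ h1
        simp only at this
        omega

theorem IsLiftedAccordion.of_rotation {P Q : FramedTriangulation} {r : ℤ} (hs : Q.s = P.s)
    (h : ∀ u v, Q.Joined u v ↔ P.Joined (u + r) (v + r)) (hQ : Q.IsLiftedAccordion) :
    P.IsLiftedAccordion := by
  obtain ⟨h3, a, p, h0, hp, hD⟩ := hQ
  refine ⟨hs ▸ h3, a + r, p, h0, hp, fun u v => ?_⟩
  have h1 := h (u - r) (v - r)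
  rw [sub_add_cancel, sub_add_cancel] at h1
  rw [← h1, hD, hs]
  apply exists_congr
  intro J
  have e1 : ∀ w : ℤ, w - r - (a - p J) = w - (a + r - p J) := fun w => by ring
  have e2 : ∀ w : ℤ, w - r - (a + 2 + (J - p J)) = w - (a + r + 2 + (J - p J)) :=
    fun w => by ring
  rw [e1, e1, e2, e2]

/-- Exactly two vertices have index one. -/
def HasTwoEars (P : FramedTriangulation) : Prop :=
  ∃ e e' : ℤ, ¬ ((P.s : ℤ) + 1) ∣ e - e' ∧
    ∀ v, P.lind v = 1 ↔ ((P.s : ℤ) + 1) ∣ v - e ∨ ((P.s : ℤ) + 1) ∣ v - e'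

theorem not_joined_of_lind_eq_one {P : FramedTriangulation} {v : ℤ} (h : P.lind v = 1) (w : ℤ) :
    ¬ P.Joined v w := by
  rw [lind, index_eq_one_iff] at h
  rintro (h' | h')
  · exact (h _ h').1 rfl
  · exact (h _ h').2 rfl

theorem mem_of_index_zero (P : FramedTriangulation) (h3 : 3 ≤ P.s) (h : P.index 0 = 1) :
    (1, P.s) ∈ P.diagonals := by
  rw [index_eq_one_iff] at h
  apply P.maximal
  · simp only [IsDiagonal]; omega
  · rintro ⟨u, v⟩ hq
    have h1 := h _ hq
    have h2 := P.isDiagonal _ hq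
    simp only [Crosses, IsDiagonal] at *
    omega

/-- There are at least two ears. -/
theorem exists_two_ears (P : FramedTriangulation) (h3 : 3 ≤ P.s) :
    ∃ e e' : ℤ, ¬ ((P.s : ℤ) + 1) ∣ e - e' ∧ P.lind e = 1 ∧ P.lind e' = 1 := by
  obtain ⟨e, h0, h2, he⟩ := P.exists_ear_between 0 P.s (Or.inr ⟨rfl, rfl, h3⟩)
  -- Frame the polygon at the first ear: then (1, s) is a diagonal, and a second ear lies below it.
  obtain ⟨Q, hs, hQ⟩ := P.exists_rotation e
  have hl := lind_rotation hs hQ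
  have hQ0 : Q.index 0 = 1 := by
    have := hl 0
    rw [zero_add, P.lind_natCast e h2.le, he] at this
    rw [← this]
    exact (Q.lind_natCast 0 (by omega)).symm
  obtain ⟨f, h5, h6, hf⟩ := Q.exists_ear_between 1 Q.s
    (Or.inl (Q.mem_of_index_zero (hs ▸ h3) hQ0))
  refine ⟨(f : ℤ) + e, e, ?_, ?_, by rw [P.lind_natCast e h2.le, he]⟩
  · rw [add_sub_cancel_right]
    intro hd
    have := Int.le_of_dvd (by omega) hd
    omega
  · rw [← hl, Q.lind_natCast f h6.le, hf]

/-- With 0 an ear, all diagonals live on the vertices 1, …, s. Two of them side by side would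
enclose two different ears, so they are nested. Hence there is exactly one diagonal of each width
from 2 to s - 1, and passing to the next width moves a single end by one. -/
theorem isLiftedAccordion_of_ear_zero (P : FramedTriangulation) (h3 : 3 ≤ P.s)
    (h0 : P.index 0 = 1)
    (hu : ∀ v w, 1 ≤ v → v ≤ P.s → 1 ≤ w → w ≤ P.s → P.index v = 1 → P.index w = 1 → v = w) :
    P.IsLiftedAccordion := by
  have htop := P.mem_of_index_zero h3 h0
  have hpos : ∀ u v, (u, v) ∈ P.diagonals → 1 ≤ u ∧ u + 2 ≤ v ∧ v ≤ P.s := by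
    intro u v h
    rw [index_eq_one_iff] at h0
    have h1 := h0 _ h
    have h2 := P.isDiagonal _ h
    simp only [IsDiagonal] at *
    omega
  have hear : ∀ l r l' r', (l, r) ∈ P.diagonals → (l', r') ∈ P.diagonals → ¬ r ≤ l' := by
    intro l r l' r' h h' hr
    obtain ⟨e, h1, h2, he⟩ := P.exists_ear_between l r (Or.inl h)
    obtain ⟨f, h4, h5, hf⟩ := P.exists_ear_between l' r' (Or.inl h')
    have := hpos _ _ h
    have := hpos _ _ h'
    have := hu e f (by omega) (by omega) (by omega) (by omega) he hf
    omega
  have huniq : ∀ l l' T, (l, l + T) ∈ P.diagonals → (l', l' + T) ∈ P.diagonals → l = l' := by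
    have key : ∀ l l' T, (l, l + T) ∈ P.diagonals → (l', l' + T) ∈ P.diagonals → ¬ l < l' := by
      intro l l' T h h' hlt
      have h1 := P.nonCrossing _ h _ h'
      have h2 := hear _ _ _ _ h h'
      simp only [Crosses] at h1
      omega
    intro l l' T h h'
    have := key _ _ _ h h'
    have := key _ _ _ h' h
    omega
  have hstep : ∀ l T, 2 ≤ T → (l, l + (T + 1)) ∈ P.diagonals →
      (l + 1, l + 1 + T) ∈ P.diagonals ∨ (l, l + T) ∈ P.diagonals := by
    intro l T hT h
    by_contra hcon
    push Not at hcon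
    obtain ⟨hc1, hc2⟩ := hcon
    have hb := hpos _ _ h
    have hin : ∀ u v, (u, v) ∈ P.diagonals → ¬ Crosses (u, v) (l, l + (T + 1)) :=
      fun u v h' => P.nonCrossing _ h' _ h
    -- A diagonal that obstructs the first shortening starts at l; one that obstructs the second
    -- ends at l + T + 1. Since they do not cross, they lie side by side, which `hear` forbids.
    have h1 : ∃ q ∈ P.diagonals, Crosses (l + 1, l + 1 + T) q := by
      by_contra hno
      push Not at hno
      exact hc1 (P.maximal _ (by simp only [IsDiagonal]; omega) hno)
    have h2 : ∃ q ∈ P.diagonals, Crosses (l, l + T) q := by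
      by_contra hno
      push Not at hno
      exact hc2 (P.maximal _ (by simp only [IsDiagonal]; omega) hno)
    obtain ⟨⟨u, v⟩, hq, hcr⟩ := h1
    obtain ⟨⟨u', v'⟩, hq', hcr'⟩ := h2
    have a1 := hin _ _ hq
    have a2 := hin _ _ hq'
    have a3 := P.nonCrossing _ hq _ hq'
    have a4 := hear _ _ _ _ hq hq'
    have a5 := hpos _ _ hq
    have a6 := hpos _ _ hq'
    simp only [Crosses] at hcr hcr' a1 a2 a3
    omega
  have hex : ∀ d, d + 2 ≤ P.s - 1 → ∃ l, (l, l + (P.s - 1 - d)) ∈ P.diagonals := by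
    intro d
    induction d with
    | zero =>
      intro _
      refine ⟨1, ?_⟩
      rwa [show 1 + (P.s - 1 - 0) = P.s by omega]
    | succ d ih =>
      intro hd
      obtain ⟨l, hl⟩ := ih (by omega)
      rw [show P.s - 1 - d = (P.s - 1 - (d + 1)) + 1 by omega] at hl
      rcases hstep l _ (by omega) hl with h | h
      · exact ⟨_, h⟩
      · exact ⟨_, h⟩
  have hex' : ∀ T, ∃ l, 2 ≤ T → T ≤ P.s - 1 → (l, l + T) ∈ P.diagonals := by
    intro T
    by_cases hT : 2 ≤ T ∧ T ≤ P.s - 1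
    · obtain ⟨l, hl⟩ := hex (P.s - 1 - T) (by omega)
      rw [show P.s - 1 - (P.s - 1 - T) = T by omega] at hl
      exact ⟨l, fun _ _ => hl⟩
    · exact ⟨0, fun _ _ => by omega⟩
  choose l hl using hex'
  have hls : ∀ T, 2 ≤ T → T + 1 ≤ P.s - 1 → l T = l (T + 1) ∨ l T = l (T + 1) + 1 := by
    intro T h1 h2
    rcases hstep _ T h1 (hl (T + 1) (by omega) h2) with h | h
    · exact Or.inr (huniq _ _ _ (hl T h1 (by omega)) h)
    · exact Or.inl (huniq _ _ _ (hl T h1 (by omega)) h)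
  have hle : ∀ j, j + 2 ≤ P.s - 1 → l (j + 2) ≤ l 2 := by
    intro j
    induction j with
    | zero => intro _; exact le_rfl
    | succ j ih =>
      intro hj
      have h1 := ih (by omega)
      have h2 := hls (j + 2) (by omega) (by omega)
      rw [show j + 1 + 2 = j + 2 + 1 by omega]
      omega
  -- Step j has width j + 2, and p counts the moves of the left end. The minimum freezes p beyond
  -- the last diagonal, since the step condition is required for every index.
  refine ⟨h3, l 2, fun j => l 2 - l (min (j + 2) (P.s - 1)), ?_, ?_, ?_⟩
  · simp only
    rw [show min (0 + 2) (P.s - 1) = 2 by omega]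
    omega
  · intro j
    simp only
    by_cases hj : j + 3 ≤ P.s - 1
    · rw [show min (j + 2) (P.s - 1) = j + 2 by omega,
        show min (j + 1 + 2) (P.s - 1) = j + 2 + 1 by omega]
      have h1 := hle j (by omega)
      have h2 := hle (j + 1) (by omega)
      rw [show j + 1 + 2 = j + 2 + 1 by omega] at h2
      have h4 := hls (j + 2) (by omega) (by omega)
      omega
    · left
      congr 2
      omega
  · intro u v
    have key : ∀ x y : ℕ, x ≤ P.s → y ≤ P.s → ((x, y) ∈ P.diagonals ↔ ∃ J, J + 2 < P.s ∧
        (x : ℤ) = (l 2 : ℤ) - ((l 2 - l (min (J + 2) (P.s - 1)) : ℕ) : ℤ) ∧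
        (y : ℤ) = (l 2 : ℤ) + 2 + (J - ((l 2 - l (min (J + 2) (P.s - 1)) : ℕ) : ℤ))) := by
      intro x y hx hy
      constructor
      · intro h
        have h1 := hpos _ _ h
        have h2 : x = l (y - x) := by
          apply huniq x (l (y - x)) (y - x) _ (hl _ (by omega) (by omega))
          rwa [show x + (y - x) = y by omega]
        have h4 := hle (y - x - 2) (by omega)
        rw [show y - x - 2 + 2 = y - x by omega] at h4
        refine ⟨y - x - 2, by omega, ?_⟩
        rw [show min (y - x - 2 + 2) (P.s - 1) = y - x by omega]
        omega
      · rintro ⟨J, hJ, h1, h2⟩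
        rw [show min (J + 2) (P.s - 1) = J + 2 by omega] at h1 h2
        have h4 := hle J (by omega)
        have h5 := hl (J + 2) (by omega) (by omega)
        have h6 : x = l (J + 2) := by omega
        have h7 : y = l (J + 2) + (J + 2) := by omega
        rw [h6, h7]
        exact h5
    unfold Joined
    rw [key _ _ (P.res_le u) (P.res_le v), key _ _ (P.res_le v) (P.res_le u), ← exists_or]
    apply exists_congr
    intro J
    rw [← and_or_left]
    apply and_congr_right
    intro hJ
    have h4 := hle J (by omega)
    have h5 := hpos _ _ (hl (J + 2) (by omega) (by omega))
    have e : min (J + 2) (P.s - 1) = J + 2 := by omega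
    simp only [e]
    have e1 : (l 2 : ℤ) - ((l 2 - l (J + 2) : ℕ) : ℤ) = (l (J + 2) : ℕ) := by omega
    have e2 : (l 2 : ℤ) + 2 + (J - ((l 2 - l (J + 2) : ℕ) : ℤ)) =
        ((l (J + 2) + (J + 2) : ℕ) : ℤ) := by omega
    rw [e1, e2, Nat.cast_inj, Nat.cast_inj, Nat.cast_inj, Nat.cast_inj,
      P.res_eq_iff u _ (by omega), P.res_eq_iff v _ (by omega),
      P.res_eq_iff u _ (by omega), P.res_eq_iff v _ (by omega)]

/-- A triangulation with exactly two ears is an accordion. -/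
theorem HasTwoEars.isAccordion {P : FramedTriangulation} (h3 : 3 ≤ P.s) (h : P.HasTwoEars) :
    P.IsAccordion := by
  obtain ⟨e, e', hee, h⟩ := h
  obtain ⟨Q, hs, hQ⟩ := P.exists_rotation e
  have hl := lind_rotation hs hQ
  rw [isAccordion_iff]
  refine IsLiftedAccordion.of_rotation hs hQ ?_
  apply isLiftedAccordion_of_ear_zero Q (hs ▸ h3)
  · have h1 := Q.lind_natCast 0 (by omega)
    rw [← h1, Nat.cast_zero, hl, zero_add, h]
    simp
  · have key : ∀ v : ℕ, 1 ≤ v → v ≤ Q.s → Q.index v = 1 → ((P.s : ℤ) + 1) ∣ (v : ℤ) + e - e' := by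
      intro v h1 h2 h4
      rw [← Q.lind_natCast v h2, hl, h] at h4
      rcases h4 with h4 | h4
      · rw [add_sub_cancel_right] at h4
        have := Int.le_of_dvd (by omega) h4
        omega
      · exact h4
    intro v w h1 h2 h1' h2' hv hw
    have h4 := dvd_sub (key v h1 h2 hv) (key w h1' h2' hw)
    have h5 := (P.res_eq_res_iff v w).mpr (dvd_of_eq_of_dvd (by ring) h4)
    rwa [P.res_natCast v (hs ▸ h2), P.res_natCast w (hs ▸ h2')] at h5

end FramedTriangulation

end Wormhole

/-! ### Symmetric staircases. -/

namespace Wormhole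

/-- A monotone staircase on `[0, N]` extends to a staircase on `ℤ` which is symmetric under the
exchange of the two ends `u T` and `u T + T` and under rotations by `N`. -/
theorem exists_staircase_extension (N : ℤ) (hN : 0 < N) (w : ℤ → ℤ)
    (hw : ∀ T, 0 ≤ T → T < N → w (T + 1) = w T ∨ w (T + 1) = w T - 1) :
    ∃ u : ℤ → ℤ, (∀ T, 0 ≤ T → T ≤ N → u T = w T) ∧
      (∀ T, u (T + 1) = u T ∨ u (T + 1) = u T - 1) ∧ (∀ T, u (-T) = u T + T) ∧
      ∀ k T, u (T + 2 * N * k) = u T - N * k := by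
  -- The values on [N, 2N] are forced by the two symmetries: u r = u (-(2N - r)) - N = u (2N - r) +
  -- (N - r).
  let base : ℤ → ℤ := fun r => if r ≤ N then w r else w (2 * N - r) + (N - r)
  let u : ℤ → ℤ := fun T => base (T % (2 * N)) - N * (T / (2 * N))
  have hper : ∀ k T, u (T + 2 * N * k) = u T - N * k := by
    intro k T
    simp only [u]
    rw [Int.add_mul_emod_self_left, Int.add_mul_ediv_left _ _ (by omega)]
    ring
  have hu0 : ∀ r, 0 ≤ r → r < 2 * N → u r = base r := by
    intro r h1 h2
    simp only [u]
    rw [Int.emod_eq_of_lt h1 h2, Int.ediv_eq_zero_of_lt h1 h2]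
    ring
  have hu1 : ∀ r, 0 ≤ r → r ≤ 2 * N → u r = base r := by
    intro r h1 h2
    rcases lt_or_eq_of_le h2 with h | rfl
    · exact hu0 r h1 h
    · have h3 := hper 1 0
      rw [zero_add, mul_one] at h3
      rw [h3, hu0 0 le_rfl (by omega)]
      simp only [base]
      rw [if_pos (by omega), if_neg (by omega), sub_self]
      ring
  have hdiv : ∀ T : ℤ, ∃ q r, 0 ≤ r ∧ r < 2 * N ∧ T = r + 2 * N * q := fun T =>
    ⟨T / (2 * N), T % (2 * N), Int.emod_nonneg _ (by omega), Int.emod_lt_of_pos _ (by omega),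
      (Int.emod_add_mul_ediv T (2 * N)).symm⟩
  refine ⟨u, ?_, ?_, ?_, hper⟩
  · intro T h1 h2
    rw [hu1 T h1 (by omega)]
    exact if_pos h2
  · intro T
    obtain ⟨q, r, h1, h2, rfl⟩ := hdiv T
    rw [show r + 2 * N * q + 1 = r + 1 + 2 * N * q by ring, hper, hper, hu1 r h1 h2.le,
      hu1 (r + 1) (by omega) (by omega)]
    have : base (r + 1) = base r ∨ base (r + 1) = base r - 1 := by
      simp only [base]
      by_cases h3 : r + 1 ≤ N
      · rw [if_pos h3, if_pos (by omega)]
        exact hw r h1 (by omega)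
      · have h4 := hw (2 * N - (r + 1)) (by omega) (by omega)
        rw [show 2 * N - (r + 1) + 1 = 2 * N - r by ring] at h4
        rw [if_neg h3]
        by_cases h5 : r = N
        · subst h5
          rw [if_pos le_rfl]
          rw [show 2 * r - r = r by ring] at h4
          omega
        · rw [if_neg (by omega)]
          omega
    omega
  · intro T
    obtain ⟨q, r, h1, h2, rfl⟩ := hdiv T
    rw [show -(r + 2 * N * q) = 2 * N - r + 2 * N * (-q - 1) by ring, hper, hper, hu1 r h1 h2.le,
      hu1 (2 * N - r) (by omega) (by omega)]
    have : base (2 * N - r) + N = base r + r := by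
      simp only [base]
      rcases lt_trichotomy r N with h | h | h
      · rw [if_neg (by omega), if_pos (by omega), show 2 * N - (2 * N - r) = r by ring]
        ring
      · subst h
        rw [if_pos (by omega), if_pos (by omega), show 2 * r - r = r by ring]
      · rw [if_pos (by omega), if_neg (by omega)]
        ring
    linarith

namespace FramedTriangulation

/-- The diagonals of an accordion form a staircase `T ↦ (u T, u T + T)`. -/
structure IsStaircase (P : FramedTriangulation) (u : ℤ → ℤ) : Prop where
  step : ∀ T, u (T + 1) = u T ∨ u (T + 1) = u T - 1
  neg : ∀ T, u (-T) = u T + T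
  per : ∀ k T, u (T + 2 * ((P.s : ℤ) + 1) * k) = u T - ((P.s : ℤ) + 1) * k
  corner : ∀ k, u (((P.s : ℤ) + 1) * k) - u (((P.s : ℤ) + 1) * k + 1) =
      u (((P.s : ℤ) + 1) * k + 1) - u (((P.s : ℤ) + 1) * k + 2) ∧
    u (((P.s : ℤ) + 1) * k + 1) - u (((P.s : ℤ) + 1) * k + 2) =
      u (((P.s : ℤ) + 1) * k + 2) - u (((P.s : ℤ) + 1) * k + 3)
  joined : ∀ α β, P.Joined α β ↔ ∃ T, u T = α ∧ ((P.s : ℤ) + 1) ∣ β - (α + T) ∧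
    ¬ ((P.s : ℤ) + 1) ∣ T ∧ ¬ ((P.s : ℤ) + 1) ∣ T - 1 ∧ ¬ ((P.s : ℤ) + 1) ∣ T + 1

theorem not_dvd_of_mem {N T : ℤ} (h1 : 2 ≤ T) (h2 : T ≤ N - 2) :
    ¬ N ∣ T ∧ ¬ N ∣ T - 1 ∧ ¬ N ∣ T + 1 := by
  refine ⟨fun h => ?_, fun h => ?_, fun h => ?_⟩ <;>
    · have := Int.le_of_dvd (by omega) h
      omega

/-- The diagonal of width T, for 2 ≤ T ≤ N - 2, has left end a - p (T - 2). The widths 0, 1, N - 1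
and N belong to no diagonal; there the first and the last step are continued linearly, so that
`corner` holds. The remaining widths come from exchanging ends and from full turns. -/
theorem IsLiftedAccordion.exists_isStaircase {P : FramedTriangulation}
    (h : P.IsLiftedAccordion) (h4 : 4 ≤ P.s) : ∃ u, P.IsStaircase u := by
  obtain ⟨-, a, p, h0, hp, hD⟩ := h
  obtain ⟨N, hN⟩ : ∃ N : ℤ, N = (P.s : ℤ) + 1 := ⟨_, rfl⟩
  have hN5 : 5 ≤ N := by omega
  -- The step after width 2 and, in `d₁`, the step before width N - 2; both exist because s ≥ 4.
  let d₀ : ℤ := p 1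
  let d₁ : ℤ := p (P.s - 3) - p (P.s - 4)
  have hd₀ : d₀ = 0 ∨ d₀ = 1 := by
    have := hp 0
    rw [zero_add] at this
    simp only [d₀]; omega
  have hd₁ : d₁ = 0 ∨ d₁ = 1 := by
    have := hp (P.s - 4)
    rw [show P.s - 4 + 1 = P.s - 3 by omega] at this
    simp only [d₁]; omega
  let w : ℤ → ℤ := fun T => if T < 2 then a + (2 - T) * d₀ else
    if T ≤ N - 2 then a - p (T - 2).toNat else a - p (P.s - 3) - (T - (N - 2)) * d₁
  have hw1 : ∀ T, T ≤ 2 → w T = a + (2 - T) * d₀ := by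
    intro T hT
    simp only [w]
    rcases lt_or_eq_of_le hT with h | rfl
    · rw [if_pos h]
    · rw [if_neg (by omega), if_pos (by omega)]
      simp [h0]
  have hw2 : ∀ J : ℕ, J + 2 < P.s → w (J + 2) = a - p J := by
    intro J hJ
    simp only [w]
    rw [if_neg (by omega), if_pos (by omega)]
    simp
  have hw3 : ∀ T, N - 2 ≤ T → w T = a - p (P.s - 3) - (T - (N - 2)) * d₁ := by
    intro T hT
    rcases lt_or_eq_of_le hT with h | rfl
    · simp only [w]
      rw [if_neg (by omega), if_neg (by omega)]
    · have := hw2 (P.s - 3) (by omega)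
      rw [show ((P.s - 3 : ℕ) : ℤ) + 2 = N - 2 by omega] at this
      rw [this]; ring
  obtain ⟨u, hu, hstep, hneg, hper⟩ := exists_staircase_extension N (by omega) w (by
    intro T h1 h2
    by_cases h3 : T < 2
    · rw [hw1 T (by omega), hw1 (T + 1) (by omega),
        show a + (2 - (T + 1)) * d₀ = a + (2 - T) * d₀ - d₀ by ring]
      omega
    by_cases h5 : T < N - 2
    · obtain ⟨J, rfl⟩ : ∃ J : ℕ, T = J + 2 := ⟨(T - 2).toNat, by omega⟩
      have e1 := hw2 J (by omega)
      have e2 := hw2 (J + 1) (by omega)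
      have := hp J
      rw [show ((J + 1 : ℕ) : ℤ) + 2 = J + 2 + 1 by push_cast; ring] at e2
      omega
    · rw [hw3 T (by omega), hw3 (T + 1) (by omega),
        show a - (p (P.s - 3) : ℤ) - (T + 1 - (N - 2)) * d₁ =
          a - (p (P.s - 3) : ℤ) - (T - (N - 2)) * d₁ - d₁ by ring]
      omega)
  have huJ : ∀ J : ℕ, J + 2 < P.s → u (J + 2) = a - p J := by
    intro J hJ
    rw [hu _ (by omega) (by omega), hw2 J hJ]
  refine ⟨u, hstep, hneg, by rw [← hN]; exact hper, ?_, ?_⟩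
  · rw [← hN]
    have c0 : u 0 - u 1 = u 1 - u 2 ∧ u 1 - u 2 = u 2 - u 3 := by
      have e0 := hw1 0 (by omega)
      have e1 := hw1 1 (by omega)
      have e2 := hw1 2 (by omega)
      have e3 := hw2 1 (by omega)
      rw [hu 0 (by omega) (by omega), hu 1 (by omega) (by omega), hu 2 (by omega) (by omega),
        hu 3 (by omega) (by omega)]
      norm_num at e0 e1 e2 e3
      rw [e0, e1, e2, e3]
      constructor <;> ring
    have c1 : u N - u (N - 1) = u (N - 1) - u (N - 2) ∧
        u (N - 1) - u (N - 2) = u (N - 2) - u (N - 3) := by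
      have e0 := hw3 N (by omega)
      have e1 := hw3 (N - 1) (by omega)
      have e2 := hw3 (N - 2) (by omega)
      have e3 := hw2 (P.s - 4) (by omega)
      rw [show ((P.s - 4 : ℕ) : ℤ) + 2 = N - 3 by omega] at e3
      rw [hu _ (by omega) (by omega), hu _ (by omega) (by omega), hu _ (by omega) (by omega),
        hu _ (by omega) (by omega), e0, e1, e2, e3]
      constructor
      · ring
      · simp only [d₁]; ring
    -- Reflection at N transfers the equality of steps from the left of the corner to its right.
    have hrefl : ∀ t, u (N + t) = u (N - t) - t := by
      intro t
      have e1 := hper 1 (-(N - t))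
      have e2 := hneg (N - t)
      rw [show -(N - t) + 2 * N * 1 = N + t by ring] at e1
      rw [e1, e2]; ring
    have c2 : u N - u (N + 1) = u (N + 1) - u (N + 2) ∧
        u (N + 1) - u (N + 2) = u (N + 2) - u (N + 3) := by
      have r1 := hrefl 1
      have r2 := hrefl 2
      have r3 := hrefl 3
      omega
    intro k
    rcases Int.even_or_odd' k with ⟨q, rfl | rfl⟩
    · have e : ∀ t, u (N * (2 * q) + t) = u t - N * q := by
        intro t
        rw [show N * (2 * q) + t = t + 2 * N * q by ring, hper]
      have e0 := e 0
      rw [add_zero] at e0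
      rw [e0, e, e, e]
      omega
    · have e : ∀ t, u (N * (2 * q + 1) + t) = u (N + t) - N * q := by
        intro t
        rw [show N * (2 * q + 1) + t = N + t + 2 * N * q by ring, hper]
      have e0 := e 0
      rw [add_zero, add_zero] at e0
      rw [e0, e, e, e]
      omega
  · intro α β
    rw [hD, ← hN]
    constructor
    · rintro ⟨J, hJ, ⟨⟨k, hk⟩, h2⟩ | ⟨h2, ⟨k, hk⟩⟩⟩
      · have hg := not_dvd_of_mem (N := N) (T := J + 2) (by omega) (by omega)
        refine ⟨J + 2 + 2 * N * (-k), ?_, ?_, ?_, ?_, ?_⟩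
        · rw [hper, huJ J hJ]; linarith
        · refine dvd_of_eq_of_dvd ?_ (dvd_add h2 (Dvd.intro k rfl))
          linarith
        · intro hd
          exact hg.1 (dvd_of_eq_of_dvd (by ring) (dvd_add hd (Dvd.intro (2 * k) rfl)))
        · intro hd
          exact hg.2.1 (dvd_of_eq_of_dvd (by ring) (dvd_add hd (Dvd.intro (2 * k) rfl)))
        · intro hd
          exact hg.2.2 (dvd_of_eq_of_dvd (by ring) (dvd_add hd (Dvd.intro (2 * k) rfl)))
      · have hg := not_dvd_of_mem (N := N) (T := J + 2) (by omega) (by omega)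
        refine ⟨-(J + 2) + 2 * N * (-k), ?_, ?_, ?_, ?_, ?_⟩
        · rw [hper, hneg, huJ J hJ]; linarith
        · refine dvd_of_eq_of_dvd ?_ (dvd_add h2 (Dvd.intro k rfl))
          linarith
        · intro hd
          exact hg.1 (dvd_of_eq_of_dvd (by ring) (dvd_add hd (Dvd.intro (2 * k) rfl)).neg_right)
        · intro hd
          exact hg.2.2 (dvd_of_eq_of_dvd (by ring) (dvd_add hd (Dvd.intro (2 * k) rfl)).neg_right)
        · intro hd
          exact hg.2.1 (dvd_of_eq_of_dvd (by ring) (dvd_add hd (Dvd.intro (2 * k) rfl)).neg_right)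
    · rintro ⟨T, rfl, h2, h3, h5, h6⟩
      -- Modulo 2N, a width r < N is a diagonal read from its first end, and a width r > N is one
      -- read backwards.
      obtain ⟨q, r, hr0, hr1, rfl⟩ : ∃ q r, 0 ≤ r ∧ r < 2 * N ∧ T = r + 2 * N * q :=
        ⟨T / (2 * N), T % (2 * N), Int.emod_nonneg _ (by omega), Int.emod_lt_of_pos _ (by omega),
        (Int.emod_add_mul_ediv T (2 * N)).symm⟩
      have hbad : ∀ j, (N ∣ j → N ∣ j + 2 * N * q) := fun j hj =>
        dvd_add hj ⟨2 * q, by ring⟩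
      have b : r ≠ 0 ∧ r ≠ 1 ∧ r ≠ N - 1 ∧ r ≠ N ∧ r ≠ N + 1 ∧ r ≠ 2 * N - 1 := by
        refine ⟨?_, ?_, ?_, ?_, ?_, ?_⟩
        · rintro rfl; exact h3 (hbad 0 (dvd_zero _))
        · rintro rfl; exact h5 (dvd_of_eq_of_dvd (by ring) (hbad 0 (dvd_zero _)))
        · rintro rfl; exact h6 (dvd_of_eq_of_dvd (by ring) (hbad N dvd_rfl))
        · rintro rfl; exact h3 (hbad _ dvd_rfl)
        · rintro rfl; exact h5 (dvd_of_eq_of_dvd (by ring) (hbad N dvd_rfl))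
        · rintro rfl; exact h6 (dvd_of_eq_of_dvd (by ring) (hbad (2 * N) ⟨2, by ring⟩))
      by_cases hr : r ≤ N
      · obtain ⟨J, rfl⟩ : ∃ J : ℕ, r = J + 2 := ⟨(r - 2).toNat, by omega⟩
        refine ⟨J, by omega, Or.inl ⟨?_, ?_⟩⟩
        · rw [hper, huJ J (by omega)]
          exact ⟨-q, by ring⟩
        · refine dvd_of_eq_of_dvd ?_ (dvd_add h2 (Dvd.intro q rfl))
          rw [hper, huJ J (by omega)]
          ring
      · obtain ⟨J, rfl⟩ : ∃ J : ℕ, r = 2 * N - (J + 2) := ⟨(2 * N - r - 2).toNat, by omega⟩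
        have e : u (2 * N - (J + 2) + 2 * N * q) = a - p J + (J + 2) - N * (q + 1) := by
          rw [show 2 * N - ((J : ℤ) + 2) + 2 * N * q = -(J + 2) + 2 * N * (q + 1) by ring, hper,
            hneg, huJ J (by omega)]
        rw [e] at h2 ⊢
        refine ⟨J, by omega, Or.inr ⟨?_, ?_⟩⟩
        · refine dvd_of_eq_of_dvd ?_ (dvd_add h2 (Dvd.intro (q + 1) rfl))
          ring
        · exact ⟨-(q + 1), by ring⟩

end FramedTriangulation

/-- In a symmetric staircase the columns with at least two points have coherent positions. -/
theorem exists_fiber_of_staircase {N : ℤ} (hN : 0 < N) {u J : ℤ → ℤ}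
    (step : ∀ T, u (T + 1) = u T ∨ u (T + 1) = u T - 1) (neg : ∀ T, u (-T) = u T + T)
    (per : ∀ k T, u (T + 2 * N * k) = u T - N * k) (hJ : StrictMono J)
    (hr : ∀ w, (∃ T, u T = w ∧ u (T + 1) = w) ↔ ∃ i, J i = w) :
    ∃ c, ∀ i T, u T = J i ↔ J (c - i) ≤ J i + T ∧ J i + T ≤ J (c - i + 1) := by
  have anti : ∀ S T, S ≤ T → u T ≤ u S := by
    intro S T h
    induction T, h using Int.leInduction with
    | base => exact le_rfl
    | succ T _ ih => rcases step T with h | h <;> omega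
  have lip : ∀ S T, S ≤ T → u S ≤ u T + (T - S) := by
    intro S T h
    induction T, h using Int.leInduction with
    | base => omega
    | succ T _ ih => rcases step T with h | h <;> omega
  -- Since u is monotone and unbounded in both directions, each column is a bounded interval; over a
  -- weight it has at least two points.
  have hfib : ∀ i, ∃ A B, A < B ∧ ∀ T, u T = J i ↔ A ≤ T ∧ T ≤ B := by
    intro i
    obtain ⟨T₀, h1, h2⟩ := (hr (J i)).mpr ⟨i, rfl⟩
    obtain ⟨B, hB, hB'⟩ := Int.exists_greatest_of_bdd (P := fun T => u T = J i)
      ⟨T₀ + 2 * N * 1, fun z hz => by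
        by_contra hlt
        have := anti _ _ (not_le.mp hlt).le
        rw [per] at this
        omega⟩ ⟨T₀, h1⟩
    obtain ⟨A, hA, hA'⟩ := Int.exists_least_of_bdd (P := fun T => u T = J i)
      ⟨T₀ + 2 * N * (-1), fun z hz => by
        by_contra hlt
        have := anti _ _ (not_le.mp hlt).le
        rw [per] at this
        omega⟩ ⟨T₀, h1⟩
    refine ⟨A, B, ?_, fun T => ⟨fun h => ⟨hA' T h, hB' T h⟩, fun h => ?_⟩⟩
    · have := hA' _ h1
      have := hB' _ h2
      omega
    · have := anti _ _ h.1
      have := anti _ _ h.2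
      omega
  choose A B hAB hf using hfib
  -- At the first point of the column, the diagonals with first ends J i and J i + 1 share their
  -- second end, which is therefore a weight by the symmetry. The last point is treated alike.
  have ends : ∀ i, ∃ g, J g = J i + A i ∧ J (g + 1) = J i + B i := by
    intro i
    have hA := (hf i (A i)).mpr ⟨le_rfl, (hAB i).le⟩
    have hB := (hf i (B i)).mpr ⟨(hAB i).le, le_rfl⟩
    have hA1 : u (A i - 1) = J i + 1 := by
      have h1 := step (A i - 1)
      rw [sub_add_cancel] at h1
      have h2 : u (A i - 1) ≠ J i := fun h => by have := (hf i _).mp h; omega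
      omega
    have hB1 : u (B i + 1) = J i - 1 := by
      have h1 := step (B i)
      have h2 : u (B i + 1) ≠ J i := fun h => by have := (hf i _).mp h; omega
      omega
    obtain ⟨g, hg⟩ := (hr (J i + A i)).mp ⟨-A i, by rw [neg, hA], by
      rw [show -A i + 1 = -(A i - 1) by ring, neg, hA1]; ring⟩
    obtain ⟨g', hg'⟩ := (hr (J i + B i)).mp ⟨-(B i + 1), by rw [neg, hB1]; ring, by
      rw [show -(B i + 1) + 1 = -B i by ring, neg, hB]⟩
    have hlt : g < g' := by
      rw [← hJ.lt_iff_lt, hg, hg']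
      have := hAB i
      omega
    -- The second end of an interior point T of the fan is met by no other step, so its own column
    -- is a single point and it cannot be a weight.
    have hge : ¬ g + 1 < g' := by
      intro hlt'
      have h1 := hJ (show g < g + 1 by omega)
      have h2 := hJ hlt'
      rw [hg] at h1
      rw [hg'] at h2
      obtain ⟨T', h3, h5⟩ := (hr _).mpr ⟨g + 1, rfl⟩
      obtain ⟨T, hT⟩ : ∃ T, T = J (g + 1) - J i := ⟨_, rfl⟩
      have f0 := (hf i T).mpr (by omega)
      have f1 := (hf i (T - 1)).mpr (by omega)
      have f2 := (hf i (T + 1)).mpr (by omega)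
      have n1 := neg (-T')
      have n2 := neg (-(T' + 1))
      rw [neg_neg] at n1 n2
      rcases lt_trichotomy (-T') T with h | h | h
      · have := lip (-T') (T - 1) (by omega)
        omega
      · have e : -(T' + 1) = T - 1 := by omega
        rw [e] at n2
        omega
      · have := lip (T + 1) (-T') (by omega)
        omega
    have e : g' = g + 1 := by omega
    exact ⟨g, hg, by rw [← e, hg']⟩
  choose g hg hg' using ends
  -- From the last point of column J (i + 1), the staircase descends one column per step down to J
  -- i, as there are no weights in between. The second end stays fixed meanwhile, so the two fans
  -- share a boundary weight.
  have next : ∀ i, g i = g (i + 1) + 1 := by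
    intro i
    apply hJ.injective
    rw [hg, hg']
    have hlt := hJ (show i < i + 1 by omega)
    have run : ∀ k : ℕ, (k : ℤ) ≤ J (i + 1) - J i → u (B (i + 1) + k) = J (i + 1) - k := by
      intro k
      induction k with
      | zero =>
        intro _
        simpa using (hf (i + 1) _).mpr ⟨(hAB (i + 1)).le, le_rfl⟩
      | succ k ih =>
        intro hk
        push_cast at hk ⊢
        have h1 := ih (by omega)
        have h2 := step (B (i + 1) + k)
        rw [← add_assoc]
        rcases h2 with h2 | h2
        · exfalso
          obtain ⟨j, hj⟩ := (hr _).mp ⟨_, h1, by rw [h2, h1]⟩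
          have h3 : i < j := by rw [← hJ.lt_iff_lt]; omega
          have h5 : i + 1 ≤ j := by omega
          have h6 := hJ.monotone h5
          have h7 : k = 0 := by omega
          subst h7
          have h8 := (hf (i + 1) (B (i + 1) + 1)).mp (by simpa using h2.trans h1)
          omega
        · omega
    obtain ⟨k, hk⟩ : ∃ k : ℕ, (k : ℤ) + 1 = J (i + 1) - J i :=
      ⟨(J (i + 1) - J i - 1).toNat, by omega⟩
    have r0 := run k (by omega)
    have r1 := run (k + 1) (by push_cast; omega)
    push_cast at r1
    have s1 := (hf i (B (i + 1) + (k + 1))).mp (by omega)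
    have s2 : ¬ (A i ≤ B (i + 1) + k ∧ B (i + 1) + k ≤ B i) := by
      rw [← hf]; omega
    omega
  have gi : ∀ i, g i = g 0 - i := by
    intro i
    induction i using Int.induction_on with
    | zero => omega
    | succ k ih => have := next k; omega
    | pred k ih => have := next (-k - 1); rw [sub_add_cancel] at this; omega
  refine ⟨g 0, fun i T => ?_⟩
  rw [hf, ← gi, hg, hg']
  omega

end Wormhole

/-! ### Coherent position of the weights of an accordion. -/

namespace Wormhole

namespace FramedTriangulation

/-- The weights of `P` are at the positions `J i`, and the fan of the weight `J i` goes to the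
gap between `J (c - i)` and `J (c - i + 1)`. -/
structure IsCoherent (P : FramedTriangulation) (n : ℕ) (c : ℤ) (J : ℤ → ℤ) : Prop where
  mono : StrictMono J
  per : ∀ i, J (i + n) = J i + ((P.s : ℤ) + 1)
  weight : ∀ v, 2 < P.lind v ↔ ∃ i, J i = v
  gap : ∀ g, J (g + 1) - J g =
    P.lind (J (c - g)) - if (n : ℤ) ∣ 2 * g - c ∨ (n : ℤ) ∣ 2 * g + 1 - c then 0 else 2
  one : ∀ v, P.lind v = 1 ↔ ∃ g, ((n : ℤ) ∣ 2 * g - c ∧ v = J g + 1) ∨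
    ((n : ℤ) ∣ 2 * g + 1 - c ∧ v = J (g + 1) - 1)
  fan : ∀ i β, P.Joined (J i) β ↔ ∃ z, J (c - i) ≤ z ∧ z ≤ J (c - i + 1) ∧
    ((P.s : ℤ) + 1) ∣ β - z ∧ ¬ ((P.s : ℤ) + 1) ∣ z - J i ∧ ¬ ((P.s : ℤ) + 1) ∣ z - J i - 1 ∧
    ¬ ((P.s : ℤ) + 1) ∣ z - J i + 1

theorem add_mul_of_periodic {J : ℤ → ℤ} {n N : ℤ} (h : ∀ i, J (i + n) = J i + N) (i k : ℤ) :
    J (i + k * n) = J i + k * N := by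
  induction k using Int.induction_on with
  | zero => simp
  | succ k ih =>
    have := h (i + k * n)
    rw [show i + ((k : ℤ) + 1) * n = i + k * n + n by ring, this, ih]; ring
  | pred k ih =>
    have := h (i + (-k - 1) * n)
    rw [show i + (-(k : ℤ) - 1) * n + n = i + -k * n by ring, ih] at this
    linarith

theorem lind_eq_one_of_forall_not_joined {P : FramedTriangulation} {v : ℤ}
    (h : ∀ w, ¬ P.Joined v w) : P.lind v = 1 := by
  classical
  have : (Finset.range (P.s + 1)).filter (fun x : ℕ => P.Joined v x) = ∅ :=
    Finset.filter_eq_empty_iff.mpr (fun x _ => h x)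
  rw [lind_eq_card, this]
  simp

theorem lind_le_two_of_joined {P : FramedTriangulation} {v : ℤ}
    (h : ∀ x y, P.Joined v x → P.Joined v y → ((P.s : ℤ) + 1) ∣ x - y) : P.lind v ≤ 2 := by
  classical
  rw [lind_eq_card]
  have : ((Finset.range (P.s + 1)).filter (fun x : ℕ => P.Joined v x)).card ≤ 1 := by
    rw [Finset.card_le_one]
    intro x hx y hy
    rw [Finset.mem_filter, Finset.mem_range] at hx hy
    have h1 := h _ _ hx.2 hy.2
    rw [← res_eq_res_iff, res_natCast _ _ (by omega), res_natCast _ _ (by omega)] at h1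
    exact h1
  omega

theorem joined_res {P : FramedTriangulation} {v x : ℤ} (h : P.Joined v x) :
    P.Joined v (P.res x) :=
  (P.joined_congr (by simp) (P.dvd_sub_res x)).mp h

theorem two_lt_lind_of_joined {P : FramedTriangulation} {v x y : ℤ} (hx : P.Joined v x)
    (hy : P.Joined v y) (h : ¬ ((P.s : ℤ) + 1) ∣ x - y) : 2 < P.lind v := by
  classical
  rw [lind_eq_card]
  have : 1 < ((Finset.range (P.s + 1)).filter (fun x : ℕ => P.Joined v x)).card := by
    rw [Finset.one_lt_card]
    have h1 := P.res_le x
    have h2 := P.res_le y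
    refine ⟨P.res x, ?_, P.res y, ?_, ?_⟩
    · rw [Finset.mem_filter, Finset.mem_range]; exact ⟨by omega, joined_res hx⟩
    · rw [Finset.mem_filter, Finset.mem_range]; exact ⟨by omega, joined_res hy⟩
    · rwa [ne_eq, res_eq_res_iff]
  omega

/-- The step `T` of a staircase gives a diagonal, and not a side or a single vertex. -/
def Good (N T : ℤ) : Prop := ¬ N ∣ T ∧ ¬ N ∣ T - 1 ∧ ¬ N ∣ T + 1

theorem good_of_mem {N T : ℤ} (k : ℤ) (h1 : N * k + 2 ≤ T) (h2 : T ≤ N * k + N - 2) :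
    Good N T := by
  have h := not_dvd_of_mem (N := N) (T := T - N * k) (by omega) (by omega)
  have hk : N ∣ N * k := Dvd.intro k rfl
  refine ⟨fun hd => h.1 (dvd_sub hd hk), fun hd => h.2.1 ?_, fun hd => h.2.2 ?_⟩
  · exact dvd_of_eq_of_dvd (by ring) (dvd_sub hd hk)
  · exact dvd_of_eq_of_dvd (by ring) (dvd_sub hd hk)

namespace IsStaircase

variable {P : FramedTriangulation} {u : ℤ → ℤ}

theorem anti (h : P.IsStaircase u) {S T : ℤ} (hST : S ≤ T) : u T ≤ u S := by
  induction T, hST using Int.leInduction with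
  | base => exact le_rfl
  | succ T _ ih => rcases h.step T with h | h <;> omega

theorem surj (h : P.IsStaircase u) (v : ℤ) : ∃ T, u T = v := by
  have hN : (0 : ℤ) < (P.s : ℤ) + 1 := by omega
  obtain ⟨T, hT, hT'⟩ := Int.exists_least_of_bdd (P := fun T => u T ≤ v)
    ⟨0 + 2 * ((P.s : ℤ) + 1) * (-(|u 0 - v| + 1)), fun z hz => by
      by_contra hlt
      have h1 := h.anti (not_le.mp hlt).le
      rw [h.per] at h1
      have h2 := neg_abs_le (u 0 - v)
      have h3 := abs_nonneg (u 0 - v)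
      nlinarith⟩
    ⟨0 + 2 * ((P.s : ℤ) + 1) * |u 0 - v|, by
      rw [h.per]
      have h2 := le_abs_self (u 0 - v)
      have h3 := abs_nonneg (u 0 - v)
      nlinarith⟩
  refine ⟨T, ?_⟩
  have h1 := h.step (T - 1)
  rw [sub_add_cancel] at h1
  have h2 : ¬ u (T - 1) ≤ v := fun h => by have := hT' _ h; omega
  omega

/-- Exchange of ends combined with k full turns: the staircase is symmetric about every multiple of
N, up to a shear. -/
theorem refl (h : P.IsStaircase u) (k t : ℤ) :
    u (((P.s : ℤ) + 1) * k + t) = u (((P.s : ℤ) + 1) * k - t) - t := by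
  have h1 := h.per k (-(((P.s : ℤ) + 1) * k - t))
  rw [h.neg, show -(((P.s : ℤ) + 1) * k - t) + 2 * ((P.s : ℤ) + 1) * k =
    ((P.s : ℤ) + 1) * k + t by ring] at h1
  rw [h1]; ring

/-- The two possible shapes of a staircase near the multiples of the number of vertices. -/
theorem corner_cases (h : P.IsStaircase u) {k K : ℤ} (hK : K = ((P.s : ℤ) + 1) * k) :
    (u (K + 1) = u K ∧ u (K + 2) = u K ∧ u (K + 3) = u K ∧ u (K - 1) = u K + 1 ∧
      u (K - 2) = u K + 2) ∨
    (u (K + 1) = u K - 1 ∧ u (K + 2) = u K - 2 ∧ u (K - 1) = u K ∧ u (K - 2) = u K ∧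
      u (K - 3) = u K) := by
  subst hK
  have h1 := h.refl k 1
  have h2 := h.refl k 2
  have h3 := h.refl k 3
  have h4 := h.corner k
  have h5 := h.step (((P.s : ℤ) + 1) * k)
  omega

theorem joined_of_good (h : P.IsStaircase u) {T : ℤ} (hT : Good ((P.s : ℤ) + 1) T) :
    P.Joined (u T) (u T + T) :=
  (h.joined _ _).mpr ⟨T, rfl, by simp, hT⟩

/-- The columns with at least two points are the weights. -/
theorem two_lt_lind_iff (h : P.IsStaircase u) (h4 : 4 ≤ P.s) (v : ℤ) :
    2 < P.lind v ↔ ∃ T, u T = v ∧ u (T + 1) = v := by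
  constructor
  · intro hv
    by_contra hno
    push Not at hno
    have huniq : ∀ S T, u S = v → u T = v → ¬ S < T := by
      intro S T hS hT hlt
      have h1 := h.anti (show S ≤ S + 1 by omega)
      have h2 := h.anti (show S + 1 ≤ T by omega)
      exact hno S hS (by omega)
    have := lind_le_two_of_joined (P := P) (v := v) (by
      intro x y hx hy
      obtain ⟨T, h1, h2, -⟩ := (h.joined _ _).mp hx
      obtain ⟨T', h1', h2', -⟩ := (h.joined _ _).mp hy
      have e : T = T' := by
        have := huniq _ _ h1 h1'
        have := huniq _ _ h1' h1
        omega
      subst e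
      exact dvd_of_eq_of_dvd (by ring) (dvd_sub h2 h2'))
    omega
  · rintro ⟨T, h1, h2⟩
    have key : ∀ T, u T = v → u (T + 1) = v → Good ((P.s : ℤ) + 1) T →
        Good ((P.s : ℤ) + 1) (T + 1) → 2 < P.lind v := by
      intro T h1 h2 hg hg'
      have j1 := h.joined_of_good hg
      have j2 := h.joined_of_good hg'
      rw [h1] at j1
      rw [h2] at j2
      refine two_lt_lind_of_joined j2 j1 ?_
      rw [show v + (T + 1) - (v + T) = 1 by ring]
      intro hd
      have := Int.le_of_dvd one_pos hd
      omega
    have right : ∀ k, u (((P.s : ℤ) + 1) * k + 2) = v → u (((P.s : ℤ) + 1) * k + 3) = v →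
        2 < P.lind v := by
      intro k e1 e2
      exact key _ e1 (by rw [← e2]; ring_nf) (good_of_mem k (by omega) (by omega))
        (good_of_mem k (by omega) (by omega))
    have left : ∀ k, u (((P.s : ℤ) + 1) * k - 2) = v → u (((P.s : ℤ) + 1) * k - 3) = v →
        2 < P.lind v := by
      intro k e1 e2
      have e : ((P.s : ℤ) + 1) * (k - 1) = ((P.s : ℤ) + 1) * k - ((P.s : ℤ) + 1) := by ring
      exact key _ e2 (by rw [← e1]; ring_nf) (good_of_mem (k - 1) (by omega) (by omega))
        (good_of_mem (k - 1) (by omega) (by omega))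
    -- If T or T + 1 is no diagonal, the pair lies at a corner. There `corner_cases` supplies two
    -- further points of the same column, at distances 2 and 3 from the corner, which are diagonals
    -- because N ≥ 5.
    by_cases c0 : ((P.s : ℤ) + 1) ∣ T
    · obtain ⟨k, hk⟩ := c0
      have := h.corner_cases hk
      subst hk
      exact right k (by omega) (by omega)
    by_cases c1 : ((P.s : ℤ) + 1) ∣ T - 1
    · obtain ⟨k, hk⟩ := c1
      have := h.corner_cases rfl (k := k)
      obtain rfl : T = ((P.s : ℤ) + 1) * k + 1 := by omega
      rw [show ((P.s : ℤ) + 1) * k + 1 + 1 = ((P.s : ℤ) + 1) * k + 2 by ring] at h2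
      exact right k (by omega) (by omega)
    by_cases c2 : ((P.s : ℤ) + 1) ∣ T + 1
    · obtain ⟨k, hk⟩ := c2
      have := h.corner_cases rfl (k := k)
      obtain rfl : T = ((P.s : ℤ) + 1) * k - 1 := by omega
      rw [sub_add_cancel] at h2
      exact left k (by omega) (by omega)
    by_cases c3 : ((P.s : ℤ) + 1) ∣ T + 1 + 1
    · obtain ⟨k, hk⟩ := c3
      have := h.corner_cases rfl (k := k)
      obtain rfl : T = ((P.s : ℤ) + 1) * k - 2 := by omega
      rw [show ((P.s : ℤ) + 1) * k - 2 + 1 = ((P.s : ℤ) + 1) * k - 1 by ring] at h2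
      exact left k (by omega) (by omega)
    · exact key T h1 h2 ⟨c0, c1, c2⟩ ⟨c2, by rwa [add_sub_cancel_right], c3⟩

/-- The good points of a column are the diagonals at its vertex. As the column is shorter than N,
their second ends are distinct modulo N. -/
theorem lind_eq_card_good (h : P.IsStaircase u) {w A B : ℤ}
    (hf : ∀ T, u T = w ↔ A ≤ T ∧ T ≤ B) (hAB : B - A < (P.s : ℤ) + 1)
    [DecidablePred (Good ((P.s : ℤ) + 1))] :
    P.lind w = ((Finset.Icc A B).filter (Good ((P.s : ℤ) + 1))).card + 1 := by
  classical
  rw [lind_eq_card]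
  congr 2
  symm
  refine Finset.card_bij (fun T _ => P.res (w + T)) ?_ ?_ ?_
  · intro T hT
    rw [Finset.mem_filter, Finset.mem_Icc] at hT
    have h1 := P.res_le (w + T)
    rw [Finset.mem_filter, Finset.mem_range]
    refine ⟨by omega, ?_⟩
    have := h.joined_of_good hT.2
    rw [(hf T).mpr hT.1] at this
    exact joined_res this
  · intro T hT T' hT' he
    rw [Finset.mem_filter, Finset.mem_Icc] at hT hT'
    rw [res_eq_res_iff, add_sub_add_left_eq_sub] at he
    have h1 := Int.eq_zero_of_abs_lt_dvd he (by rw [abs_lt]; omega)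
    omega
  · intro x hx
    rw [Finset.mem_filter, Finset.mem_range] at hx
    obtain ⟨T, h1, h2, h3⟩ := (h.joined _ _).mp hx.2
    refine ⟨T, ?_, ?_⟩
    · rw [Finset.mem_filter, Finset.mem_Icc]
      exact ⟨(hf T).mp h1, h3⟩
    · rw [res_eq_iff _ _ _ (by omega), dvd_sub_comm]
      exact h2

theorem lind_eq_one_of_isolated (h : P.IsStaircase u) {T v : ℤ} (h0 : u T = v)
    (h1 : u (T + 1) ≠ v) (h2 : u (T - 1) ≠ v) (hb : ¬ Good ((P.s : ℤ) + 1) T) :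
    P.lind v = 1 := by
  apply lind_eq_one_of_forall_not_joined
  intro w hw
  obtain ⟨S, h3, -, h5⟩ := (h.joined _ _).mp hw
  have : S = T := by
    rcases lt_trichotomy S T with hlt | he | hlt
    · have a1 := h.anti (show S ≤ T - 1 by omega)
      have a2 := h.anti (show T - 1 ≤ T by omega)
      omega
    · exact he
    · have a1 := h.anti (show T + 1 ≤ S by omega)
      have a2 := h.anti (show T ≤ T + 1 by omega)
      omega
  subst this
  exact hb h5

/-- Vertices of index one are next to a corner of the staircase. -/
theorem exists_corner_of_lind_eq_one (h : P.IsStaircase u) (h4 : 4 ≤ P.s) {v : ℤ}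
    (hv : P.lind v = 1) : ∃ k K, K = ((P.s : ℤ) + 1) * k ∧
      ((u K + 1 = v ∧ u (K + 1) = u K) ∨ (u K - 1 = v ∧ u (K - 1) = u K)) := by
  obtain ⟨T, hT⟩ := h.surj v
  have hw : ¬ ∃ T, u T = v ∧ u (T + 1) = v := by
    rw [← h.two_lt_lind_iff h4]; omega
  push Not at hw
  have hb : ¬ Good ((P.s : ℤ) + 1) T := by
    intro hg
    have := h.joined_of_good hg
    rw [hT] at this
    exact not_joined_of_lind_eq_one hv _ this
  unfold Good at hb
  have hb' : ((P.s : ℤ) + 1) ∣ T ∨ ((P.s : ℤ) + 1) ∣ T - 1 ∨ ((P.s : ℤ) + 1) ∣ T + 1 := by tauto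
  rcases hb' with ⟨k, hk⟩ | ⟨k, hk⟩ | ⟨k, hk⟩
  · exfalso
    have h1 := h.corner_cases hk
    have h2 := hw T hT
    have h3 := hw (T - 1)
    rw [sub_add_cancel] at h3
    omega
  · have h1 := h.corner_cases hk
    rw [sub_add_cancel, show T - 1 + 2 = T + 1 by ring] at h1
    have h2 := hw T hT
    refine ⟨k, T - 1, hk, Or.inr ?_⟩
    omega
  · have h1 := h.corner_cases hk
    rw [add_sub_cancel_right, show T + 1 - 2 = T - 1 by ring] at h1
    have h2 := hw (T - 1)
    rw [sub_add_cancel] at h2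
    refine ⟨k, T + 1, hk, Or.inl ?_⟩
    omega

end IsStaircase

/-- The weights of an accordion form a coherent graph. -/
theorem IsLiftedAccordion.exists_isCoherent {P : FramedTriangulation} (h : P.IsLiftedAccordion)
    (h4 : 4 ≤ P.s) {n : ℕ} (hn : 2 ≤ n) {J : ℤ → ℤ} (mono : StrictMono J)
    (per : ∀ i, J (i + n) = J i + ((P.s : ℤ) + 1)) (weight : ∀ v, 2 < P.lind v ↔ ∃ i, J i = v) :
    ∃ c, P.IsCoherent n c J := by
  classical
  obtain ⟨u, hu⟩ := h.exists_isStaircase h4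
  obtain ⟨N, hN⟩ : ∃ N : ℤ, N = (P.s : ℤ) + 1 := ⟨_, rfl⟩
  have hN5 : 5 ≤ N := by omega
  have hgood : ∀ T, Good N T ↔ Good ((P.s : ℤ) + 1) T := by rw [hN]; exact fun _ => Iff.rfl
  obtain ⟨c, hc⟩ := exists_fiber_of_staircase (N := (P.s : ℤ) + 1) (by omega) hu.step hu.neg
    hu.per mono (fun w => by rw [← hu.two_lt_lind_iff h4, weight])
  have perk := add_mul_of_periodic per
  have lt_of : ∀ i j, i < j → J i < J j := fun i j hij => mono hij
  have inj : ∀ i j, J i = J j → i = j := fun i j hij => mono.injective hij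
  have gap_lt : ∀ g, J (g + 1) < J g + N := by
    intro g
    rw [hN, ← per]
    exact mono (by omega)
  have gap_pos : ∀ g, J g < J (g + 1) := fun g => mono (by omega)
  have hf : ∀ i T, u T = J i ↔ J (c - i) - J i ≤ T ∧ T ≤ J (c - i + 1) - J i := by
    intro i T
    rw [hc]
    omega
  refine ⟨c, mono, per, weight, ?_, ?_, ?_⟩
  · intro g
    obtain ⟨i, rfl⟩ : ∃ i, g = c - i := ⟨c - g, by ring⟩
    rw [sub_sub_cancel]
    have gl := gap_lt (c - i)
    have gp := gap_pos (c - i)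
    obtain ⟨A, hA⟩ : ∃ A, A = J (c - i) - J i := ⟨_, rfl⟩
    obtain ⟨B, hB⟩ : ∃ B, B = J (c - i + 1) - J i := ⟨_, rfl⟩
    have hfi : ∀ T, u T = J i ↔ A ≤ T ∧ T ≤ B := by rw [hA, hB]; exact hf i
    have hcard := hu.lind_eq_card_good hfi (by omega)
    -- A point of width N * k has second end congruent to J i. This lies in the opposite gap only as
    -- one of its bounding weights, which gives the two congruences.
    have hsp : (∃ k, u (N * k) = J i) ↔
        ((n : ℤ) ∣ 2 * (c - i) - c ∨ (n : ℤ) ∣ 2 * (c - i) + 1 - c) := by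
      constructor
      · rintro ⟨k, hk⟩
        rw [hf] at hk
        have h1 := perk i k
        rw [mul_comm k ((P.s : ℤ) + 1), ← hN] at h1
        have h2 : c - i ≤ i + k * n := by
          rw [← mono.le_iff_le]; omega
        have h3 : i + k * n ≤ c - i + 1 := by
          rw [← mono.le_iff_le]; omega
        rcases (show i + k * n = c - i ∨ i + k * n = c - i + 1 by omega) with h5 | h5
        · exact Or.inl ⟨k, by linarith⟩
        · exact Or.inr ⟨k, by linarith⟩
      · rintro (⟨k, hk⟩ | ⟨k, hk⟩)
        · refine ⟨k, ?_⟩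
          have h1 := perk i k
          rw [mul_comm k ((P.s : ℤ) + 1), ← hN, show i + k * n = c - i by linarith] at h1
          rw [hf]
          omega
        · refine ⟨k, ?_⟩
          have h1 := perk i k
          rw [mul_comm k ((P.s : ℤ) + 1), ← hN, show i + k * n = c - i + 1 by linarith] at h1
          rw [hf]
          omega
    have adj : ∀ T, A ≤ T → T ≤ B → u (T - 1) = J i ∨ u (T + 1) = J i := by
      intro T h1 h2
      rw [hfi, hfi]
      omega
    split_ifs with hs <;> rw [← hsp] at hs
    -- A column through a corner starts or ends there and loses exactly two points: the corner and
    -- its neighbour inside the column. This accounts for the constant 0 in place of 2.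
    · obtain ⟨k, hk⟩ := hs
      have cc := hu.corner_cases (K := N * k) (by rw [hN])
      have hk' := (hfi _).mp hk
      rcases cc with cc | cc
      · have a1 : ¬ (A ≤ N * k - 1 ∧ N * k - 1 ≤ B) := by rw [← hfi]; omega
        have a3 := (hfi (N * k + 3)).mp (by omega)
        -- The column must not lose a point at its far end too; the possible shapes of the next
        -- corner exclude this.
        have hne : B ≠ N * k + N - 1 := by
          intro hBe
          have c2 := hu.corner_cases (k := k + 1) (K := N * k + N) (by rw [hN]; ring)
          have b1 := (hfi B).mpr (by omega)
          have b2 := (hfi (B - 1)).mpr (by omega)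
          have b3 : ¬ (A ≤ B + 1 ∧ B + 1 ≤ B) := by omega
          rw [← hfi] at b3
          rw [show N * k + N - 1 = B by omega, show N * k + N - 2 = B - 1 by omega,
            show N * k + N = B + 1 by omega] at c2
          omega
        have hfil : (Finset.Icc A B).filter (Good ((P.s : ℤ) + 1)) =
            Finset.Icc (N * k + 2) B := by
          ext T
          rw [Finset.mem_filter, Finset.mem_Icc, Finset.mem_Icc, ← hgood]
          constructor
          · rintro ⟨h1, h2⟩
            have n0 : T ≠ N * k := by
              rintro rfl; exact h2.1 (Dvd.intro k rfl)
            have n1 : T ≠ N * k + 1 := by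
              rintro rfl; exact h2.2.1 ⟨k, by ring⟩
            omega
          · intro h1
            exact ⟨by omega, good_of_mem k (by omega) (by omega)⟩
        rw [hcard, hfil, Int.card_Icc]
        omega
      · have a1 : ¬ (A ≤ N * k + 1 ∧ N * k + 1 ≤ B) := by rw [← hfi]; omega
        have a3 := (hfi (N * k - 3)).mp (by omega)
        have hne : A ≠ N * k - N + 1 := by
          intro hAe
          have c2 := hu.corner_cases (k := k - 1) (K := N * k - N) (by rw [hN]; ring)
          have b1 := (hfi A).mpr (by omega)
          have b2 := (hfi (A + 1)).mpr (by omega)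
          have b3 : ¬ (A ≤ A - 1 ∧ A - 1 ≤ B) := by omega
          rw [← hfi] at b3
          rw [show N * k - N + 1 = A by omega, show N * k - N + 2 = A + 1 by omega,
            show N * k - N = A - 1 by omega] at c2
          omega
        have hfil : (Finset.Icc A B).filter (Good ((P.s : ℤ) + 1)) =
            Finset.Icc A (N * k - 2) := by
          ext T
          rw [Finset.mem_filter, Finset.mem_Icc, Finset.mem_Icc, ← hgood]
          constructor
          · rintro ⟨h1, h2⟩
            have n0 : T ≠ N * k := by
              rintro rfl; exact h2.1 (Dvd.intro k rfl)
            have n1 : T ≠ N * k - 1 := by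
              rintro rfl; exact h2.2.2 ⟨k, by ring⟩
            omega
          · intro h1
            have e : N * (k - 1) = N * k - N := by ring
            exact ⟨by omega, good_of_mem (k - 1) (by omega) (by omega)⟩
        rw [hcard, hfil, Int.card_Icc]
        omega
    · push Not at hs
      have hfil : (Finset.Icc A B).filter (Good ((P.s : ℤ) + 1)) = Finset.Icc A B := by
        rw [Finset.filter_eq_self]
        intro T hT
        rw [Finset.mem_Icc] at hT
        rw [← hgood]
        have huT := (hfi T).mpr hT
        have hadj := adj T hT.1 hT.2
        refine ⟨?_, ?_, ?_⟩
        · rintro ⟨k, rfl⟩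
          exact hs k huT
        · rintro ⟨k, hk⟩
          have c2 := hu.corner_cases (k := k) (K := T - 1) (by rw [← hN, hk])
          have := hs k
          rw [← hk] at this
          rw [sub_add_cancel, show T - 1 + 2 = T + 1 by ring] at c2
          omega
        · rintro ⟨k, hk⟩
          have c2 := hu.corner_cases (k := k) (K := T + 1) (by rw [← hN, hk])
          have := hs k
          rw [← hk] at this
          rw [add_sub_cancel_right, show T + 1 - 2 = T - 1 by ring] at c2
          omega
      rw [hcard, hfil, Int.card_Icc]
      omega
  · intro v
    constructor
    · intro hv
      -- The ear is next to the weight containing the corner. The side of the column on which the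
      -- corner lies decides whether the ear follows or precedes that weight.
      obtain ⟨k, K, hK, hcase⟩ := hu.exists_corner_of_lind_eq_one h4 hv
      have cc := hu.corner_cases hK
      obtain ⟨i, hi⟩ : ∃ i, J i = u K := by
        rw [← weight, hu.two_lt_lind_iff h4]
        rcases hcase with hcase | hcase
        · exact ⟨K, rfl, hcase.2⟩
        · exact ⟨K - 1, hcase.2, by rw [sub_add_cancel]⟩
      have h1 := perk i k
      rw [mul_comm k ((P.s : ℤ) + 1), ← hK] at h1
      have h2 := (hf i K).mp hi.symm
      rcases hcase with hcase | hcase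
      · have h3 : ¬ (J (c - i) - J i ≤ K - 1 ∧ K - 1 ≤ J (c - i + 1) - J i) := by
          rw [← hf]; omega
        have h5 := inj (i + k * n) (c - i) (by omega)
        exact ⟨i, Or.inl ⟨⟨-k, by linarith⟩, by omega⟩⟩
      · have h3 : ¬ (J (c - i) - J i ≤ K + 1 ∧ K + 1 ≤ J (c - i + 1) - J i) := by
          rw [← hf]; omega
        have h5 := inj (i + k * n) (c - i + 1) (by omega)
        exact ⟨i - 1, Or.inr ⟨⟨-k, by linarith⟩, by rw [sub_add_cancel]; omega⟩⟩
    · rintro ⟨g, ⟨⟨k, hk⟩, rfl⟩ | ⟨⟨k, hk⟩, rfl⟩⟩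
      · obtain ⟨K, hK⟩ : ∃ K, K = ((P.s : ℤ) + 1) * (-k) := ⟨_, rfl⟩
        have cc := hu.corner_cases hK
        have h1 := perk g (-k)
        rw [mul_comm (-k) ((P.s : ℤ) + 1), ← hK, show g + -k * n = c - g by linarith] at h1
        have h2 := (hf g K).mpr (by have := gap_pos (c - g); omega)
        have h3 : ¬ (J (c - g) - J g ≤ K - 1 ∧ K - 1 ≤ J (c - g + 1) - J g) := by omega
        rw [← hf] at h3
        refine hu.lind_eq_one_of_isolated (T := K - 1) (by omega) (by rw [sub_add_cancel]; omega)
          (by rw [show K - 1 - 1 = K - 2 by ring]; omega) (fun hg => hg.2.2 ?_)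
        exact ⟨-k, by rw [sub_add_cancel, hK]⟩
      · obtain ⟨K, hK⟩ : ∃ K, K = ((P.s : ℤ) + 1) * (-k) := ⟨_, rfl⟩
        have cc := hu.corner_cases hK
        have h1 := perk (g + 1) (-k)
        rw [mul_comm (-k) ((P.s : ℤ) + 1), ← hK,
          show g + 1 + -k * n = c - (g + 1) + 1 by linarith] at h1
        have h2 := (hf (g + 1) K).mpr (by have := gap_pos (c - (g + 1)); omega)
        have h3 : ¬ (J (c - (g + 1)) - J (g + 1) ≤ K + 1 ∧
          K + 1 ≤ J (c - (g + 1) + 1) - J (g + 1)) := by omega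
        rw [← hf] at h3
        refine hu.lind_eq_one_of_isolated (T := K + 1) (by omega)
          (by rw [show K + 1 + 1 = K + 2 by ring]; omega)
          (by rw [add_sub_cancel_right]; omega) (fun hg => hg.2.1 ?_)
        exact ⟨-k, by rw [add_sub_cancel_right, hK]⟩
  · intro i β
    rw [hu.joined]
    constructor
    · rintro ⟨T, h1, h2, h3, h5, h6⟩
      refine ⟨J i + T, ((hc i T).mp h1).1, ((hc i T).mp h1).2, h2, ?_⟩
      rw [add_sub_cancel_left]
      exact ⟨h3, h5, h6⟩
    · rintro ⟨z, h1, h2, h3, h5, h6, h7⟩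
      refine ⟨z - J i, (hc i _).mpr (by rw [add_sub_cancel]; exact ⟨h1, h2⟩), ?_, h5, h6, h7⟩
      rwa [add_sub_cancel]

/-- An accordion with at least five sides has exactly two ears. -/
theorem IsLiftedAccordion.hasTwoEars {P : FramedTriangulation} (h : P.IsLiftedAccordion)
    (h4 : 4 ≤ P.s) : P.HasTwoEars := by
  obtain ⟨u, hu⟩ := h.exists_isStaircase h4
  -- Corners N * k with k of the same parity differ by full turns, so their ears are congruent. The
  -- two parities leave room for at most two ears.
  have hper : ∀ k, ∃ e, ∀ v, P.lind v = 1 → (∃ q K, K = ((P.s : ℤ) + 1) * (2 * q + k) ∧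
      ((u K + 1 = v ∧ u (K + 1) = u K) ∨ (u K - 1 = v ∧ u (K - 1) = u K))) →
      ((P.s : ℤ) + 1) ∣ v - e := by
    intro k
    have e : ∀ q t, u (((P.s : ℤ) + 1) * (2 * q + k) + t) =
        u (((P.s : ℤ) + 1) * k + t) - ((P.s : ℤ) + 1) * q := by
      intro q t
      rw [← hu.per]; ring_nf
    have cc := hu.corner_cases (k := k) rfl
    by_cases hk : u (((P.s : ℤ) + 1) * k + 1) = u (((P.s : ℤ) + 1) * k)
    · refine ⟨u (((P.s : ℤ) + 1) * k) + 1, ?_⟩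
      rintro v - ⟨q, K, rfl, hc⟩
      have e0 := e q 0
      have e1 := e q 1
      have e2 := e q (-1)
      simp only [add_zero, ← sub_eq_add_neg] at e0 e2
      exact ⟨-q, by rw [mul_neg]; omega⟩
    · refine ⟨u (((P.s : ℤ) + 1) * k) - 1, ?_⟩
      rintro v - ⟨q, K, rfl, hc⟩
      have e0 := e q 0
      have e1 := e q 1
      have e2 := e q (-1)
      simp only [add_zero, ← sub_eq_add_neg] at e0 e2
      exact ⟨-q, by rw [mul_neg]; omega⟩
  obtain ⟨a, ha⟩ := hper 0
  obtain ⟨b, hb⟩ := hper 1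
  have hab : ∀ v, P.lind v = 1 → ((P.s : ℤ) + 1) ∣ v - a ∨ ((P.s : ℤ) + 1) ∣ v - b := by
    intro v hv
    obtain ⟨k, K, hK, hc⟩ := hu.exists_corner_of_lind_eq_one h4 hv
    rcases Int.even_or_odd' k with ⟨q, rfl | rfl⟩
    · exact Or.inl (ha v hv ⟨q, K, by rw [hK, add_zero], hc⟩)
    · exact Or.inr (hb v hv ⟨q, K, hK, hc⟩)
  obtain ⟨e, e', hne, he, he'⟩ := P.exists_two_ears (by omega)
  refine ⟨e, e', hne, fun v => ⟨fun hv => ?_, ?_⟩⟩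
  · have key : ∀ x y z : ℤ, ((P.s : ℤ) + 1) ∣ x - z → ((P.s : ℤ) + 1) ∣ y - z →
        ((P.s : ℤ) + 1) ∣ x - y :=
      fun x y z hx hy => dvd_of_eq_of_dvd (by ring) (dvd_sub hx hy)
    rcases hab v hv with h1 | h1 <;> rcases hab e he with h2 | h2 <;>
      rcases hab e' he' with h3 | h3
    · exact absurd (key _ _ _ h2 h3) hne
    · exact Or.inl (key _ _ _ h1 h2)
    · exact Or.inr (key _ _ _ h1 h3)
    · exact absurd (key _ _ _ h2 h3) hne
    · exact absurd (key _ _ _ h2 h3) hne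
    · exact Or.inr (key _ _ _ h1 h3)
    · exact Or.inl (key _ _ _ h1 h2)
    · exact absurd (key _ _ _ h2 h3) hne
  · rintro (h1 | h1)
    · rw [P.lind_congr h1, he]
    · rw [P.lind_congr h1, he']

end FramedTriangulation

end Wormhole

set_option linter.unusedSectionVars false

/-! ### Arithmetic of the systems S_0 ∪ S_m. -/

namespace Wormhole

/-! ### The numbers `k_i^{(m)}` -/

/-- The first of the two positions where `k_i^{(m)} = 1`. -/
def specialPos (n m : ℕ) : ℕ :=
  if n % 2 = 1 then (n - 1) / 2 + (m + 1) / 2 else n / 2 + m / 2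

theorem kNumber_eq (n m : ℕ) (i : ZMod n) :
    kNumber n m i = if i = (specialPos n m : ℕ) ∨ i = (n + m / 2 : ℕ) then 1 else 3 := by
  unfold kNumber specialPos
  split_ifs <;> simp_all

theorem natCast_eq_natCast_iff_dvd (n a b : ℕ) :
    ((a : ℕ) : ZMod n) = b ↔ (n : ℤ) ∣ (a : ℤ) - b := by
  rw [← Int.cast_natCast a, ← Int.cast_natCast b, ZMod.intCast_eq_intCast_iff_dvd_sub,
    dvd_sub_comm]

theorem specialPos_ne {n : ℕ} (hn : 2 ≤ n) (m : ℕ) :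
    ((specialPos n m : ℕ) : ZMod n) ≠ (n + m / 2 : ℕ) := by
  rw [ne_eq, natCast_eq_natCast_iff_dvd]
  rintro ⟨k, hk⟩
  have h1 : -(2 * (n : ℤ)) < n * k := by
    rw [← hk]; unfold specialPos; split_ifs <;> push_cast <;> omega
  have h2 : (n : ℤ) * k < 0 := by
    rw [← hk]; unfold specialPos; split_ifs <;> push_cast <;> omega
  have h3 : k = -1 := by
    have a1 : k < 0 := by nlinarith
    have a2 : -2 < k := by nlinarith
    omega
  rw [h3] at hk
  unfold specialPos at hk
  split_ifs at hk <;> push_cast at hk <;> omega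

/-- As the two special positions are distinct, the disjunction becomes a sum of indicators, which is
what the linear arguments need. -/
theorem kNumber_eq_sub {n : ℕ} (hn : 2 ≤ n) (m : ℕ) (i : ZMod n) :
    kNumber n m i = 3 - 2 * ((if i = (specialPos n m : ℕ) then 1 else 0) +
      (if i = (n + m / 2 : ℕ) then 1 else 0)) := by
  rw [kNumber_eq]
  have := specialPos_ne hn m
  by_cases h1 : i = (specialPos n m : ℕ)
  · rw [h1, if_pos (Or.inl rfl), if_pos rfl, if_neg this]; norm_num
  · by_cases h2 : i = (n + m / 2 : ℕ)
    · rw [if_pos (Or.inr h2), if_neg h1, if_pos h2]; norm_num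
    · rw [if_neg (by tauto), if_neg h1, if_neg h2]; norm_num

theorem odd_dvd_two_mul_iff (h x : ℤ) : 2 * h + 1 ∣ 2 * x ↔ 2 * h + 1 ∣ x := by
  refine ⟨fun hd => ?_, fun hd => hd.mul_left 2⟩
  exact dvd_of_eq_of_dvd (by ring) (dvd_sub (Dvd.intro x rfl) (hd.mul_left h))

theorem dvd_iff_two_mul_dvd (h y : ℤ) : h ∣ y ↔ 2 * h ∣ y ∨ 2 * h ∣ y - h := by
  constructor
  · rintro ⟨k, rfl⟩
    rcases Int.even_or_odd' k with ⟨q, rfl | rfl⟩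
    · exact Or.inl ⟨q, by ring⟩
    · exact Or.inr ⟨q, by ring⟩
  · rintro (⟨k, hk⟩ | ⟨k, hk⟩)
    · exact ⟨2 * k, by linarith⟩
    · exact ⟨2 * k + 1, by linarith⟩

/-- The special positions are the solutions of 2i ≡ m and 2i + 1 ≡ m modulo n. For odd n each
congruence has one solution; for even n the parity of m makes just one of them solvable, with two
solutions. This matches the exceptional gaps in `IsCoherent.gap`. -/
theorem kNumber_intCast (n m : ℕ) (i : ℤ) : kNumber n m (i : ZMod n) =
    if (n : ℤ) ∣ 2 * i - m ∨ (n : ℤ) ∣ 2 * i + 1 - m then 1 else 3 := by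
  rw [kNumber_eq]
  have e : ∀ k : ℕ, (i : ZMod n) = (k : ℕ) ↔ (n : ℤ) ∣ i - k := by
    intro k
    rw [← Int.cast_natCast k, ZMod.intCast_eq_intCast_iff_dvd_sub, dvd_sub_comm]
  simp only [e]
  have hadd : ∀ N x y : ℤ, y = x + N → (N ∣ y ↔ N ∣ x) := by
    rintro N x y rfl
    exact dvd_add_self_right
  have key : ((n : ℤ) ∣ i - (specialPos n m : ℕ) ∨ (n : ℤ) ∣ i - (n + m / 2 : ℕ)) ↔
      ((n : ℤ) ∣ 2 * i - m ∨ (n : ℤ) ∣ 2 * i + 1 - m) := by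
    have e2 : (n : ℤ) ∣ i - (n + m / 2 : ℕ) ↔ (n : ℤ) ∣ i - (m / 2 : ℕ) := by
      symm; apply hadd; push_cast; ring
    rw [e2]
    unfold specialPos
    rcases Nat.even_or_odd' n with ⟨h, rfl | rfl⟩ <;>
      rcases Nat.even_or_odd' m with ⟨q, rfl | rfl⟩
    · rw [if_neg (by omega), show 2 * h / 2 = h by omega, show 2 * q / 2 = q by omega]
      push_cast
      have e3 : ¬ 2 * (h : ℤ) ∣ 2 * i + 1 - 2 * q := by
        rintro ⟨k, hk⟩
        rw [mul_assoc] at hk; omega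
      rw [show 2 * i - 2 * (q : ℤ) = 2 * (i - q) by ring, or_iff_left e3,
        mul_dvd_mul_iff_left (by norm_num : (2 : ℤ) ≠ 0), dvd_iff_two_mul_dvd (h : ℤ) (i - q), or_comm,
        show i - ((h : ℤ) + q) = i - q - h by ring]
    · rw [if_neg (by omega), show 2 * h / 2 = h by omega, show (2 * q + 1) / 2 = q by omega]
      push_cast
      have e3 : ¬ 2 * (h : ℤ) ∣ 2 * i - (2 * q + 1) := by
        rintro ⟨k, hk⟩
        rw [mul_assoc] at hk; omega
      rw [show 2 * i + 1 - (2 * (q : ℤ) + 1) = 2 * (i - q) by ring, or_iff_right e3,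
        mul_dvd_mul_iff_left (by norm_num : (2 : ℤ) ≠ 0), dvd_iff_two_mul_dvd (h : ℤ) (i - q), or_comm,
        show i - ((h : ℤ) + q) = i - q - h by ring]
    · rw [if_pos (by omega), show (2 * h + 1 - 1) / 2 = h by omega,
        show (2 * q + 1) / 2 = q by omega, show 2 * q / 2 = q by omega]
      push_cast
      rw [show 2 * i - 2 * (q : ℤ) = 2 * (i - q) by ring, odd_dvd_two_mul_iff,
        or_comm (b := _ ∣ 2 * i + 1 - 2 * (q : ℤ)), or_congr_left]
      rw [← hadd _ (2 * i + 1 - 2 * (q : ℤ)) (2 * (i + h + 1 - q)) (by ring), odd_dvd_two_mul_iff,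
        hadd _ (i - (h + q)) (i + h + 1 - (q : ℤ)) (by ring)]
    · rw [if_pos (by omega), show (2 * h + 1 - 1) / 2 = h by omega,
        show (2 * q + 1 + 1) / 2 = q + 1 by omega, show (2 * q + 1) / 2 = q by omega]
      push_cast
      rw [show 2 * i + 1 - (2 * (q : ℤ) + 1) = 2 * (i - q) by ring, odd_dvd_two_mul_iff,
        or_congr_left]
      rw [hadd _ (2 * (i - (h + (q + 1)))) (2 * i - (2 * (q : ℤ) + 1)) (by ring),
        odd_dvd_two_mul_iff]
  simp only [key]

/-! ### The linear system -/

/-- The difference of the constant terms of the two systems at the unknown `x_a`. -/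
def systemDiff (n m : ℕ) (a : ZMod n) : ℤ :=
  kNumber n 0 ((n : ZMod n) - a) - kNumber n m ((n : ZMod n) - a)

/-- S_0 only defines y. Substituting it into S_m leaves a first-order difference equation along
translation by m. -/
theorem solvesUnion_iff (n m : ℕ) (x : ZMod n → ℤ) :
    SolvesUnion n m x ↔ ∀ a : ZMod n, x (a + m) = x a - systemDiff n m a := by
  unfold SolvesUnion SystemS systemDiff
  constructor
  · rintro ⟨y, h0, h1⟩ a
    have e0 := h0 (n - a)
    have e1 := h1 (n - a)
    rw [sub_sub_cancel] at e0 e1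
    rw [Nat.cast_zero, add_zero] at e0
    linarith
  · intro h
    refine ⟨fun i => x ((n : ZMod n) - i) - kNumber n 0 i, fun i => by simp, fun i => ?_⟩
    have := h (n - i)
    rw [sub_sub_cancel] at this
    rw [this]; ring

section

variable {n : ℕ} [NeZero n] (m : ℕ)

/-- Reduction modulo `gcd n m`. -/
def gcdHom (n m : ℕ) : ZMod n →+* ZMod (Nat.gcd n m) :=
  ZMod.castHom (Nat.gcd_dvd_left n m) _

theorem gcdHom_add (a : ZMod n) : gcdHom n m (a + m) = gcdHom n m a := by
  rw [map_add, map_natCast, (ZMod.natCast_eq_zero_iff m _).mpr (Nat.gcd_dvd_right n m), add_zero]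

/-- Bézout: the orbits of translation by m are the full residue classes modulo gcd n m. -/
theorem exists_eq_add_mul_of_gcdHom_eq {a b : ZMod n} (h : gcdHom n m a = gcdHom n m b) :
    ∃ j : ℕ, b = a + (j : ZMod n) * m := by
  obtain ⟨z, hz⟩ := ZMod.intCast_surjective (b - a)
  have hd : ((z : ℤ) : ZMod (Nat.gcd n m)) = 0 := by
    rw [← map_intCast (gcdHom n m), hz, map_sub, h, sub_self]
  rw [ZMod.intCast_zmod_eq_zero_iff_dvd] at hd
  obtain ⟨t, rfl⟩ := hd
  obtain ⟨k, hk⟩ := ZMod.natCast_zmod_surjective (n := n)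
    (((Nat.gcdB n m * t : ℤ)) : ZMod n)
  refine ⟨k, ?_⟩
  rw [hk, ← sub_eq_iff_eq_add', ← hz, Nat.gcd_eq_gcd_ab]
  push_cast
  rw [ZMod.natCast_self]
  ring

theorem gcd_pos_of_neZero : 0 < Nat.gcd n m :=
  Nat.gcd_pos_of_pos_left _ (Nat.pos_of_ne_zero (NeZero.ne n))

/-- The representative of a class modulo `gcd n m` between `1` and `gcd n m`. -/
def gcdRep (n m : ℕ) (c : ZMod (Nat.gcd n m)) : ℕ :=
  if c.val = 0 then Nat.gcd n m else c.val

theorem gcdRep_mem (c : ZMod (Nat.gcd n m)) :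
    gcdRep n m c ∈ Finset.Icc 1 (Nat.gcd n m) := by
  have h := gcd_pos_of_neZero (n := n) m
  have : NeZero (Nat.gcd n m) := ⟨h.ne'⟩
  have := ZMod.val_lt c
  rw [Finset.mem_Icc]
  unfold gcdRep
  split_ifs <;> omega

theorem natCast_gcdRep (c : ZMod (Nat.gcd n m)) :
    ((gcdRep n m c : ℕ) : ZMod (Nat.gcd n m)) = c := by
  have : NeZero (Nat.gcd n m) := ⟨(gcd_pos_of_neZero (n := n) m).ne'⟩
  unfold gcdRep
  split_ifs with h
  · rw [ZMod.natCast_self, ← ZMod.natCast_zmod_val c, h, Nat.cast_zero]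
  · exact ZMod.natCast_zmod_val c

theorem gcdRep_natCast {i : ℕ} (hi : i ∈ Finset.Icc 1 (Nat.gcd n m)) :
    gcdRep n m (i : ZMod (Nat.gcd n m)) = i := by
  have : NeZero (Nat.gcd n m) := ⟨(gcd_pos_of_neZero (n := n) m).ne'⟩
  rw [Finset.mem_Icc] at hi
  unfold gcdRep
  rw [ZMod.val_natCast]
  rcases lt_or_eq_of_le hi.2 with h | h
  · rw [Nat.mod_eq_of_lt h, if_neg (by omega)]
  · rw [← h, Nat.mod_self, if_pos rfl]

theorem exists_rep (a : ZMod n) : ∃ i ∈ Finset.Icc 1 (Nat.gcd n m), ∃ l < n / Nat.gcd n m,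
    a = ((i + l * m : ℕ) : ZMod n) := by
  have hd := gcd_pos_of_neZero (n := n) m
  have hq : 0 < n / Nat.gcd n m :=
    Nat.div_pos (Nat.le_of_dvd (Nat.pos_of_ne_zero (NeZero.ne n)) (Nat.gcd_dvd_left n m)) hd
  refine ⟨_, gcdRep_mem m (gcdHom n m a), ?_⟩
  obtain ⟨j, hj⟩ := exists_eq_add_mul_of_gcdHom_eq m
    (a := ((gcdRep n m (gcdHom n m a) : ℕ) : ZMod n)) (b := a) (by
      rw [map_natCast, natCast_gcdRep])
  refine ⟨j % (n / Nat.gcd n m), Nat.mod_lt _ hq, ?_⟩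
  -- The orbit closes up after n / gcd n m steps, so j may be reduced modulo this number.
  have h0 : ((n / Nat.gcd n m : ℕ) : ZMod n) * m = 0 := by
    rw [← Nat.cast_mul, ZMod.natCast_eq_zero_iff]
    obtain ⟨t, ht⟩ := Nat.gcd_dvd_right n m
    obtain ⟨t', ht'⟩ := Nat.gcd_dvd_left n m
    refine ⟨t, ?_⟩
    have e : n / Nat.gcd n m = t' := Nat.div_eq_of_eq_mul_right hd ht'
    rw [e]
    calc t' * m = t' * (Nat.gcd n m * t) := by rw [← ht]
      _ = Nat.gcd n m * t' * t := by ring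
      _ = n * t := by rw [← ht']
  have hm : ((j : ℕ) : ZMod n) * m = ((j % (n / Nat.gcd n m) : ℕ) : ZMod n) * m := by
    conv_lhs => rw [← Nat.mod_add_div j (n / Nat.gcd n m)]
    push_cast
    rw [add_mul, mul_right_comm, h0, zero_mul, add_zero]
  push_cast
  rw [← hm]
  exact hj

theorem SolvesUnion.eq_sub_sum {m : ℕ} {x : ZMod n → ℤ} (h : SolvesUnion n m x) (i j : ℕ) :
    x ((i + j * m : ℕ) : ZMod n) = x (i : ZMod n) -
      ∑ l ∈ Finset.range j, systemDiff n m ((i + l * m : ℕ) : ZMod n) := by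
  rw [solvesUnion_iff] at h
  induction j with
  | zero => simp
  | succ j ih =>
    have h1 := h ((i + j * m : ℕ) : ZMod n)
    rw [← Nat.cast_add, show i + j * m + m = i + (j + 1) * m by ring] at h1
    rw [h1, ih, Finset.sum_range_succ]
    ring

/-- The formula is the equation summed along an orbit, and subtracting its instances for j and j + 1
gives the equation back. The instance j = n / gcd n m returns to the starting point and expresses
solvability on that orbit. -/
theorem solvesUnion_iff_parametricFormula (x : ZMod n → ℤ) :
    SolvesUnion n m x ↔ ParametricFormula n m x := by
  constructor
  · intro h i _ j _
    exact h.eq_sub_sum i j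
  · intro h
    rw [solvesUnion_iff]
    intro a
    obtain ⟨i, hi, l, hl, rfl⟩ := exists_rep m a
    have h1 := h i hi (l + 1) (by rw [Finset.mem_Icc]; omega)
    rw [Finset.sum_range_succ] at h1
    have h2 : x ((i + l * m : ℕ) : ZMod n) = x (i : ZMod n) -
        ∑ l ∈ Finset.range l, systemDiff n m ((i + l * m : ℕ) : ZMod n) := by
      rcases Nat.eq_zero_or_pos l with rfl | hl0
      · simp
      · exact h i hi l (by rw [Finset.mem_Icc]; omega)
    rw [← Nat.cast_add, show i + l * m + m = i + (l + 1) * m by ring, h1, h2]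
    unfold systemDiff
    ring

/-- Functions constant on the orbits solve the homogeneous equation. This provides the free
parameters, and a large constant makes all weights at least 3. -/
theorem SolvesUnion.add_of_gcdHom {m : ℕ} {x : ZMod n → ℤ} (h : SolvesUnion n m x)
    (f : ZMod (Nat.gcd n m) → ℤ) : SolvesUnion n m (fun a => x a + f (gcdHom n m a)) := by
  rw [solvesUnion_iff] at h ⊢
  intro a
  rw [h, gcdHom_add]
  ring

theorem existsUnique_solvesUnion {m : ℕ} (h : IsConsistent n m) (t : ℕ → ℤ) :
    ∃! x : ZMod n → ℤ, SolvesUnion n m x ∧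
      ∀ i ∈ Finset.Icc 1 (Nat.gcd n m), x ((i : ℕ) : ZMod n) = t i := by
  obtain ⟨x, hx⟩ := h
  refine ⟨_, ⟨hx.add_of_gcdHom (fun c => t (gcdRep n m c) - x ((gcdRep n m c : ℕ) : ZMod n)), ?_⟩,
    ?_⟩
  · intro i hi
    rw [map_natCast, gcdRep_natCast m hi]
    ring
  · rintro x' ⟨hx', ht'⟩
    have hu := hx.add_of_gcdHom (fun c => t (gcdRep n m c) - x ((gcdRep n m c : ℕ) : ZMod n))
    funext a
    obtain ⟨i, hi, l, -, rfl⟩ := exists_rep m a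
    rw [hx'.eq_sub_sum, ht' i hi]
    have := hu.eq_sub_sum i l
    rw [this]
    rw [map_natCast, gcdRep_natCast m hi]
    ring

theorem exists_solvesUnion_three_le {m : ℕ} (h : IsConsistent n m) :
    ∃ x : ZMod n → ℤ, SolvesUnion n m x ∧ ∀ i, 3 ≤ x i := by
  obtain ⟨x, hx⟩ := h
  refine ⟨_, hx.add_of_gcdHom (fun _ => ∑ i, |x i| + 3), fun i => ?_⟩
  have h1 : |x i| ≤ ∑ i, |x i| :=
    Finset.single_le_sum (f := fun i => |x i|) (fun _ _ => abs_nonneg _) (Finset.mem_univ i)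
  have h2 := neg_abs_le (x i)
  linarith

/-- Add up the indicators of the points on the orbit after α up to β; the difference along the orbit
telescopes to the two end points. -/
theorem exists_sub_eq_indicator {α β : ZMod n} (h : gcdHom n m α = gcdHom n m β) :
    ∃ z : ZMod n → ℤ, ∀ a, z (a + m) - z a =
      (if a = α then 1 else 0) - (if a = β then 1 else 0) := by
  obtain ⟨j, rfl⟩ := exists_eq_add_mul_of_gcdHom_eq m h
  refine ⟨fun a => ∑ l ∈ Finset.range j, if a = α + ((l + 1 : ℕ) : ZMod n) * m then 1 else 0,
    fun a => ?_⟩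
  have e : ∀ l : ℕ, (a + (m : ZMod n) = α + ((l + 1 : ℕ) : ZMod n) * m) ↔
      a = α + (l : ZMod n) * m := by
    intro l
    push_cast
    rw [add_mul, one_mul, ← add_assoc, add_left_inj]
  simp only [e]
  rw [← Finset.sum_sub_distrib, Finset.sum_range_sub'
    (fun l : ℕ => if a = α + (l : ZMod n) * m then (1 : ℤ) else 0)]
  simp

theorem systemDiff_eq (hn : 2 ≤ n) (m : ℕ) (a : ZMod n) :
    systemDiff n m a = 2 * (((if a = -(specialPos n m : ℕ) then 1 else 0) +
        (if a = -(n + m / 2 : ℕ) then 1 else 0)) -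
      ((if a = -(specialPos n 0 : ℕ) then 1 else 0) +
        (if a = -(n + 0 / 2 : ℕ) then 1 else 0))) := by
  unfold systemDiff
  rw [kNumber_eq_sub hn, kNumber_eq_sub hn]
  have e : ∀ k : ℕ, (n : ZMod n) - a = (k : ℕ) ↔ a = -(k : ℕ) := by
    intro k
    rw [ZMod.natCast_self, zero_sub, neg_eq_iff_eq_neg]
  simp only [e]
  ring

/-- Each mass of S_0 is cancelled against a mass of S_m in the same orbit. Quantifying `hab` over
all f says that α, β are the two special positions of S_m in some order, so one lemma serves both
pairings. -/
theorem isConsistent_of_pairing (hn : 2 ≤ n) {α β : ZMod n}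
    (hab : ∀ f : ZMod n → ℤ, f α + f β =
      f (specialPos n m : ℕ) + f (n + m / 2 : ℕ))
    (h1 : gcdHom n m (specialPos n 0 : ℕ) = gcdHom n m α)
    (h2 : gcdHom n m (n + 0 / 2 : ℕ) = gcdHom n m β) : IsConsistent n m := by
  obtain ⟨z₁, hz₁⟩ := exists_sub_eq_indicator m (α := -((specialPos n 0 : ℕ) : ZMod n)) (β := -α)
    (by rw [map_neg, map_neg, h1])
  obtain ⟨z₂, hz₂⟩ := exists_sub_eq_indicator m (α := -((n + 0 / 2 : ℕ) : ZMod n)) (β := -β)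
    (by rw [map_neg, map_neg, h2])
  refine ⟨fun a => 2 * (z₁ a + z₂ a), (solvesUnion_iff _ _ _).mpr fun a => ?_⟩
  rw [systemDiff_eq hn]
  have h3 := hab (fun b => if a = -b then 1 else 0)
  have h4 := hz₁ a
  have h5 := hz₂ a
  linarith

theorem gcdHom_natCast_eq_iff (a b : ℕ) :
    gcdHom n m (a : ZMod n) = gcdHom n m (b : ZMod n) ↔ (Nat.gcd n m : ℤ) ∣ (a : ℤ) - b := by
  rw [map_natCast, map_natCast, natCast_eq_natCast_iff_dvd]

/-- Summing the equation over the class of 0 gives total mass zero there. The special position n of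
S_0 lies in that class, so one of the special positions of S_m does too, and this is the test.
Conversely, either divisibility puts both pairs of masses into common orbits. -/
theorem isConsistent_iff (hn : 2 ≤ n) : IsConsistent n m ↔ ConsistencyTest n m := by
  have hdn : (Nat.gcd n m : ℤ) ∣ n := Int.natCast_dvd_natCast.mpr (Nat.gcd_dvd_left n m)
  have hdm : (Nat.gcd n m : ℤ) ∣ m := Int.natCast_dvd_natCast.mpr (Nat.gcd_dvd_right n m)
  have hn2 : n % 2 = 1 → (n : ℤ) = 2 * ((n - 1) / 2 : ℕ) + 1 := by omega
  have hn2' : n % 2 ≠ 1 → (n : ℤ) = 2 * (n / 2 : ℕ) := by omega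
  have hm2 : (m : ℤ) = (m / 2 : ℕ) + ((m + 1) / 2 : ℕ) := by omega
  constructor
  · rintro ⟨x, hx⟩
    rw [solvesUnion_iff] at hx
    -- An invariant test function, supported on the orbit containing the position n of S_0.
    let φ : ZMod n → ℤ := fun a => if gcdHom n m a = 0 then 1 else 0
    have hφ : ∀ a, φ (a + m) = φ a := fun a => by simp only [φ, gcdHom_add]
    have hφn : ∀ k : ℕ, φ (-(k : ZMod n)) = if Nat.gcd n m ∣ k then 1 else 0 := by
      intro k
      simp only [φ, map_neg, neg_eq_zero, map_natCast, ZMod.natCast_eq_zero_iff]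
    have hsum : ∑ a, φ a * systemDiff n m a = 0 := by
      have e1 : ∀ a, φ a * systemDiff n m a = φ a * x a - φ (a + m) * x (a + m) := by
        intro a; rw [hx, hφ]; ring
      simp only [e1]
      rw [Finset.sum_sub_distrib, sub_eq_zero]
      exact (Equiv.sum_comp (Equiv.addRight (m : ZMod n)) (fun a => φ a * x a)).symm
    have hsum2 : ∑ a, φ a * systemDiff n m a =
        2 * (φ (-(specialPos n m : ℕ)) + φ (-(n + m / 2 : ℕ)) -
          (φ (-(specialPos n 0 : ℕ)) + φ (-(n + 0 / 2 : ℕ)))) := by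
      simp only [systemDiff_eq hn]
      have e2 : ∀ b : ZMod n, ∑ a, φ a * (if a = b then (1 : ℤ) else 0) = φ b := by
        intro b
        simp
      rw [← e2 (-(specialPos n m : ℕ)), ← e2 (-(n + m / 2 : ℕ)), ← e2 (-(specialPos n 0 : ℕ)),
        ← e2 (-(n + 0 / 2 : ℕ)), ← Finset.sum_add_distrib, ← Finset.sum_add_distrib,
        ← Finset.sum_sub_distrib, Finset.mul_sum]
      apply Finset.sum_congr rfl
      intro a _
      ring
    rw [hsum, hφn, hφn, hφn, hφn, if_pos (c := Nat.gcd n m ∣ n + 0 / 2)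
      (by simpa using Nat.gcd_dvd_left n m)] at hsum2
    have hor : Nat.gcd n m ∣ specialPos n m ∨ Nat.gcd n m ∣ n + m / 2 := by
      by_contra hno
      push Not at hno
      rw [if_neg hno.1, if_neg hno.2] at hsum2
      split_ifs at hsum2 <;> omega
    unfold ConsistencyTest
    unfold specialPos at hor
    rcases hor with h | h
    · have h' := Int.natCast_dvd_natCast.mpr h
      split_ifs with hp
      · right
        rw [if_pos hp] at h'
        push_cast at h'
        exact dvd_of_eq_of_dvd (by omega) (dvd_sub h' hdm)
      · right
        rw [if_neg hp] at h'
        push_cast at h'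
        exact dvd_of_eq_of_dvd (by omega) (dvd_sub hdn h')
    · have h' := Int.natCast_dvd_natCast.mpr h
      push_cast at h'
      split_ifs with hp
      · left
        exact dvd_of_eq_of_dvd (by omega) (dvd_sub h' hdm)
      · left
        exact dvd_of_eq_of_dvd (by omega) (dvd_sub (hdn.mul_left 2) h')
  · intro h
    unfold ConsistencyTest at h
    by_cases hp : n % 2 = 1
    · rw [if_pos hp] at h
      rcases h with h | h
      · refine isConsistent_of_pairing m hn (fun f => rfl) ?_ ?_ <;>
          rw [gcdHom_natCast_eq_iff]
        · unfold specialPos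
          rw [if_pos hp, if_pos hp]
          exact dvd_of_eq_of_dvd (by omega) (dvd_sub h hdn)
        · exact dvd_of_eq_of_dvd (by omega) (dvd_sub (dvd_sub hdn h) hdm)
      -- The second alternative of the test pairs the special positions crosswise.
      · refine isConsistent_of_pairing m hn (α := (n + m / 2 : ℕ)) (β := (specialPos n m : ℕ))
          (fun f => add_comm _ _) ?_ ?_ <;> rw [gcdHom_natCast_eq_iff]
        · unfold specialPos
          rw [if_pos hp]
          exact dvd_of_eq_of_dvd (by omega) (dvd_sub h hdn)
        · unfold specialPos
          rw [if_pos hp]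
          exact dvd_of_eq_of_dvd (by omega) (dvd_sub (dvd_sub hdn h) hdm)
    · rw [if_neg hp] at h
      rcases h with h | h
      · refine isConsistent_of_pairing m hn (fun f => rfl) ?_ ?_ <;>
          rw [gcdHom_natCast_eq_iff]
        · unfold specialPos
          rw [if_neg hp, if_neg hp]
          exact dvd_of_eq_of_dvd (by omega) (dvd_sub h hdn)
        · exact dvd_of_eq_of_dvd (by omega) (dvd_sub h hdn)
      · refine isConsistent_of_pairing m hn (α := (n + m / 2 : ℕ)) (β := (specialPos n m : ℕ))
          (fun f => add_comm _ _) ?_ ?_ <;> rw [gcdHom_natCast_eq_iff]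
        · unfold specialPos
          rw [if_neg hp]
          exact dvd_of_eq_of_dvd (by omega) (dvd_sub h hdn)
        · unfold specialPos
          rw [if_neg hp]
          exact dvd_of_eq_of_dvd (by omega) h

end

end Wormhole

namespace Wormhole

/-! ### Periodic enumerations -/

/-- The increasing enumeration of the integers congruent to an element of `L` modulo `N`; the
elements of `L` are the values at `1, …, L.length`. -/
def posEnum (L : List ℕ) (N : ℕ) (i : ℤ) : ℤ :=
  (L.getD ((i - 1) % L.length).toNat 0 : ℕ) + N * ((i - 1) / L.length)

theorem posEnum_add_length {L : List ℕ} (N : ℕ) (hL : 0 < L.length) (i : ℤ) :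
    posEnum L N (i + L.length) = posEnum L N i + N := by
  unfold posEnum
  rw [show i + (L.length : ℤ) - 1 = i - 1 + L.length by ring, Int.add_emod_right,
    Int.add_ediv_of_dvd_right dvd_rfl, Int.ediv_self (by omega)]
  ring

theorem posEnum_natCast_succ {L : List ℕ} (N : ℕ) {k : ℕ} (hk : k < L.length) :
    posEnum L N (k + 1) = L[k] := by
  unfold posEnum
  rw [add_sub_cancel_right, Int.emod_eq_of_lt (by omega) (by omega),
    Int.ediv_eq_zero_of_lt (by omega) (by omega)]
  simp [hk]

theorem exists_posEnum_eq {L : List ℕ} (N : ℕ) (hL : 0 < L.length) (i : ℤ) :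
    ∃ (k : ℕ) (hk : k < L.length) (q : ℤ), i = k + 1 + q * L.length ∧
      posEnum L N i = L[k] + q * N := by
  have h1 := Int.emod_nonneg (i - 1) (show (L.length : ℤ) ≠ 0 by omega)
  have h2 := Int.emod_lt_of_pos (i - 1) (show (0 : ℤ) < L.length by omega)
  have h3 := Int.emod_add_mul_ediv (i - 1) L.length
  have hk : ((i - 1) % L.length).toNat < L.length := by omega
  have hi : i = (((i - 1) % L.length).toNat : ℤ) + 1 + (i - 1) / L.length * L.length := by
    rw [Int.toNat_of_nonneg h1]; linarith
  refine ⟨_, hk, (i - 1) / L.length, hi, ?_⟩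
  conv_lhs => rw [hi]
  rw [FramedTriangulation.add_mul_of_periodic (posEnum_add_length N hL), posEnum_natCast_succ N hk]

theorem strictMono_posEnum {L : List ℕ} {N : ℕ} (hL : 0 < L.length) (hs : L.Pairwise (· < ·))
    (hb : ∀ k ∈ L, 1 ≤ k ∧ k ≤ N) : StrictMono (posEnum L N) := by
  apply strictMono_int_of_lt_succ
  intro i
  obtain ⟨k, hk, q, rfl, h⟩ := exists_posEnum_eq N hL i
  rw [h]
  by_cases hk1 : k + 1 < L.length
  · have e : (k : ℤ) + 1 + q * L.length + 1 = ((k + 1 : ℕ) : ℤ) + 1 + q * L.length := by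
      push_cast; ring
    rw [e, FramedTriangulation.add_mul_of_periodic (posEnum_add_length N hL),
      posEnum_natCast_succ N hk1]
    have := List.pairwise_iff_getElem.mp hs k (k + 1) hk hk1 (by omega)
    omega
  · have e : (k : ℤ) + 1 + q * L.length + 1 = ((0 : ℕ) : ℤ) + 1 + (q + 1) * L.length := by
      have : L.length = k + 1 := by omega
      rw [this]; push_cast; ring
    rw [e, FramedTriangulation.add_mul_of_periodic (posEnum_add_length N hL),
      posEnum_natCast_succ N hL]
    have h1 := hb _ (List.getElem_mem hk)
    have h2 := hb _ (List.getElem_mem hL)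
    linarith

theorem exists_posEnum_eq_iff {L : List ℕ} {N : ℕ} (hL : 0 < L.length) (v : ℤ) :
    (∃ i, posEnum L N i = v) ↔ ∃ k ∈ L, (N : ℤ) ∣ v - k := by
  constructor
  · rintro ⟨i, rfl⟩
    obtain ⟨k, hk, q, -, h⟩ := exists_posEnum_eq N hL i
    exact ⟨L[k], List.getElem_mem hk, q, by rw [h]; ring⟩
  · rintro ⟨k, hk, q, hq⟩
    obtain ⟨j, hj, rfl⟩ := List.mem_iff_getElem.mp hk
    refine ⟨j + 1 + q * L.length, ?_⟩
    rw [FramedTriangulation.add_mul_of_periodic (posEnum_add_length N hL),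
      posEnum_natCast_succ N hj]
    linarith

/-- The change of labels is strictly increasing and skips no label, hence is a translation. -/
theorem exists_shift_of_range_eq {J J' : ℤ → ℤ} (hJ : StrictMono J) (hJ' : StrictMono J')
    (h : ∀ v, (∃ i, J i = v) ↔ ∃ i, J' i = v) : ∃ t, ∀ i, J i = J' (i + t) := by
  have h1 : ∀ i, ∃ j, J' j = J i := fun i => (h _).mp ⟨i, rfl⟩
  choose f hf using h1
  have hfm : StrictMono f := fun i j hij => by
    rw [← hJ'.lt_iff_lt, hf, hf]; exact hJ hij
  have hsucc : ∀ i, f (i + 1) = f i + 1 := by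
    intro i
    have h2 := hfm (show i < i + 1 by omega)
    by_contra hne
    obtain ⟨j, hj⟩ := (h (J' (f i + 1))).mpr ⟨_, rfl⟩
    have h3 : J i < J j := by rw [← hf, hj]; exact hJ' (by omega)
    have h4 : J j < J (i + 1) := by rw [← hf (i + 1), hj]; exact hJ' (by omega)
    rw [hJ.lt_iff_lt] at h3 h4
    omega
  have hfi : ∀ i, f i = i + f 0 := by
    intro i
    induction i using Int.induction_on with
    | zero => omega
    | succ k ih => rw [hsucc, ih]; ring
    | pred k ih => have := hsucc (-k - 1); rw [sub_add_cancel] at this; omega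
  exact ⟨f 0, fun i => by rw [← hfi, hf]⟩

namespace FramedTriangulation

/-- The periodic enumeration of the positions of the weights. -/
def pos (P : FramedTriangulation) : ℤ → ℤ := posEnum P.weightPositions (P.s + 1)

theorem length_weights (P : FramedTriangulation) :
    P.weights.length = P.weightPositions.length := by
  simp [weights]

theorem mem_weightPositions (P : FramedTriangulation) (k : ℕ) :
    k ∈ P.weightPositions ↔ (1 ≤ k ∧ k ≤ P.s + 1) ∧ 2 < P.lind k := by
  unfold weightPositions
  rw [List.mem_filter, List.mem_range'_1, ← entry_eq_lind, decide_eq_true_iff]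
  apply and_congr_left
  intro _
  omega

theorem strictMono_pos {P : FramedTriangulation} (h : 0 < P.weights.length) :
    StrictMono P.pos := by
  rw [length_weights] at h
  refine strictMono_posEnum h ?_ fun k hk => ((P.mem_weightPositions k).mp hk).1
  exact List.Pairwise.filter _ (List.pairwise_lt_range' (s := 1) (n := P.s + 1))

theorem pos_add {P : FramedTriangulation} (h : 0 < P.weights.length) (i : ℤ) :
    P.pos (i + P.weights.length) = P.pos i + ((P.s : ℤ) + 1) := by
  rw [length_weights] at h ⊢
  unfold pos
  rw [posEnum_add_length _ h]
  push_cast; rfl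

theorem two_lt_lind_iff_pos {P : FramedTriangulation} (h : 0 < P.weights.length) (v : ℤ) :
    2 < P.lind v ↔ ∃ i, P.pos i = v := by
  rw [length_weights] at h
  unfold pos
  rw [exists_posEnum_eq_iff h]
  constructor
  · intro hv
    have h1 := P.res_le (v - 1)
    refine ⟨P.res (v - 1) + 1, ?_, ?_⟩
    · rw [mem_weightPositions]
      refine ⟨by omega, ?_⟩
      rw [P.lind_eq_lind_res] at hv
      exact_mod_cast hv
    · exact dvd_of_eq_of_dvd (by push_cast; ring) (P.dvd_sub_res (v - 1))
  · rintro ⟨k, hk, hd⟩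
    rw [mem_weightPositions] at hk
    rw [P.lind_congr (v := k) (by exact_mod_cast hd)]
    exact hk.2

/-- Label 1 is the first weight at a position at least 1, and label 0 lies at a position at most 0.
If vertex 0 is itself a weight, nothing fits in between. -/
theorem pos_zero {P : FramedTriangulation} (h : 0 < P.weights.length) (h0 : 2 < P.hidden) :
    P.pos 0 = 0 := by
  have hm := strictMono_pos h
  rw [hidden_eq_lind, two_lt_lind_iff_pos h] at h0
  obtain ⟨i, hi⟩ := h0
  rw [length_weights] at h
  have h1 : P.pos 1 = P.weightPositions[0] := by
    have := posEnum_natCast_succ (P.s + 1) h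
    unfold pos
    simpa using this
  have h2 := (P.mem_weightPositions _).mp (List.getElem_mem h)
  have h3 : i < 1 := by rw [← hm.lt_iff_lt, h1, hi]; omega
  have h4 : P.pos 0 ≤ 0 := by
    obtain ⟨k, hk, q, h5, h6⟩ := exists_posEnum_eq (P.s + 1) h 0
    have h7 := (P.mem_weightPositions _).mp (List.getElem_mem hk)
    have hq : q ≤ -1 := by
      by_contra hq
      have : 0 ≤ q * P.weightPositions.length := by
        apply mul_nonneg <;> omega
      omega
    unfold pos
    rw [h6]
    push_cast
    nlinarith
  have h5 := hm.monotone (show i ≤ 0 by omega)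
  omega

theorem weightPos_eq_pos {P : FramedTriangulation} (h0 : P.pos 0 = 0) {i : ℕ}
    (hi : i ≤ P.weights.length) : (P.weightPos i : ℤ) = P.pos i := by
  cases i with
  | zero => simpa [weightPos] using h0.symm
  | succ k =>
    rw [length_weights] at hi
    have := posEnum_natCast_succ (P.s + 1) (show k < P.weightPositions.length by omega)
    rw [Nat.cast_succ, pos, this]
    simp [weightPos, show k < P.weightPositions.length by omega]

theorem weights_eq (P : FramedTriangulation) :
    P.weights = (List.range P.weights.length).map (fun k : ℕ => P.lind (P.pos (k + 1))) := by
  apply List.ext_getElem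
  · simp
  · intro k h1 h2
    rw [length_weights] at h1
    rw [List.getElem_map, List.getElem_range, pos, posEnum_natCast_succ _ h1]
    simp only [weights, List.getElem_map]
    rw [entry_eq_lind]

/-! ### Coherent triangulations -/

namespace IsCoherent

variable {P Q : FramedTriangulation} {n : ℕ} {c : ℤ} {J : ℤ → ℤ}

/-- Both the label of a weight and the labels of the gap opposite to it move by t, and only their
sum c enters. So the parity of c is a genuine invariant when n is even. -/
theorem relabel (h : P.IsCoherent n c J) (t : ℤ) :
    P.IsCoherent n (c - 2 * t) (fun i => J (i + t)) where
  mono := fun i j hij => h.mono (by omega)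
  per := fun i => by rw [← h.per]; ring_nf
  weight := fun v => by
    rw [h.weight]
    exact ⟨fun ⟨i, hi⟩ => ⟨i - t, by rwa [sub_add_cancel]⟩, fun ⟨i, hi⟩ => ⟨i + t, hi⟩⟩
  gap := fun g => by
    have := h.gap (g + t)
    rw [show g + t + 1 = g + 1 + t by ring, show c - (g + t) = c - 2 * t - g + t by ring,
      show 2 * (g + t) - c = 2 * g - (c - 2 * t) by ring,
      show 2 * (g + t) + 1 - c = 2 * g + 1 - (c - 2 * t) by ring] at this
    exact this
  one := fun v => by
    rw [h.one]
    constructor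
    · rintro ⟨g, hg⟩
      refine ⟨g - t, ?_⟩
      rw [show 2 * (g - t) - (c - 2 * t) = 2 * g - c by ring,
        show 2 * (g - t) + 1 - (c - 2 * t) = 2 * g + 1 - c by ring, sub_add_cancel,
        show g - t + 1 + t = g + 1 by ring]
      exact hg
    · rintro ⟨g, hg⟩
      refine ⟨g + t, ?_⟩
      rw [show g + t + 1 = g + 1 + t by ring, show 2 * (g + t) - c = 2 * g - (c - 2 * t) by ring,
        show 2 * (g + t) + 1 - c = 2 * g + 1 - (c - 2 * t) by ring]
      exact hg
  fan := fun i β => by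
    rw [h.fan, show c - (i + t) = c - 2 * t - i + t by ring,
      show c - 2 * t - i + t + 1 = c - 2 * t - i + 1 + t by ring]

/-- Changing c by a multiple of n moves every fan by full turns, which is invisible modulo s + 1. -/
theorem shift (h : P.IsCoherent n c J) (k : ℤ) : P.IsCoherent n (c + k * n) J where
  mono := h.mono
  per := h.per
  weight := h.weight
  gap := fun g => by
    have h1 := h.gap g
    have h2 : P.lind (J (c + k * n - g)) = P.lind (J (c - g)) := by
      rw [show c + k * n - g = c - g + k * n by ring, add_mul_of_periodic h.per]
      exact P.lind_congr ⟨k, by ring⟩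
    have h3 : ∀ x, ((n : ℤ) ∣ x - (c + k * n) ↔ (n : ℤ) ∣ x - c) := fun x => by
      rw [show x - (c + k * n) = x - c - k * n by ring]
      exact dvd_sub_left (Dvd.intro_left k rfl)
    simp only [h2, h3]
    exact h1
  one := fun v => by
    have h3 : ∀ x, ((n : ℤ) ∣ x - (c + k * n) ↔ (n : ℤ) ∣ x - c) := fun x => by
      rw [show x - (c + k * n) = x - c - k * n by ring]
      exact dvd_sub_left (Dvd.intro_left k rfl)
    simp only [h3]
    exact h.one v
  fan := fun i β => by
    rw [h.fan, show c + k * n - i + 1 = c - i + 1 + k * n by ring,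
      show c + k * n - i = c - i + k * n by ring, add_mul_of_periodic h.per,
      add_mul_of_periodic h.per]
    have h3 : ∀ x y, x - (y + k * ((P.s : ℤ) + 1)) = x - y - k * ((P.s : ℤ) + 1) :=
      fun x y => by ring
    have h5 : ∀ x, ((P.s : ℤ) + 1 ∣ x + k * ((P.s : ℤ) + 1) ↔ (P.s : ℤ) + 1 ∣ x) :=
      fun x => dvd_add_left (Dvd.intro_left k rfl)
    have h6 : ∀ x, ((P.s : ℤ) + 1 ∣ x - k * ((P.s : ℤ) + 1) ↔ (P.s : ℤ) + 1 ∣ x) :=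
      fun x => dvd_sub_left (Dvd.intro_left k rfl)
    constructor
    · rintro ⟨z, h7, h8, h9, h10, h11, h12⟩
      refine ⟨z + k * ((P.s : ℤ) + 1), by linarith, by linarith, ?_, ?_, ?_, ?_⟩
      · rw [h3, h6]; exact h9
      · rw [show z + k * ((P.s : ℤ) + 1) - J i = z - J i + k * ((P.s : ℤ) + 1) by ring, h5]
        exact h10
      · rw [show z + k * ((P.s : ℤ) + 1) - J i - 1 = z - J i - 1 + k * ((P.s : ℤ) + 1) by ring, h5]
        exact h11
      · rw [show z + k * ((P.s : ℤ) + 1) - J i + 1 = z - J i + 1 + k * ((P.s : ℤ) + 1) by ring, h5]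
        exact h12
    · rintro ⟨z, h7, h8, h9, h10, h11, h12⟩
      refine ⟨z - k * ((P.s : ℤ) + 1), by linarith, by linarith, ?_, ?_, ?_, ?_⟩
      · rw [show β - (z - k * ((P.s : ℤ) + 1)) = β - z + k * ((P.s : ℤ) + 1) by ring, h5]
        exact h9
      · rw [show z - k * ((P.s : ℤ) + 1) - J i = z - J i - k * ((P.s : ℤ) + 1) by ring, h6]
        exact h10
      · rw [show z - k * ((P.s : ℤ) + 1) - J i - 1 = z - J i - 1 - k * ((P.s : ℤ) + 1) by ring, h6]
        exact h11
      · rw [show z - k * ((P.s : ℤ) + 1) - J i + 1 = z - J i + 1 - k * ((P.s : ℤ) + 1) by ring, h6]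
        exact h12

theorem rotate {r : ℤ} (h : P.IsCoherent n c J) (hs : Q.s = P.s)
    (hQ : ∀ u v, Q.Joined u v ↔ P.Joined (u + r) (v + r)) :
    Q.IsCoherent n c (fun i => J i - r) := by
  have hl := lind_rotation hs hQ
  refine ⟨fun i j hij => by have := h.mono hij; show J i - r < J j - r; omega, fun i => ?_, fun v => ?_,
    fun g => ?_, fun v => ?_, fun i β => ?_⟩
  · rw [h.per, hs]; ring
  · rw [hl, h.weight]
    exact exists_congr fun i => by omega
  · rw [hl, sub_add_cancel, ← h.gap]; ring
  · rw [hl, h.one]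
    exact exists_congr fun g => by
      rw [show v + r = J g + 1 ↔ v = J g - r + 1 by omega,
        show v + r = J (g + 1) - 1 ↔ v = J (g + 1) - r - 1 by omega]
  · rw [hQ, sub_add_cancel, h.fan, hs]
    constructor
    · rintro ⟨z, h1, h2, h3, h4, h5, h6⟩
      refine ⟨z - r, by linarith, by linarith, ?_⟩
      rw [sub_sub_sub_cancel_right]
      exact ⟨dvd_of_eq_of_dvd (by ring) h3, h4, h5, h6⟩
    · rintro ⟨z, h1, h2, h3, h4, h5, h6⟩
      refine ⟨z + r, by linarith, by linarith, ?_⟩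
      rw [show z + r - J i = z - (J i - r) by ring]
      exact ⟨dvd_of_eq_of_dvd (by ring) h3, h4, h5, h6⟩

/-- Two enumerations of the weights of the same triangulation differ by a shift of the labels. -/
theorem exists_shift_pos (h : P.IsCoherent n c J) (hw : 0 < P.weights.length) :
    P.weights.length = n ∧ ∃ t, ∀ i, J i = P.pos (i + t) := by
  obtain ⟨t, ht⟩ := exists_shift_of_range_eq h.mono (strictMono_pos hw)
    (fun v => by rw [← h.weight, two_lt_lind_iff_pos hw])
  refine ⟨?_, t, ht⟩
  have h1 := h.per 0
  rw [ht, ht, ← pos_add hw] at h1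
  have := (strictMono_pos hw).injective h1
  omega

theorem lind_congr_index (h : P.IsCoherent n c J) {i j : ℤ} (hij : (n : ℤ) ∣ i - j) :
    P.lind (J i) = P.lind (J j) := by
  obtain ⟨k, hk⟩ := hij
  rw [show i = j + k * n by linarith, add_mul_of_periodic h.per]
  exact P.lind_congr ⟨k, by ring⟩

/-- The gaps of a coherent triangulation satisfy the equations of the linear system. -/
theorem gap_eq {m : ℕ} (h : P.IsCoherent n m J) {x : ZMod n → ℤ}
    (hx : ∀ i : ℤ, x (i : ZMod n) = P.lind (J i)) (i : ℤ) :
    J (i + 1) - J i - 1 =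
      x ((n : ZMod n) - (i : ZMod n) + (m : ZMod n)) - kNumber n m (i : ZMod n) := by
  have e : (n : ZMod n) - (i : ZMod n) + (m : ZMod n) = ((m - i : ℤ) : ZMod n) := by
    push_cast
    rw [ZMod.natCast_self]; ring
  rw [e, hx, kNumber_intCast, h.gap]
  split_ifs <;> ring

/-- The hidden vertex has label 0, so its fan faces the gap between the labels c and c + 1. For 0 ≤
c < n this gap lies within one turn, and the representatives in `fan` are actual vertices. -/
theorem hiddenDiagonalsGoTo (h : P.IsCoherent n c P.pos) (h0 : P.pos 0 = 0)
    (hw : P.weights.length = n) {m : ℕ} (hm : m < n) (hc : c = m) :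
    P.HiddenDiagonalsGoTo m := by
  subst hc
  intro k
  have e1 := weightPos_eq_pos h0 (i := m) (by omega)
  have e2 := weightPos_eq_pos h0 (i := m + 1) (by omega)
  push_cast at e2
  have hfan := h.fan 0 k
  rw [h0, sub_zero] at hfan
  simp only [sub_zero] at hfan
  have hJm : 0 ≤ P.pos m := by rw [← h0]; exact h.mono.monotone (by omega)
  have hJn : P.pos (m + 1) ≤ (P.s : ℤ) + 1 := by
    have := h.per 0
    rw [h0, zero_add, zero_add] at this
    rw [← this]
    exact h.mono.monotone (by omega)
  have hj : k ≤ P.s → 1 ≤ k → (P.Joined 0 k ↔ (0, k) ∈ P.diagonals) := fun h1 h2 => by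
    exact_mod_cast P.joined_natCast (u := 0) (v := k) (by omega) h1
  constructor
  · intro hd
    have hk := P.isDiagonal _ hd
    refine ⟨hk, ?_⟩
    simp only [IsDiagonal] at hk
    rw [← hj (by omega) (by omega), hfan] at hd
    obtain ⟨z, h1, h2, ⟨q, hq⟩, h4, -⟩ := hd
    have hz0 : z ≠ 0 := by rintro rfl; exact h4 (dvd_zero _)
    have hz1 : z ≠ (P.s : ℤ) + 1 := by rintro rfl; exact h4 dvd_rfl
    have hq0 : q = 0 := by
      have a1 : ((P.s : ℤ) + 1) * q < ((P.s : ℤ) + 1) * 1 := by omega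
      have a2 : ((P.s : ℤ) + 1) * (-1) < ((P.s : ℤ) + 1) * q := by omega
      have b1 := lt_of_mul_lt_mul_left a1 (by omega)
      have b2 := lt_of_mul_lt_mul_left a2 (by omega)
      omega
    subst hq0
    omega
  · rintro ⟨hk, h1, h2⟩
    simp only [IsDiagonal, true_and] at hk
    rw [← hj (by omega) (by omega), hfan]
    obtain ⟨g1, g2, g3⟩ := not_dvd_of_mem (N := (P.s : ℤ) + 1) (T := k) (by omega) (by omega)
    exact ⟨k, by omega, by omega, by simp, g1, g2, g3⟩

/-- A weight has at least two diagonals, while two different closed gaps within one turn share at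
most one vertex. -/
theorem eq_of_hiddenDiagonalsGoTo (h : P.IsCoherent n c P.pos) (h0 : P.pos 0 = 0)
    (hw : P.weights.length = n) (hh : 2 < P.hidden) {m k : ℕ} (hm : m < n) (hk : k < n)
    (hc : c = m) (hg : P.HiddenDiagonalsGoTo k) : m = k := by
  have hg' := h.hiddenDiagonalsGoTo h0 hw hm hc
  have htwo : ∃ a b, a < b ∧ (0, a) ∈ P.diagonals ∧ (0, b) ∈ P.diagonals := by
    unfold hidden index at hh
    have : 1 < (P.diagonals.filter (fun p => p.1 = 0 ∨ p.2 = 0)).card := by omega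
    obtain ⟨⟨u, v⟩, hp, ⟨u', v'⟩, hq, hne⟩ := Finset.one_lt_card.mp this
    rw [Finset.mem_filter] at hp hq
    have h1 := P.isDiagonal _ hp.1
    have h2 := P.isDiagonal _ hq.1
    simp only [IsDiagonal, ne_eq, Prod.mk.injEq] at h1 h2 hp hq hne
    obtain rfl : u = 0 := by omega
    obtain rfl : u' = 0 := by omega
    rcases lt_trichotomy v v' with h3 | h3 | h3
    · exact ⟨v, v', h3, hp.1, hq.1⟩
    · omega
    · exact ⟨v', v, h3, hq.1, hp.1⟩
  obtain ⟨a, b, hab, ha, hb⟩ := htwo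
  have a1 := ((hg a).mp ha).2
  have a2 := ((hg' a).mp ha).2
  have b1 := ((hg b).mp hb).2
  have b2 := ((hg' b).mp hb).2
  have mono : ∀ i j, i ≤ j → j ≤ n → P.weightPos i ≤ P.weightPos j := by
    intro i j hij hj
    have e1 := weightPos_eq_pos h0 (i := i) (by omega)
    have e2 := weightPos_eq_pos h0 (i := j) (by omega)
    have := h.mono.monotone (show (i : ℤ) ≤ j by omega)
    omega
  rcases lt_trichotomy m k with hlt | he | hlt
  · have := mono (m + 1) k (by omega) (by omega)
    omega
  · exact he
  · have := mono (k + 1) m (by omega) (by omega)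
    omega

end IsCoherent

/-- A weight needs two diagonals, and an accordion has at most s - 2. -/
theorem IsAccordion.four_le {P : FramedTriangulation} (h : P.IsAccordion)
    (hw : 0 < P.weights.length) : 4 ≤ P.s := by
  have h2 := (two_lt_lind_iff_pos hw (P.pos 0)).mpr ⟨0, rfl⟩
  obtain ⟨h3, a, p, -, -, -, hD⟩ := h
  have h4 : P.diagonals.card ≤ P.s - 2 := by
    rw [hD]
    exact Finset.card_image_le.trans (by simp)
  unfold lind index at h2
  have h5 := Finset.card_filter_le P.diagonals
    (fun p => p.1 = P.res (P.pos 0) ∨ p.2 = P.res (P.pos 0))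
  omega

/-- The weights of an accordion triangulation form a coherent graph. -/
theorem IsAccordion.exists_isCoherent {P : FramedTriangulation} (h : P.IsAccordion)
    (hw : 2 ≤ P.weights.length) : ∃ c, P.IsCoherent P.weights.length c P.pos :=
  ((isAccordion_iff P).mp h).exists_isCoherent (h.four_le (by omega)) hw
    (strictMono_pos (by omega)) (pos_add (by omega)) (two_lt_lind_iff_pos (by omega))

theorem IsCoherent.eq_lind_pos {P : FramedTriangulation} {n : ℕ} {c : ℤ} {x : ZMod n → ℤ}
    (hn : 0 < n) (hc : P.IsCoherent n c P.pos)
    (h2 : P.weights = (List.range n).map (fun i => x ((i + 1 : ℕ) : ZMod n))) (i : ℤ) :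
    x (i : ZMod n) = P.lind (P.pos i) := by
  have hw : P.weights.length = n := by rw [h2]; simp
  have hn0 : (0 : ℤ) < n := by omega
  have h5 := P.weights_eq
  rw [hw, h2] at h5
  have h6 : ∀ k < n, x ((k + 1 : ℕ) : ZMod n) = P.lind (P.pos (k + 1)) := by
    intro k hk
    have := List.map_inj_left.mp h5 k (List.mem_range.mpr hk)
    exact this
  have h7 := Int.emod_nonneg (i - 1) (show (n : ℤ) ≠ 0 by omega)
  have h8 := Int.emod_lt_of_pos (i - 1) hn0
  have h9 := h6 ((i - 1) % n).toNat (by omega)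
  rw [Int.toNat_of_nonneg h7] at h9
  have h10 : (n : ℤ) ∣ (i - 1) % n - (i - 1) := Int.dvd_emod_sub_self
  have e2 : (((((i - 1) % n).toNat + 1 : ℕ)) : ZMod n) = (i : ZMod n) := by
    rw [← Int.cast_natCast, ZMod.intCast_eq_intCast_iff_dvd_sub]
    push_cast
    rw [Int.toNat_of_nonneg h7, dvd_sub_comm]
    exact dvd_of_eq_of_dvd (by ring) h10
  rw [← e2, h9]
  exact hc.lind_congr_index (dvd_of_eq_of_dvd (by ring) h10)

/-- The type is first reduced modulo n; the diagonals at the hidden vertex then identify it with m.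
-/
theorem IsCoherentRotation.isCoherent {P : FramedTriangulation} {n m : ℕ} {x : ZMod n → ℤ}
    (hn : 2 ≤ n) (hm : m ≤ n - 1) (h : IsCoherentRotation n m x P) :
    P.weights.length = n ∧ P.IsCoherent n m P.pos ∧ P.pos 0 = 0 ∧
      ∀ i : ℤ, x (i : ZMod n) = P.lind (P.pos i) := by
  obtain ⟨h1, h2, h3, h4⟩ := h
  have hw : P.weights.length = n := by rw [h2]; simp
  obtain ⟨c, hc⟩ := h1.exists_isCoherent (by omega)
  have h0 := pos_zero (by omega) h3
  rw [hw] at hc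
  have hn0 : (0 : ℤ) < n := by omega
  have hc' := hc.shift (-(c / n))
  have e : c + -(c / n) * n = ((c % n).toNat : ℕ) := by
    rw [Int.toNat_of_nonneg (Int.emod_nonneg _ (by omega))]
    have := Int.emod_add_mul_ediv c n
    linarith
  have hlt := Int.emod_lt_of_pos c hn0
  have hnn := Int.emod_nonneg c (show (n : ℤ) ≠ 0 by omega)
  have heq := hc'.eq_of_hiddenDiagonalsGoTo h0 hw h3 (m := (c % n).toNat) (k := m) (by omega)
    (by omega) e h4
  rw [e, heq] at hc'
  exact ⟨hw, hc', h0, hc'.eq_lind_pos (by omega) h2⟩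

theorem IsCoherent.isCoherentRotation {P : FramedTriangulation} {n m : ℕ} {x : ZMod n → ℤ}
    {J : ℤ → ℤ} (hn : 2 ≤ n) (hm : m ≤ n - 1) (hP : P.IsAccordion) (h : P.IsCoherent n m J)
    (h0 : J 0 = 0) (hx : ∀ i : ℤ, x (i : ZMod n) = P.lind (J i)) :
    IsCoherentRotation n m x P := by
  have hh : 2 < P.hidden := by
    rw [hidden_eq_lind, h.weight]; exact ⟨0, h0⟩
  have hw : 0 < P.weights.length := by
    rw [length_weights, List.length_pos_iff_exists_mem]
    refine ⟨P.s + 1, (P.mem_weightPositions _).mpr ⟨by omega, ?_⟩⟩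
    rw [hidden_eq_lind] at hh
    rwa [P.lind_congr (v := 0) (by simp)]
  obtain ⟨hwn, t, ht⟩ := h.exists_shift_pos hw
  have hp0 := pos_zero hw hh
  have ht0 : t = 0 := by
    have := ht 0
    rw [h0, zero_add] at this
    exact ((strictMono_pos hw).injective (hp0.trans this)).symm
  have hJ : J = P.pos := by
    funext i
    rw [ht, ht0, add_zero]
  subst hJ
  refine ⟨hP, ?_, hh, h.hiddenDiagonalsGoTo h0 hwn (by omega) rfl⟩
  rw [P.weights_eq, hwn]
  apply List.map_congr_left
  intro k _
  rw [← hx]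
  push_cast; rfl

/-- The last label is defined as the remaining number of non-weights. The other labels telescope,
and one full turn has s + 1 vertices, so it is again the size of a gap. -/
theorem edgeLabel_eq {P : FramedTriangulation} (h0 : P.pos 0 = 0) {i : ℕ} (h1 : 1 ≤ i)
    (hi : i ≤ P.weights.length) : P.edgeLabel i = P.pos (i + 1) - P.pos i - 1 := by
  have hw : 0 < P.weights.length := by omega
  have e : ∀ j, j + 1 ≤ P.weights.length →
      (P.weightPos (j + 1) : ℤ) - P.weightPos j - 1 = P.pos (j + 1) - P.pos j - 1 := by
    intro j hj
    rw [weightPos_eq_pos h0 hj, weightPos_eq_pos h0 (by omega)]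
    push_cast; rfl
  unfold edgeLabel
  split_ifs with hlt
  · exact e i (by omega)
  · obtain rfl : i = P.weights.length := by omega
    have hsum : ∀ k : ℕ, 1 ≤ k → k ≤ P.weights.length →
        ∑ j ∈ Finset.Ico 1 k, ((P.weightPos (j + 1) : ℤ) - P.weightPos j - 1) =
          P.pos k - P.pos 1 - (k - 1) := by
      intro k hk
      induction k, hk using Nat.le_induction with
      | base => intro _; simp
      | succ k hk ih =>
        intro hk'
        rw [Finset.sum_Ico_succ_top hk, ih (by omega), e k hk']
        push_cast; ring
    rw [hsum _ h1 le_rfl]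
    have p1 := pos_add hw 1
    have p0 := pos_add hw 0
    rw [zero_add, h0, zero_add] at p0
    rw [add_comm (1 : ℤ)] at p1
    rw [p1, p0]
    ring

end FramedTriangulation

end Wormhole

/-! ### WW-decompositions, companions and twins. -/

namespace Wormhole

theorem one_lt_hjValue {l : List ℤ} (hl : l ≠ []) (h : ∀ a ∈ l, 2 ≤ a) : 1 < hjValue l := by
  induction l with
  | nil => exact absurd rfl hl
  | cons e l ih =>
    have he : (2 : ℚ) ≤ e := by exact_mod_cast h e (by simp)
    rw [hjValue]
    by_cases hl' : l = []
    · subst hl'; simp only [hjValue, inv_zero]; linarith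
    · have := inv_lt_one_of_one_lt₀ (ih hl' fun a ha => h a (by simp [ha]))
      linarith

theorem inv_hjValue_mem {l : List ℤ} (h : ∀ a ∈ l, 2 ≤ a) :
    0 ≤ (hjValue l)⁻¹ ∧ (hjValue l)⁻¹ < 1 := by
  by_cases hl : l = []
  · subst hl; simp [hjValue]
  · have h1 := one_lt_hjValue hl h
    exact ⟨by positivity, inv_lt_one_of_one_lt₀ h1⟩

/-- With entries at least 2, the inverse of the tail lies in [0, 1), so the value determines the
first entry and then the tail. -/
theorem hjValue_injective {k l : List ℤ} (hk : ∀ a ∈ k, 2 ≤ a) (hl : ∀ a ∈ l, 2 ≤ a)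
    (h : hjValue k = hjValue l) : k = l := by
  induction k generalizing l with
  | nil =>
    by_contra hne
    have := one_lt_hjValue (Ne.symm hne) hl
    rw [← h, hjValue] at this
    linarith
  | cons e k ih =>
    cases l with
    | nil =>
      have := one_lt_hjValue (by simp) hk
      rw [h, hjValue] at this
      linarith
    | cons f l =>
      have hk' : ∀ a ∈ k, 2 ≤ a := fun a ha => hk a (by simp [ha])
      have hl' : ∀ a ∈ l, 2 ≤ a := fun a ha => hl a (by simp [ha])
      obtain ⟨a1, a2⟩ := inv_hjValue_mem hk'
      obtain ⟨b1, b2⟩ := inv_hjValue_mem hl'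
      rw [hjValue, hjValue] at h
      have h1 : (e : ℚ) < f + 1 := by linarith
      have h2 : (f : ℚ) < e + 1 := by linarith
      have h3 : e < f + 1 := by exact_mod_cast h1
      have h4 : f < e + 1 := by exact_mod_cast h2
      have h5 : e = f := by omega
      subst h5
      rw [ih hk' hl' (inv_injective (by linarith))]

theorem isHJFraction_of_two_le {k : List ℤ} (hne : k ≠ []) (h : ∀ a ∈ k, 2 ≤ a) :
    IsHJFraction k := by
  refine ⟨hne, fun a ha => by have := h a ha; omega, ?_, fun i _ h2 => ?_⟩
  · have := one_lt_hjValue hne h; linarith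
  · have := one_lt_hjValue (l := k.drop i) (by simpa using h2)
      fun a ha => h a (List.mem_of_mem_drop ha)
    linarith

/-- A list of entries at least two is the dual chain of a cyclic quotient singularity. -/
theorem exists_isDualChain {k : List ℤ} (hne : k ≠ []) (h : ∀ a ∈ k, 2 ≤ a) :
    ∃ m q : ℕ, 0 < q ∧ q < m ∧ Nat.Coprime m q ∧ IsDualChain m q k := by
  have h1 := one_lt_hjValue hne h
  set r := hjValue k with hr
  have hnum : 0 < r.num := Rat.num_pos.mpr (by linarith)
  have hden := r.den_pos
  have hlt : (r.den : ℤ) < r.num := by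
    rw [← Rat.num_div_den r, lt_div_iff₀ (by exact_mod_cast hden), one_mul] at h1
    exact_mod_cast h1
  obtain ⟨m, hm⟩ := Int.eq_ofNat_of_zero_le hnum.le
  have hcop : Nat.Coprime m r.den := by
    have := r.reduced
    rwa [hm] at this
  have hlt' : r.den < m := by rw [hm] at hlt; exact_mod_cast hlt
  -- The value is m / (m - q), so q is the numerator minus the denominator.
  refine ⟨m, m - r.den, by omega, by omega, ?_, isHJFraction_of_two_le hne h, h, ?_⟩
  · exact (Nat.coprime_self_sub_right hlt'.le).mpr hcop
  · rw [← hr, Nat.cast_sub hlt'.le, sub_sub_cancel]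
    conv_lhs => rw [← Rat.num_div_den r, hm]
    simp

theorem IsDualChain.unique {m q : ℕ} {k l : List ℤ} (hk : IsDualChain m q k)
    (hl : IsDualChain m q l) : k = l :=
  hjValue_injective hk.2.1 hl.2.1 (hk.2.2.trans hl.2.2.symm)

theorem sum_modify_sub_one (k : List ℤ) (α : ℕ) (h : α < k.length) :
    (k.modify α (fun a => a - 1)).sum = k.sum - 1 := by
  induction k generalizing α with
  | nil => simp at h
  | cons e k ih =>
    cases α with
    | zero => simp; ring
    | succ α =>
      rw [List.modify_succ_cons, List.sum_cons, List.sum_cons, ih α (by simpa using h)]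
      ring

theorem IsWWDecomposition.length_eq {k b : List ℤ} (h : IsWWDecomposition k b) :
    b.length = k.length := by
  obtain ⟨-, -, α, β, -, -, rfl⟩ := h
  simp

/-- The right-hand side does not involve b, so all WW-decompositions of k share their hidden index.
-/
theorem IsWWDecomposition.hidden_eq {k b : List ℤ} (h : IsWWDecomposition k b) :
    hiddenOfZeroFraction b = 3 * ((k.length : ℤ) - 1) - (k.sum - 2) := by
  have hl := h.length_eq
  obtain ⟨-, -, α, β, h1, h2, rfl⟩ := h
  unfold hiddenOfZeroFraction
  rw [hl, sum_modify_sub_one _ _ (by simpa using h2), sum_modify_sub_one _ _ (by omega)]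
  ring

namespace FramedTriangulation

theorem getElem_chain (P : FramedTriangulation) (i : ℕ) (hi : i < P.chain.length) :
    P.chain[i] = P.lind (i + 1) := by
  rw [length_chain] at hi
  have := P.lind_natCast (i + 1) (by omega)
  push_cast at this
  rw [this]
  simp [chain]

theorem chain_injective {P Q : FramedTriangulation} (h : P.chain = Q.chain) : P = Q := by
  have hs : P.s = Q.s := by rw [← length_chain, h, length_chain]
  have hE : P.extChain = Q.extChain := by
    unfold extChain
    rw [hidden_eq, hidden_eq, h]
  refine eq_of_lind_eq P Q hs fun v => ?_
  rw [P.lind_congr (v := ((P.res (v - 1) : ℕ) : ℤ) + 1)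
      (dvd_of_eq_of_dvd (by ring) (P.dvd_sub_res (v - 1))),
    Q.lind_congr (v := ((P.res (v - 1) : ℕ) : ℤ) + 1)
      (dvd_of_eq_of_dvd (by ring) (hs ▸ P.dvd_sub_res (v - 1)))]
  have hr := P.res_le (v - 1)
  rw [← P.getElem_extChain _ (by rw [length_extChain]; omega),
    ← Q.getElem_extChain _ (by rw [length_extChain]; omega)]
  simp only [hE]

theorem exists_index_of_not_dvd {P : FramedTriangulation} {e : ℤ}
    (h : ¬ ((P.s : ℤ) + 1) ∣ e) : ∃ a : ℕ, a < P.s ∧ ((P.s : ℤ) + 1) ∣ e - (a + 1) := by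
  have h1 := P.dvd_sub_res e
  have h2 := P.res_le e
  have h3 : P.res e ≠ 0 := by
    intro h3; rw [h3] at h1; exact h (by simpa using h1)
  exact ⟨P.res e - 1, by omega, dvd_of_eq_of_dvd (by push_cast [Nat.one_le_iff_ne_zero.mpr h3]; ring) h1⟩

theorem not_dvd_of_one_lt_hidden {P : FramedTriangulation} (h : 1 < P.hidden) {e : ℤ}
    (he : P.lind e = 1) : ¬ ((P.s : ℤ) + 1) ∣ e := by
  intro hd
  rw [hidden_eq_lind, P.lind_congr (u := 0) (v := e) (by simpa using hd), he] at h
  exact lt_irrefl _ h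

theorem three_le_of_one_lt_hidden {P : FramedTriangulation} (h : 1 < P.hidden) : 3 ≤ P.s := by
  by_contra h3
  have h2 : P.s = 2 := by have := P.two_le; omega
  have := P.index_of_s_eq_two h2 0
  unfold hidden at h
  omega

theorem dvd_natCast_succ_sub_iff {N : ℤ} {i a : ℕ} (hi : (i : ℤ) < N) (ha : (a : ℤ) < N) :
    N ∣ ((i : ℤ) + 1) - (a + 1) ↔ i = a := by
  constructor
  · intro h
    have := Int.eq_zero_of_abs_lt_dvd h (by rw [abs_lt]; constructor <;> omega)
    omega
  · rintro rfl; simp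

/-- All entries of k are at least 2, so ones can occur only at the two lowered positions. There are
at least two ears, none of them hidden, so both positions carry ones; raising these to 2 recovers k.
Conversely, two ears single out the positions to lower. -/
theorem isWWDecomposition_iff {P : FramedTriangulation} (h : 1 < P.hidden) (k : List ℤ) :
    IsWWDecomposition k P.chain ↔ P.HasTwoEars ∧ k = P.chain.map (max 2) := by
  have h3 := three_le_of_one_lt_hidden h
  constructor
  · intro hk
    have hlen := hk.length_eq
    rw [length_chain] at hlen
    obtain ⟨hk1, -, α, β, hab, hb, hc⟩ := hk
    have hget : ∀ i (hi : i < k.length), P.lind (i + 1) =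
        if i = α ∨ i = β then k[i] - 1 else k[i] := by
      intro i hi
      rw [← P.getElem_chain i (by rw [length_chain]; omega)]
      simp only [hc, List.getElem_modify]
      split_ifs <;> omega
    have hone : ∀ i (hi : i < k.length), P.lind (i + 1) = 1 → i = α ∨ i = β := by
      intro i hi h1
      rw [hget i hi] at h1
      by_contra hne
      rw [if_neg hne] at h1
      have := hk1 _ (List.getElem_mem hi)
      omega
    obtain ⟨e, e', hee, he, he'⟩ := P.exists_two_ears h3
    obtain ⟨a, ha, had⟩ := exists_index_of_not_dvd (not_dvd_of_one_lt_hidden h he)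
    obtain ⟨b, hb', hbd⟩ := exists_index_of_not_dvd (not_dvd_of_one_lt_hidden h he')
    rw [P.lind_congr had] at he
    rw [P.lind_congr hbd] at he'
    have hne : a ≠ b := by
      rintro rfl
      exact hee (dvd_of_eq_of_dvd (by ring) (dvd_sub had hbd))
    have ha1 := hone a (by omega) he
    have hb1 := hone b (by omega) he'
    have hαβ : P.lind (α + 1) = 1 ∧ P.lind (β + 1) = 1 := by
      rcases ha1 with rfl | rfl <;> rcases hb1 with rfl | rfl
      · exact absurd rfl hne
      · exact ⟨he, he'⟩
      · exact ⟨he', he⟩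
      · exact absurd rfl hne
    refine ⟨⟨α + 1, β + 1, ?_, fun v => ⟨fun hv => ?_, ?_⟩⟩, ?_⟩
    · rw [dvd_natCast_succ_sub_iff (by omega) (by omega)]; omega
    · obtain ⟨c, hc1, hcd⟩ := exists_index_of_not_dvd (not_dvd_of_one_lt_hidden h hv)
      rw [P.lind_congr hcd] at hv
      rcases hone c (by omega) hv with rfl | rfl
      · exact Or.inl hcd
      · exact Or.inr hcd
    · rintro (hv | hv)
      · rw [P.lind_congr hv, hαβ.1]
      · rw [P.lind_congr hv, hαβ.2]
    · refine List.ext_getElem (by simp [hlen, length_chain]) fun i hi _ => ?_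
      rw [List.getElem_map, getElem_chain]
      have h1 := hget i hi
      have h2 := hk1 _ (List.getElem_mem hi)
      split_ifs at h1 with hi'
      · rcases hi' with rfl | rfl
        · rw [hαβ.1] at h1 ⊢; omega
        · rw [hαβ.2] at h1 ⊢; omega
      · rw [h1]; omega
  · rintro ⟨⟨e, e', hee, hone⟩, rfl⟩
    refine ⟨fun a ha => ?_, P.isZeroFraction_chain, ?_⟩
    · obtain ⟨c, -, rfl⟩ := List.mem_map.mp ha
      omega
    have he := (hone e).mpr (Or.inl (by simp))
    have he' := (hone e').mpr (Or.inr (by simp))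
    obtain ⟨a, ha, had⟩ := exists_index_of_not_dvd (not_dvd_of_one_lt_hidden h he)
    obtain ⟨b, hb, hbd⟩ := exists_index_of_not_dvd (not_dvd_of_one_lt_hidden h he')
    have hne : a ≠ b := by
      rintro rfl
      exact hee (dvd_of_eq_of_dvd (by ring) (dvd_sub had hbd))
    have hone' : ∀ i : ℕ, i < P.s → (P.lind (i + 1) = 1 ↔ i = a ∨ i = b) := by
      intro i hi
      rw [hone, ← dvd_natCast_succ_sub_iff (N := (P.s : ℤ) + 1) (by omega) (by omega),
        ← dvd_natCast_succ_sub_iff (N := (P.s : ℤ) + 1) (a := b) (by omega) (by omega)]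
      refine or_congr ⟨fun hd => ?_, fun hd => ?_⟩ ⟨fun hd => ?_, fun hd => ?_⟩
      · exact dvd_of_eq_of_dvd (by ring) (dvd_add hd had)
      · exact dvd_of_eq_of_dvd (by ring) (dvd_sub hd had)
      · exact dvd_of_eq_of_dvd (by ring) (dvd_add hd hbd)
      · exact dvd_of_eq_of_dvd (by ring) (dvd_sub hd hbd)
    refine ⟨min a b, max a b, by omega, by simp [length_chain]; omega, ?_⟩
    refine List.ext_getElem (by simp) fun i hi _ => ?_
    have hi' : i < P.s := by rwa [length_chain] at hi
    simp only [List.getElem_modify, List.getElem_map, getElem_chain]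
    have h1 := hone' i hi'
    have h2 := P.one_le_lind (i + 1)
    by_cases hc : i = a ∨ i = b
    · rw [h1.mpr hc]
      split_ifs <;> omega
    · have h4 : P.lind (i + 1) ≠ 1 := fun h => hc (h1.mp h)
      split_ifs <;> omega

/-- Two triangulations with hidden index greater than one and two ears each, whose indices agree
after replacing ones by twos. -/
structure IsTwin (P Q : FramedTriangulation) : Prop where
  s_eq : Q.s = P.s
  max_eq : ∀ v, max 2 (Q.lind v) = max 2 (P.lind v)
  ne : P ≠ Q
  hidden_left : 1 < P.hidden
  hidden_right : 1 < Q.hidden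
  ears_left : P.HasTwoEars
  ears_right : Q.HasTwoEars

theorem IsTwin.symm {P Q : FramedTriangulation} (h : P.IsTwin Q) : Q.IsTwin P :=
  ⟨h.s_eq.symm, fun v => (h.max_eq v).symm, h.ne.symm, h.hidden_right, h.hidden_left,
    h.ears_right, h.ears_left⟩

theorem isTwin_of_isWWDecomposition {P Q : FramedTriangulation} {k : List ℤ}
    (hP : IsWWDecomposition k P.chain) (hQ : IsWWDecomposition k Q.chain)
    (hne : P ≠ Q) (h : 1 < P.hidden) : P.IsTwin Q := by
  have hh : Q.hidden = P.hidden := by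
    rw [hidden_eq, hidden_eq, hP.hidden_eq, hQ.hidden_eq]
  have hs : Q.s = P.s := by
    rw [← length_chain, ← length_chain, hP.length_eq, hQ.length_eq]
  have h1 := (isWWDecomposition_iff h k).mp hP
  have h2 := (isWWDecomposition_iff (by rwa [hh]) k).mp hQ
  refine ⟨hs, fun v => ?_, hne, h, by rwa [hh], h1.1, h2.1⟩
  -- The hidden vertex is not part of the chain; there the equality of hidden indices is used.
  by_cases hv : ((P.s : ℤ) + 1) ∣ v
  · rw [P.lind_congr (v := 0) (by simpa using hv),
      Q.lind_congr (v := 0) (by rw [hs]; simpa using hv), ← hidden_eq_lind, ← hidden_eq_lind, hh]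
  · obtain ⟨a, ha, had⟩ := exists_index_of_not_dvd hv
    rw [P.lind_congr had, Q.lind_congr (by rwa [hs]), ← getElem_chain _ _ (by rwa [length_chain, hs]),
      ← getElem_chain _ _ (by rwa [length_chain])]
    have h3 := h2.2.symm.trans h1.2
    have h4 := List.getElem_of_eq h3 (i := a) (by rwa [List.length_map, length_chain, hs])
    simpa using h4

/-- The common dual chain is the chain with ones raised to 2, and any list of entries at least 2
belongs to some singularity. This removes continued fractions from the rest of the argument. -/
theorem isCompanion_iff (P Q : FramedTriangulation) : IsCompanion P Q ↔ P.IsTwin Q := by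
  constructor
  · rintro ⟨m, q, ⟨-, -, -, k', hk', -, hh⟩, k, hk, hP, hQ, hne⟩
    obtain rfl := hk.unique hk'
    refine isTwin_of_isWWDecomposition hP hQ (fun h => hne (by rw [h])) ?_
    rw [hidden_eq]
    exact hh _ hP
  · intro h
    have hk : Q.chain.map (max 2) = P.chain.map (max 2) := by
      refine List.ext_getElem (by simp [length_chain, h.s_eq]) fun i hi _ => ?_
      rw [List.getElem_map, List.getElem_map, getElem_chain, getElem_chain, h.max_eq]
    have hP := (isWWDecomposition_iff h.hidden_left _).mpr ⟨h.ears_left, rfl⟩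
    have hQ := (isWWDecomposition_iff h.hidden_right _).mpr ⟨h.ears_right, hk.symm⟩
    have hne : P.chain ≠ Q.chain := fun he => h.ne (chain_injective he)
    have hlen : P.chain.map (max 2) ≠ [] := by
      intro he
      have := congrArg List.length he
      rw [List.length_map, length_chain] at this
      have := P.two_le
      simp_all
    obtain ⟨m, q, h1, h2, h3, h4⟩ := exists_isDualChain hlen (fun a ha => by
      obtain ⟨c, -, rfl⟩ := List.mem_map.mp ha; omega)
    refine ⟨m, q, ⟨h1, h2, h3, _, h4, ⟨_, _, hne, hP, hQ⟩, fun b hb => ?_⟩, _, h4, hP, hQ, hne⟩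
    rw [hb.hidden_eq, ← hP.hidden_eq, ← FramedTriangulation.hidden_eq]
    exact h.hidden_left

theorem IsCompanion.symm {P Q : FramedTriangulation} (h : IsCompanion P Q) : IsCompanion Q P :=
  (isCompanion_iff Q P).mpr ((isCompanion_iff P Q).mp h).symm

/-- Of two different decompositions, at least one differs from that of P, and it is the chain of a
triangulation. -/
theorem isBasicWormhole_iff (P : FramedTriangulation) :
    P.IsBasicWormhole ↔ ∃ Q, IsCompanion P Q := by
  constructor
  · rintro ⟨m, q, hb, k, hk, hP⟩
    obtain ⟨-, -, -, k', hk', ⟨b, b', hne, h1, h2⟩, hh⟩ := id hb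
    obtain rfl := hk.unique hk'
    obtain ⟨Q, hQ⟩ := exists_chain_eq b h1.2.1
    obtain ⟨Q', hQ'⟩ := exists_chain_eq b' h2.2.1
    subst hQ hQ'
    by_cases h : P.chain = Q.chain
    · exact ⟨Q', m, q, hb, k, hk, hP, h2, h ▸ hne⟩
    · exact ⟨Q, m, q, hb, k, hk, hP, h1, h⟩
  · rintro ⟨Q, m, q, hb, k, hk, hP, -⟩
    exact ⟨m, q, hb, k, hk, hP⟩

theorem HasTwoEars.of_lind_eq {P Q : FramedTriangulation} {r : ℤ} (hs : Q.s = P.s)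
    (hl : ∀ v, Q.lind v = P.lind (v + r)) (h : P.HasTwoEars) : Q.HasTwoEars := by
  obtain ⟨e, e', h1, h2⟩ := h
  refine ⟨e - r, e' - r, by rw [hs]; simpa using h1, fun v => ?_⟩
  rw [hl, h2, hs, show v + r - e = v - (e - r) by ring, show v + r - e' = v - (e' - r) by ring]

theorem HasTwoEars.mirror {P : FramedTriangulation} (h : P.HasTwoEars) : P.mirror.HasTwoEars := by
  obtain ⟨e, e', h1, h2⟩ := h
  refine ⟨-e, -e', fun h => h1 ((dvd_neg).mp (dvd_of_eq_of_dvd (by ring) h)), fun v => ?_⟩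
  rw [lind_mirror, h2, show -v - e = -(v - -e) by ring, show -v - e' = -(v - -e') by ring,
    dvd_neg, dvd_neg]
  rfl

theorem isMirror_iff (P Q : FramedTriangulation) : IsMirror P Q ↔ Q = P.mirror := by
  have key : IsMirror P P.mirror := by
    refine ⟨List.ext_getElem ?_ fun i hi hi' => ?_, ?_⟩
    · rw [List.length_reverse, length_chain, length_chain]; rfl
    · have h1 : i < P.s := by rwa [List.length_reverse, length_chain] at hi'
      rw [List.getElem_reverse, getElem_chain, getElem_chain, lind_mirror]
      refine P.lind_congr ?_
      rw [length_chain]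
      exact ⟨-1, by push_cast [show 1 ≤ P.s by omega, show i ≤ P.s - 1 by omega]; ring⟩
    · rw [hidden_eq_lind, hidden_eq_lind, lind_mirror, neg_zero]
  constructor
  · rintro ⟨h, -⟩
    exact chain_injective (h.trans key.1.symm)
  · rintro rfl; exact key

theorem mirror_mirror (P : FramedTriangulation) : P.mirror.mirror = P :=
  eq_of_lind_eq _ _ rfl fun v => by rw [lind_mirror, lind_mirror, neg_neg]

theorem IsTwin.mirror {P Q : FramedTriangulation} (h : P.IsTwin Q) : P.mirror.IsTwin Q.mirror := by
  refine ⟨h.s_eq, fun v => by rw [lind_mirror, lind_mirror, h.max_eq], fun he => h.ne ?_, ?_, ?_,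
    h.ears_left.mirror, h.ears_right.mirror⟩
  · rw [← P.mirror_mirror, he, mirror_mirror]
  · rw [hidden_eq_lind, lind_mirror, neg_zero, ← hidden_eq_lind]; exact h.hidden_left
  · rw [hidden_eq_lind, lind_mirror, neg_zero, ← hidden_eq_lind]; exact h.hidden_right

/-- Twins stay twins under a common cyclic change of frame. -/
theorem IsTwin.rotate {P P' Q Q' : FramedTriangulation} {r : ℤ} (h : P.IsTwin P')
    (hs : Q.s = P.s) (hl : ∀ v, Q.lind v = P.lind (v + r))
    (hs' : Q'.s = P'.s) (hl' : ∀ v, Q'.lind v = P'.lind (v + r))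
    (h1 : 1 < Q.hidden) (h2 : 1 < Q'.hidden) : Q.IsTwin Q' := by
  refine ⟨by rw [hs, hs', h.s_eq], fun v => by rw [hl, hl', h.max_eq], fun he => h.ne ?_, h1, h2,
    h.ears_left.of_lind_eq hs hl, h.ears_right.of_lind_eq hs' hl'⟩
  refine eq_of_lind_eq _ _ h.s_eq.symm fun v => ?_
  rw [← sub_add_cancel v r, ← hl, ← hl', he]

theorem hasTwoEars_of_count {P : FramedTriangulation} (h : P.extChain.count 1 = 2) :
    P.HasTwoEars := by
  rw [extChain_eq, List.count, List.countP_map, List.countP_eq_length_filter] at h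
  have h' : ((Finset.range (P.s + 1)).filter fun k : ℕ => P.lind (k + 1) = 1).card = 2 := by
    rw [← h]
    simp only [Finset.card, Finset.filter_val, Finset.range_val, Multiset.range,
      Multiset.filter_coe, Multiset.coe_card]
    congr 1
  obtain ⟨a, b, hab, he⟩ := Finset.card_eq_two.mp h'
  have hiff : ∀ k : ℕ, k < P.s + 1 → (P.lind (k + 1) = 1 ↔ k = a ∨ k = b) := by
    intro k hk
    have := congrArg (k ∈ ·) he
    simp only [Finset.mem_filter, Finset.mem_range, Finset.mem_insert, Finset.mem_singleton,
      eq_iff_iff] at this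
    rw [← this]
    exact ⟨fun h => ⟨hk, h⟩, fun h => h.2⟩
  have hmem : ∀ c ∈ ({a, b} : Finset ℕ), c < P.s + 1 := by
    rw [← he]
    exact fun c hc => Finset.mem_range.mp (Finset.mem_filter.mp hc).1
  have ha := hmem a (by simp)
  have hb := hmem b (by simp)
  refine ⟨a + 1, b + 1, ?_, fun v => ?_⟩
  · rw [dvd_natCast_succ_sub_iff (by omega) (by omega)]; exact hab
  · have h1 : ((P.s : ℤ) + 1) ∣ v - ((P.res (v - 1) : ℕ) + 1) :=
      dvd_of_eq_of_dvd (by ring) (P.dvd_sub_res (v - 1))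
    have h2 := P.res_le (v - 1)
    rw [P.lind_congr h1, hiff _ (by omega),
      ← dvd_natCast_succ_sub_iff (N := (P.s : ℤ) + 1) (by omega) (by omega),
      ← dvd_natCast_succ_sub_iff (N := (P.s : ℤ) + 1) (a := b) (by omega) (by omega)]
    refine or_congr ⟨fun hd => ?_, fun hd => ?_⟩ ⟨fun hd => ?_, fun hd => ?_⟩
    · exact dvd_of_eq_of_dvd (by ring) (dvd_add hd h1)
    · exact dvd_of_eq_of_dvd (by ring) (dvd_sub hd h1)
    · exact dvd_of_eq_of_dvd (by ring) (dvd_add hd h1)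
    · exact dvd_of_eq_of_dvd (by ring) (dvd_sub hd h1)

end FramedTriangulation

end Wormhole

/-! ### Accordions with prescribed weights. -/

namespace Wormhole

/-- The list is the extended zero chain of a framed triangulated polygon. -/
def IsExtChain (L : List ℤ) : Prop := ∃ P : FramedTriangulation, P.extChain = L

namespace IsExtChain

open FramedTriangulation

theorem rotate {L : List ℤ} (h : IsExtChain L) (r : ℕ) : IsExtChain (L.rotate r) := by
  obtain ⟨P, rfl⟩ := h
  obtain ⟨Q, hs, hQ⟩ := P.exists_rotation r
  exact ⟨Q, (extChain_rotate_eq_iff P Q r).mpr ⟨hs, lind_rotation hs hQ⟩⟩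

theorem append_comm {a b : List ℤ} (h : IsExtChain (a ++ b)) : IsExtChain (b ++ a) := by
  have := h.rotate a.length
  rwa [List.rotate_append_length_eq] at this

theorem insert_front {v h : ℤ} {r : List ℤ} (H : IsExtChain (v :: (r ++ [h]))) :
    IsExtChain (1 :: (v + 1) :: (r ++ [h + 1])) := by
  obtain ⟨P, hP⟩ := H
  obtain ⟨v', r', h1, h2⟩ := P.chain_insertEar_one (by have := P.two_le; omega)
  refine ⟨P.insertEar 1 le_rfl (by have := P.two_le; omega), ?_⟩
  unfold extChain at hP ⊢
  rw [h2, hidden_insertEar, if_pos rfl]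
  rw [h1, ← List.cons_append] at hP
  obtain ⟨e1, e2⟩ := List.append_inj' hP rfl
  obtain ⟨rfl, rfl⟩ := List.cons.inj e1
  rw [List.singleton_inj.mp e2]
  simp

/-- Gluing each new ear between the hidden vertex and the previous ear builds a fan at the hidden
vertex. Every former ear becomes a 2. -/
theorem insert_front_iterate {h : ℤ} {r : List ℤ} (H : IsExtChain (1 :: (r ++ [h]))) (k : ℕ) :
    IsExtChain (1 :: (List.replicate k 2 ++ (r ++ [h + k]))) := by
  induction k with
  | zero => simpa using H
  | succ k ih =>
    rw [← List.append_assoc] at ih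
    have := ih.insert_front
    rw [List.replicate_succ]
    push_cast
    simpa [add_assoc] using this

theorem insert_back_iterate {h : ℤ} {r : List ℤ} (H : IsExtChain (h :: (r ++ [1]))) (k : ℕ) :
    IsExtChain ((h + k) :: (r ++ (List.replicate k 2 ++ [1]))) := by
  induction k with
  | zero => simpa using H
  | succ k ih =>
    have h1 : IsExtChain ([1] ++ ((h + k) :: (r ++ List.replicate k 2))) := by
      apply append_comm
      simpa using ih
    have h2 : IsExtChain ((h + k) :: (r ++ List.replicate k 2 ++ [1])) := by simpa using ih
    have h3 := h2.insert_front
    have h4 : IsExtChain (((h + k + 1) :: (r ++ List.replicate k 2 ++ [1 + 1])) ++ [1]) := by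
      apply append_comm
      simpa using h3
    rw [List.replicate_succ']
    push_cast
    simpa [add_assoc] using h4

theorem triangle : IsExtChain [1, 1, 1] := by
  refine ⟨⟨2, le_rfl, ∅, by simp, by simp, fun p hp => ?_⟩, ?_⟩
  · unfold IsDiagonal at hp; omega
  · simp [extChain, chain, FramedTriangulation.hidden, index, List.range_succ]

end IsExtChain

theorem filter_replicate_two (k : ℕ) :
    (List.replicate k (2 : ℤ)).filter (fun a => 2 < a) = [] := by
  simp

theorem count_one_replicate_two (k : ℕ) : (List.replicate k (2 : ℤ)).count 1 = 0 := by
  rw [List.count_replicate]; rfl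

/-- Accordion triangulations with arbitrary weights, hidden vertex a weight followed by an ear, and
with arbitrary weights, hidden vertex an ear followed by a weight. -/
theorem exists_isExtChain (k : ℕ) :
    (∀ (l : List ℤ) (x : ℤ), l.length = k → (∀ a ∈ l, 3 ≤ a) → 3 ≤ x →
      ∃ r, IsExtChain (1 :: 2 :: (r ++ [x])) ∧ r.filter (fun a => 2 < a) = l ∧ r.count 1 = 1) ∧
    (∀ (l : List ℤ) (x : ℤ), l.length = k → (∀ a ∈ l, 3 ≤ a) → 3 ≤ x →
      ∃ r, IsExtChain (x :: (r ++ [2, 1])) ∧ r.filter (fun a => 2 < a) = l ∧ r.count 1 = 1) := by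
  induction k with
  | zero =>
    refine ⟨fun l x hl _ hx => ?_, fun l x hl _ hx => ?_⟩
    · obtain ⟨k, hk⟩ : ∃ k : ℕ, x = k + 2 := ⟨(x - 2).toNat, by omega⟩
      refine ⟨List.replicate k 2 ++ [1], ?_, ?_, ?_⟩
      · have := IsExtChain.insert_front_iterate (r := [1]) IsExtChain.triangle (k + 1)
        rw [List.replicate_succ] at this
        have e : x = 1 + ((k + 1 : ℕ) : ℤ) := by push_cast; omega
        rw [e]
        simpa using this
      · rw [List.filter_append, filter_replicate_two, List.length_eq_zero_iff.mp hl]; rfl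
      · rw [List.count_append, count_one_replicate_two]; rfl
    · obtain ⟨k, hk⟩ : ∃ k : ℕ, x = k + 2 := ⟨(x - 2).toNat, by omega⟩
      refine ⟨1 :: List.replicate k 2, ?_, ?_, ?_⟩
      · have := IsExtChain.insert_back_iterate (r := [1]) IsExtChain.triangle (k + 1)
        rw [List.replicate_succ'] at this
        have e : x = 1 + ((k + 1 : ℕ) : ℤ) := by push_cast; omega
        rw [e]
        simpa using this
      · rw [List.filter_cons_of_neg (by simp), filter_replicate_two, List.length_eq_zero_iff.mp hl]
      · rw [List.count_cons, count_one_replicate_two]; rfl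
  | succ k ih =>
    obtain ⟨ihA, ihB⟩ := ih
    refine ⟨fun l x hl h hx => ?_, fun l x hl h hx => ?_⟩
    · obtain ⟨y, l, rfl⟩ := List.exists_cons_of_length_eq_add_one hl
      obtain ⟨r, h1, h2, h3⟩ := ihB l y (by simpa using hl) (fun a ha => h a (by simp [ha]))
        (h y (by simp))
      obtain ⟨k, hk⟩ : ∃ k : ℕ, x = k + 3 := ⟨(x - 3).toNat, by omega⟩
      have hy := h y (by simp)
      refine ⟨List.replicate k 2 ++ y :: r, ?_, ?_, ?_⟩
      -- Framing at the 2 beside the ear makes it the hidden vertex; x - 2 further ears raise it to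
      -- the new weight x. The two families alternate because each new fan grows on the other side
      -- of the old ear.
      · have h4 : IsExtChain (1 :: ((y :: r) ++ [2])) := by
          have : IsExtChain ((y :: (r ++ [2])) ++ [1]) := by simpa using h1
          simpa using this.append_comm
        have h5 := h4.insert_front_iterate (k + 1)
        have e : x = 2 + ((k + 1 : ℕ) : ℤ) := by push_cast; omega
        rw [List.replicate_succ] at h5
        rw [e]
        simpa using h5
      · rw [List.filter_append, filter_replicate_two, List.filter_cons_of_pos (by simp; omega), h2]
        rfl
      · rw [List.count_append, count_one_replicate_two, List.count_cons_of_ne (by omega), h3]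
    · obtain ⟨l, y, rfl⟩ : ∃ l' y, l = l' ++ [y] := by
        have hne : l ≠ [] := by rintro rfl; simp at hl
        exact ⟨l.dropLast, l.getLast hne, (List.dropLast_append_getLast hne).symm⟩
      obtain ⟨r, h1, h2, h3⟩ := ihA l y (by simpa using hl) (fun a ha => h a (by simp [ha]))
        (h y (by simp))
      obtain ⟨k, hk⟩ : ∃ k : ℕ, x = k + 3 := ⟨(x - 3).toNat, by omega⟩
      have hy := h y (by simp)
      refine ⟨r ++ y :: List.replicate k 2, ?_, ?_, ?_⟩
      · have h4 : IsExtChain (2 :: ((r ++ [y]) ++ [1])) := by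
          have : IsExtChain ([1] ++ (2 :: (r ++ [y]))) := by simpa using h1
          simpa using this.append_comm
        have h5 := h4.insert_back_iterate (k + 1)
        have e : x = 2 + ((k + 1 : ℕ) : ℤ) := by push_cast; omega
        rw [List.replicate_succ'] at h5
        rw [e]
        simpa using h5
      · rw [List.filter_append, List.filter_cons_of_pos (by simp; omega), filter_replicate_two, h2]
      · rw [List.count_append, List.count_cons_of_ne (by omega), count_one_replicate_two, h3]

namespace FramedTriangulation

theorem weights_eq_filter (P : FramedTriangulation) :
    P.weights = P.extChain.filter (fun a => 2 < a) := by
  unfold weights weightPositions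
  rw [extChain_eq, List.filter_map, List.range'_eq_map_range, List.filter_map, List.map_map]
  have hf : ∀ k : ℕ, P.entry (1 + k) = P.lind (k + 1) := fun k => by
    rw [entry_eq_lind]; push_cast; rw [add_comm]
  have h1 : (P.entry ∘ fun x => 1 + x) = fun k : ℕ => P.lind (k + 1) := funext hf
  have h2 : ((fun k => decide (2 < P.entry k)) ∘ fun x => 1 + x) =
      (fun a => decide (2 < a)) ∘ fun k : ℕ => P.lind (k + 1) :=
    funext fun k => by simp only [Function.comp, hf]
  rw [h1, h2]

theorem pos_one {P : FramedTriangulation} (h : 2 < P.lind 1) : P.pos 1 = 1 := by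
  have h1 : ∃ L, P.weightPositions = 1 :: L := by
    unfold weightPositions
    rw [List.range'_succ, List.filter_cons_of_pos]
    · exact ⟨_, rfl⟩
    · rw [decide_eq_true_iff, entry_eq_lind]; exact_mod_cast h
  obtain ⟨L, hL⟩ := h1
  have := posEnum_natCast_succ (L := 1 :: L) (P.s + 1) (k := 0) (by simp)
  unfold pos
  rw [hL]
  simpa using this

theorem three_le_of_weights {P : FramedTriangulation} (h : 0 < P.weights.length) : 3 ≤ P.s := by
  by_contra h3
  have h2 : P.s = 2 := by have := P.two_le; omega
  rw [weights_eq_filter, List.length_pos_iff_exists_mem] at h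
  obtain ⟨a, ha⟩ := h
  rw [List.mem_filter, extChain_eq, List.mem_map] at ha
  obtain ⟨⟨k, -, rfl⟩, h4⟩ := ha
  rw [lind, P.index_of_s_eq_two h2] at h4
  simp at h4

/-- The hidden weight has label 0 and is followed by an ear, so `one` with g = 0 gives c ≡ 0 modulo
n. The entry 2 after the ear excludes the other kind of ear. -/
theorem exists_isCoherent_zero {n : ℕ} (hn : 2 ≤ n) (x : ZMod n → ℤ) (hx : ∀ i, 3 ≤ x i) :
    ∃ (P : FramedTriangulation) (J : ℤ → ℤ), P.HasTwoEars ∧ P.IsCoherent n 0 J ∧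
      ∀ i : ℤ, x (i : ZMod n) = P.lind (J i) := by
  set W := (List.range n).map (fun i => x ((i + 1 : ℕ) : ZMod n)) with hW
  have hlen : W.length = n := by simp [hW]
  have hW3 : ∀ a ∈ W, 3 ≤ a := by
    intro a ha
    obtain ⟨i, -, rfl⟩ := List.mem_map.mp ha
    exact hx _
  obtain ⟨l, y, hl⟩ : ∃ l' y, W = l' ++ [y] := by
    have hne : W ≠ [] := by intro h; rw [h] at hlen; simp at hlen; omega
    exact ⟨W.dropLast, W.getLast hne, (List.dropLast_append_getLast hne).symm⟩
  have hy : 3 ≤ y := hW3 y (by simp [hl])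
  obtain ⟨r, ⟨P, hP⟩, h2, h3⟩ := (exists_isExtChain l.length).1 l y rfl
    (fun a ha => hW3 a (by simp [hl, ha])) hy
  have hw : P.weights = W := by
    rw [weights_eq_filter, hP, hl, ← h2]
    simp [show 2 < y by omega]
  have hears : P.HasTwoEars := by
    apply hasTwoEars_of_count
    rw [hP]
    simp [h3, show y ≠ 1 by omega]
  have hwn : P.weights.length = n := by rw [hw, hlen]
  obtain ⟨c, hc⟩ := (hears.isAccordion (three_le_of_weights (by omega))).exists_isCoherent
    (by omega)
  rw [hwn] at hc
  have hget : ∀ k (hk : k < P.extChain.length), P.lind (k + 1) = P.extChain[k] :=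
    fun k hk => (P.getElem_extChain k hk).symm
  have g1 : P.lind 1 = 1 := by
    have := hget 0 (by rw [hP]; simp)
    simpa [hP] using this
  have g2 : P.lind 2 = 2 := by
    have := hget 1 (by rw [hP]; simp)
    norm_num at this
    simpa [hP] using this
  have g0 : 2 < P.hidden := by
    have : P.extChain = (1 :: 2 :: r) ++ [y] := hP
    have := (List.append_inj' this rfl).2
    rw [List.singleton_inj.mp this]; omega
  have hp0 := pos_zero (by omega) g0
  obtain ⟨g, ⟨h4, h5⟩ | ⟨h4, h5⟩⟩ := (hc.one 1).mp g1
  · have h6 : g = 0 := hc.mono.injective (by rw [hp0]; omega)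
    subst h6
    obtain ⟨q, hq⟩ := h4
    refine ⟨P, P.pos, hears, ?_, hc.eq_lind_pos (by omega) (hw.trans hW)⟩
    have := hc.shift q
    rwa [show c + q * n = 0 by linarith] at this
  · have := (hc.weight 2).mpr ⟨g + 1, by omega⟩
    omega

/-- Here the hidden vertex is an ear preceding the weight of label 1. The second kind of ear with g
= 0 gives c ≡ 1 modulo n. -/
theorem exists_isCoherent_one {n : ℕ} (hn : 2 ≤ n) (x : ZMod n → ℤ) (hx : ∀ i, 3 ≤ x i) :
    ∃ (P : FramedTriangulation) (J : ℤ → ℤ), P.HasTwoEars ∧ P.IsCoherent n 1 J ∧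
      ∀ i : ℤ, x (i : ZMod n) = P.lind (J i) := by
  set W := (List.range n).map (fun i => x ((i + 1 : ℕ) : ZMod n)) with hW
  have hlen : W.length = n := by simp [hW]
  have hW3 : ∀ a ∈ W, 3 ≤ a := by
    intro a ha
    obtain ⟨i, -, rfl⟩ := List.mem_map.mp ha
    exact hx _
  obtain ⟨y, l, hl⟩ := List.exists_cons_of_length_pos (l := W) (by omega)
  have hy : 3 ≤ y := hW3 y (by simp [hl])
  obtain ⟨r, ⟨P, hP⟩, h2, h3⟩ := (exists_isExtChain l.length).2 l y rfl
    (fun a ha => hW3 a (by simp [hl, ha])) hy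
  have hw : P.weights = W := by
    rw [weights_eq_filter, hP, hl, ← h2]
    simp [show 2 < y by omega]
  have hears : P.HasTwoEars := by
    apply hasTwoEars_of_count
    rw [hP]
    simp [h3, show y ≠ 1 by omega]
  have hwn : P.weights.length = n := by rw [hw, hlen]
  obtain ⟨c, hc⟩ := (hears.isAccordion (three_le_of_weights (by omega))).exists_isCoherent
    (by omega)
  rw [hwn] at hc
  have hs : r.length + 2 = P.s := by
    have := P.length_extChain
    rw [hP] at this
    simpa using this
  have g1 : P.lind 1 = y := by
    have := P.getElem_extChain 0 (by rw [hP]; simp)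
    simpa [hP] using this.symm
  have g0 : P.lind 0 = 1 := by
    rw [← hidden_eq_lind]
    have : P.extChain = (y :: (r ++ [2])) ++ [1] := by rw [hP]; simp
    have := (List.append_inj' this rfl).2
    exact List.singleton_inj.mp this
  have g2 : P.lind (-1) = 2 := by
    rw [P.lind_congr (v := ((r.length + 1 : ℕ) : ℤ) + 1)
      ⟨-1, by rw [← hs]; push_cast; ring⟩, ← P.getElem_extChain _ (by rw [hP]; simp)]
    simp [hP]
  have hp1 : P.pos 1 = 1 := pos_one (by omega)
  obtain ⟨g, ⟨h4, h5⟩ | ⟨h4, h5⟩⟩ := (hc.one 0).mp g0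
  · have := (hc.weight (-1)).mpr ⟨g, by omega⟩
    omega
  · have h6 : g + 1 = 1 := hc.mono.injective (by rw [hp1]; omega)
    have h7 : g = 0 := by omega
    subst h7
    obtain ⟨q, hq⟩ := h4
    refine ⟨P, P.pos, hears, ?_, hc.eq_lind_pos (by omega) (hw.trans hW)⟩
    have := hc.shift q
    rwa [show c + q * n = 1 by linarith] at this

/-- Relabelling the weights and rotating the frame. -/
theorem IsCoherent.exists_rotation {P : FramedTriangulation} {n : ℕ} {c : ℤ} {J : ℤ → ℤ}
    (h : P.IsCoherent n c J) (t : ℤ) :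
    ∃ Q : FramedTriangulation, Q.s = P.s ∧ (∀ v, Q.lind v = P.lind (v + J t)) ∧
      Q.IsCoherent n (c - 2 * t) (fun i => J (i + t) - J t) := by
  obtain ⟨Q, hs, hQ⟩ := P.exists_rotation (J t)
  exact ⟨Q, hs, lind_rotation hs hQ, (h.relabel t).rotate hs hQ⟩

/-- Relabelling by -⌊m/2⌋ raises the type by 2⌊m/2⌋, so the types 0 and 1 suffice. The weights are
shifted beforehand by the same amount. -/
theorem exists_isCoherentRotation {n m : ℕ} (hn : 2 ≤ n) (hm : m ≤ n - 1) (x : ZMod n → ℤ)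
    (hx : ∀ i, 3 ≤ x i) : ∃ P, IsCoherentRotation n m x P := by
  obtain ⟨P, J, c, hears, hc, hJ, hcm⟩ : ∃ (P : FramedTriangulation) (J : ℤ → ℤ) (c : ℤ),
      P.HasTwoEars ∧ P.IsCoherent n c J ∧
      (∀ i : ℤ, x ((i + (m / 2 : ℕ) : ℤ) : ZMod n) = P.lind (J i)) ∧
      c + 2 * (m / 2 : ℕ) = m := by
    rcases Nat.mod_two_eq_zero_or_one m with h | h
    · obtain ⟨P, J, h1, h2, h3⟩ := exists_isCoherent_zero hn (fun a => x (a + (m / 2 : ℕ)))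
        fun i => hx _
      exact ⟨P, J, 0, h1, h2, fun i => by rw [← h3, Int.cast_add, Int.cast_natCast], by omega⟩
    · obtain ⟨P, J, h1, h2, h3⟩ := exists_isCoherent_one hn (fun a => x (a + (m / 2 : ℕ)))
        fun i => hx _
      exact ⟨P, J, 1, h1, h2, fun i => by rw [← h3, Int.cast_add, Int.cast_natCast], by omega⟩
  obtain ⟨Q, hs, hl, hQ⟩ := hc.exists_rotation (-(m / 2 : ℕ))
  rw [show c - 2 * -((m / 2 : ℕ) : ℤ) = m by linarith] at hQ
  have hQe := hears.of_lind_eq hs hl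
  have hQ3 : 3 ≤ Q.s := by
    apply three_le_of_one_lt_hidden
    have := (hQ.weight 0).mpr ⟨0, by simp⟩
    rw [hidden_eq_lind]; omega
  refine ⟨Q, hQ.isCoherentRotation hn hm (hQe.isAccordion hQ3) (by simp) fun i => ?_⟩
  rw [hl, sub_add_cancel, ← hJ]
  congr 2; ring

/-- A triangulation is determined by its coherent graph. -/
theorem IsCoherent.eq {P Q : FramedTriangulation} {n : ℕ} {c : ℤ} {J J' : ℤ → ℤ}
    (hP : P.IsCoherent n c J) (hQ : Q.IsCoherent n c J') (h0 : J 0 = J' 0)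
    (hx : ∀ i, P.lind (J i) = Q.lind (J' i)) : P = Q := by
  have hJ : J = J' := by
    -- The weights and the common type determine all gaps, hence all positions from one of them. The
    -- type also places the ears, and all other vertices have index 2.
    funext i
    have hstep : ∀ i, J (i + 1) - J i = J' (i + 1) - J' i := fun i => by
      rw [hP.gap, hQ.gap, hx]
    induction i using Int.induction_on with
    | zero => exact h0
    | succ i ih => have := hstep i; omega
    | pred i ih =>
      have := hstep (-i - 1)
      rw [sub_add_cancel] at this
      omega
  subst hJ
  have hs : P.s = Q.s := by
    have h1 := hP.per 0
    have h2 := hQ.per 0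
    omega
  refine eq_of_lind_eq P Q hs fun v => ?_
  have h1 := P.one_le_lind v
  have h2 := Q.one_le_lind v
  have h3 := hP.weight v
  have h4 := hQ.weight v
  have h5 := hP.one v
  have h6 := hQ.one v
  by_cases hw : ∃ i, J i = v
  · obtain ⟨i, rfl⟩ := hw
    exact hx i
  · rw [← h6] at h5
    have := mt h3.mp hw
    have := mt h4.mp hw
    by_cases h7 : P.lind v = 1
    · rw [h7, h5.mp h7]
    · have := mt h5.mpr h7
      omega

theorem IsCoherentRotation.unique {n m : ℕ} (hn : 2 ≤ n) (hm : m ≤ n - 1) {x : ZMod n → ℤ}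
    {P Q : FramedTriangulation} (hP : IsCoherentRotation n m x P)
    (hQ : IsCoherentRotation n m x Q) : P = Q := by
  obtain ⟨-, h1, h2, h3⟩ := hP.isCoherent hn hm
  obtain ⟨-, h4, h5, h6⟩ := hQ.isCoherent hn hm
  exact h1.eq h4 (h2.trans h5.symm) fun i => (h3 i).symm.trans (h6 i)

end FramedTriangulation

end Wormhole

/-! ### Twins, produced pairs and the final list. -/

namespace Wormhole

namespace FramedTriangulation

variable {P Q P' Q' : FramedTriangulation} {n m : ℕ} {x : ZMod n → ℤ}

theorem IsCoherentRotation.systemS (hn : 2 ≤ n) (hm : m ≤ n - 1)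
    (h : IsCoherentRotation n m x P) {y : ZMod n → ℤ}
    (hy : ∀ i ∈ Finset.Icc 1 n, y ((i : ℕ) : ZMod n) = P.edgeLabel i) : SystemS n m x y := by
  obtain ⟨hw, hc, h0, hx⟩ := h.isCoherent hn hm
  have : NeZero n := ⟨by omega⟩
  intro a
  obtain ⟨i, hi, rfl⟩ : ∃ i ∈ Finset.Icc 1 n, (i : ZMod n) = a := by
    by_cases ha : a.val = 0
    · refine ⟨n, Finset.mem_Icc.mpr ⟨by omega, le_rfl⟩, ?_⟩
      rw [ZMod.natCast_self, (ZMod.val_eq_zero a).mp ha]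
    · exact ⟨a.val, Finset.mem_Icc.mpr ⟨by omega, (ZMod.val_lt a).le⟩, by simp⟩
  rw [hy i hi]
  rw [Finset.mem_Icc] at hi
  rw [edgeLabel_eq h0 hi.1 (by omega), hc.gap_eq hx, Int.cast_natCast]

/-- The system of two coherent graphs with the same weights expresses that the weights occupy the
same positions. -/
theorem IsCoherent.solvesUnion_iff {J J' : ℤ → ℤ} (hP : P.IsCoherent n (0 : ℕ) J)
    (hQ : Q.IsCoherent n m J') (h0 : J 0 = J' 0) (hx : ∀ i : ℤ, x (i : ZMod n) = P.lind (J i))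
    (hx' : ∀ i : ℤ, x (i : ZMod n) = Q.lind (J' i)) : SolvesUnion n m x ↔ J = J' := by
  constructor
  · rintro ⟨y, h1, h2⟩
    have hstep : ∀ i, J (i + 1) - J i = J' (i + 1) - J' i := fun i => by
      have h3 := hP.gap_eq hx i
      have h4 := hQ.gap_eq hx' i
      rw [← h1] at h3
      rw [← h2] at h4
      linarith
    funext i
    induction i using Int.induction_on with
    | zero => exact h0
    | succ i ih => have := hstep i; omega
    | pred i ih =>
      have := hstep (-i - 1)
      rw [sub_add_cancel] at this
      omega
  · rintro rfl
    refine ⟨_, fun a => rfl, fun a => ?_⟩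
    obtain ⟨i, rfl⟩ := ZMod.intCast_surjective a
    rw [← hP.gap_eq hx, ← hQ.gap_eq hx']

theorem IsTwin.two_lt_iff (h : P.IsTwin Q) (v : ℤ) : 2 < Q.lind v ↔ 2 < P.lind v := by
  have := h.max_eq v
  omega

theorem IsTwin.weightPositions_eq (h : P.IsTwin Q) : Q.weightPositions = P.weightPositions := by
  unfold weightPositions
  rw [h.s_eq]
  apply List.filter_congr
  intro k _
  rw [entry_eq_lind, entry_eq_lind, decide_eq_decide, h.two_lt_iff]

theorem IsTwin.pos_eq (h : P.IsTwin Q) : Q.pos = P.pos := by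
  unfold pos
  rw [h.weightPositions_eq, h.s_eq]

theorem IsTwin.length_weights_eq (h : P.IsTwin Q) : Q.weights.length = P.weights.length := by
  rw [length_weights, length_weights, h.weightPositions_eq]

theorem IsAccordion.hasTwoEars (h : P.IsAccordion) (h4 : 4 ≤ P.s) : P.HasTwoEars :=
  ((isAccordion_iff P).mp h).hasTwoEars h4

/-- Non-weights have index 1 or 2 and become equal after the replacement, so only the positions of
the weights matter, and equal positions are what the system expresses. The two are distinct because
the diagonals at the hidden vertex face different gaps for 0 and m. -/
theorem IsCoherentRotation.isTwin_iff (hn : 2 ≤ n) (hm1 : 1 ≤ m) (hm : m ≤ n - 1)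
    (hP : IsCoherentRotation n 0 x P) (hQ : IsCoherentRotation n m x Q) :
    SolvesUnion n m x ↔ P.IsTwin Q := by
  obtain ⟨w1, c1, z1, x1⟩ := hP.isCoherent hn (by omega)
  obtain ⟨w2, c2, z2, x2⟩ := hQ.isCoherent hn hm
  rw [c1.solvesUnion_iff c2 (z1.trans z2.symm) x1 x2]
  refine ⟨fun hJ => ?_, fun h => h.pos_eq.symm⟩
  have hs : Q.s = P.s := by
    have h1 := c1.per 0
    have h2 := c2.per 0
    rw [hJ] at h1
    omega
  refine ⟨hs, fun v => ?_, ?_, by have := hP.2.2.1; omega, by have := hQ.2.2.1; omega,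
    hP.1.hasTwoEars (hP.1.four_le (by omega)), hQ.1.hasTwoEars (hQ.1.four_le (by omega))⟩
  · have h1 := c1.weight v
    have h2 := c2.weight v
    rw [← hJ, ← h1] at h2
    by_cases h3 : 2 < P.lind v
    · obtain ⟨i, rfl⟩ := h1.mp h3
      rw [← x1, x2, hJ]
    · have := mt h2.mp h3
      omega
  · rintro rfl
    have := c1.eq_of_hiddenDiagonalsGoTo z1 w1 hQ.2.2.1 (m := 0) (k := m) (by omega) (by omega)
      rfl hQ.2.2.2
    omega

theorem IsCyclicChange.length_weights {r : ℕ} (h : IsCyclicChange r P Q) :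
    Q.weights.length = P.weights.length := by
  unfold IsCyclicChange at h
  rw [weights_eq_filter, weights_eq_filter, h]
  exact ((List.rotate_perm _ r).filter _).length_eq

theorem length_weights_mirror (P : FramedTriangulation) :
    P.mirror.weights.length = P.weights.length := by
  obtain ⟨h1, h2⟩ := (isMirror_iff P P.mirror).mpr rfl
  rw [weights_eq_filter, weights_eq_filter]
  refine (List.Perm.filter _ ?_).length_eq
  unfold extChain
  rw [h1, h2]
  exact (List.reverse_perm _).append_right _

theorem IsProduced.isTwin (hn : 2 ≤ n) (h : IsProduced n Q Q') :
    Q.IsTwin Q' ∧ Q.weights.length = n := by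
  obtain ⟨m, x, P, P', r, h1, h2, -, hS, hP, hP', hr, hr', h3, h4⟩ := h
  have ht := (IsCoherentRotation.isTwin_iff hn h1 h2 hP hP').mp hS
  refine ⟨?_, hr.length_weights.trans (hP.isCoherent hn (by omega)).1⟩
  rw [extChain_rotate_eq_iff] at hr hr'
  exact ht.rotate hr.1 hr.2 hr'.1 hr'.2 h3 h4

theorem exists_isCyclicChange (P : FramedTriangulation) (r : ℕ) :
    ∃ Q, IsCyclicChange r P Q ∧ Q.hidden = P.entry (P.s + 1 + r) := by
  obtain ⟨Q, hs, hQ⟩ := P.exists_rotation r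
  have hl := lind_rotation hs hQ
  refine ⟨Q, (extChain_rotate_eq_iff P Q r).mpr ⟨hs, hl⟩, ?_⟩
  rw [hidden_eq_lind, hl, entry_eq_lind]
  exact P.lind_congr ⟨-1, by push_cast; ring⟩

/-- With an even number of weights, the type of the coherent graph is even as soon as some weight is
immediately followed by an ear. -/
theorem IsCoherent.even_of_ear_after {c : ℤ} {J : ℤ → ℤ} (h : P.IsCoherent n c J)
    (hn : (2 : ℤ) ∣ n) {v : ℤ} (h1 : 2 < P.lind v) (h2 : P.lind (v + 1) = 1) : ∃ t, c = 2 * t := by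
  obtain ⟨i, rfl⟩ := (h.weight v).mp h1
  obtain ⟨g, ⟨h3, -⟩ | ⟨h3, h4⟩⟩ := (h.one _).mp h2
  · have h5 : (2 : ℤ) ∣ c := (dvd_sub_right (dvd_mul_right 2 g)).mp (hn.trans h3)
    exact h5
  -- An ear preceding a weight and also following one fills its gap alone. The gap then has length 2
  -- and is exceptional, so the opposite weight would be 2.
  · exfalso
    have h5 : i < g + 1 := by rw [← h.mono.lt_iff_lt]; omega
    have h6 : ¬ i < g := by
      intro hi
      have h7 := h.mono (show g < g + 1 by omega)
      have h8 : J i < J g := h.mono hi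
      have h9 : J g = J i + 1 := by omega
      have := (h.weight (J i + 1)).mpr ⟨g, h9⟩
      omega
    have h7 : i = g := by omega
    subst h7
    have h8 := h.gap i
    rw [if_pos (Or.inr h3)] at h8
    have := (h.weight _).mpr ⟨c - i, rfl⟩
    omega

/-- Companions are obtained by a cyclic change of frame from a pair of coherent rotations, if the
type of the coherent graph of the first one is even. -/
theorem IsTwin.isProduced_of_isCoherent (hn : 2 ≤ n) (h : Q.IsTwin Q') {t c : ℤ} {J : ℤ → ℤ}
    (hQ : Q.IsCoherent n (2 * t) J) (hQ' : Q'.IsCoherent n c J) : IsProduced n Q Q' := by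
  -- Framing both members at the weight of label t brings the first type to 0; the second type is
  -- then reduced modulo n.
  obtain ⟨P, hs, hl, hP⟩ := hQ.exists_rotation t
  obtain ⟨P', hs', hl', hP'⟩ := hQ'.exists_rotation t
  rw [sub_self] at hP
  have hn0 : (0 : ℤ) < n := by omega
  obtain ⟨m, hm⟩ := Int.eq_ofNat_of_zero_le (Int.emod_nonneg (c - 2 * t) hn0.ne')
  have hm' := Int.emod_lt_of_pos (c - 2 * t) hn0
  have hP'' := hP'.shift (-((c - 2 * t) / n))
  rw [show c - 2 * t + -((c - 2 * t) / n) * n = m by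
    have := Int.emod_add_mul_ediv (c - 2 * t) n
    linarith] at hP''
  set K : ℤ → ℤ := fun i => J (i + t) - J t with hK
  have hK0 : K 0 = 0 := by simp [hK]
  have hh : 1 < P.hidden := by
    have := (hP.weight 0).mpr ⟨0, hK0⟩
    rw [hidden_eq_lind]; omega
  have hh' : 1 < P'.hidden := by
    have := (hP'.weight 0).mpr ⟨0, hK0⟩
    rw [hidden_eq_lind]; omega
  have ht := h.rotate hs hl hs' hl' hh hh'
  have hval : ∀ i, P'.lind (K i) = P.lind (K i) := fun i => by
    have h1 := ht.max_eq (K i)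
    have h2 := (hP.weight _).mpr ⟨i, rfl⟩
    omega
  -- Equal types would make the two members equal by `IsCoherent.eq`.
  have hm0 : m ≠ 0 := by
    rintro rfl
    exact ht.ne (hP.eq hP'' rfl fun i => (hval i).symm)
  set x : ZMod n → ℤ := fun a => P.lind (K (a.cast : ℤ)) with hxdef
  have hx : ∀ i : ℤ, x (i : ZMod n) = P.lind (K i) := fun i => by
    refine hP.lind_congr_index ?_
    rw [ZMod.coe_intCast]
    exact Int.dvd_emod_sub_self
  have hx' : ∀ i : ℤ, x (i : ZMod n) = P'.lind (K i) := fun i => by rw [hx, hval]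
  have hacc := ht.ears_left.isAccordion (three_le_of_one_lt_hidden hh)
  have hacc' := ht.ears_right.isAccordion (three_le_of_one_lt_hidden hh')
  have hr := P.dvd_sub_res (-J t)
  refine ⟨m, x, P, P', P.res (-J t), by omega, by omega, fun a => ?_,
    (hP.solvesUnion_iff hP'' rfl hx hx').mpr rfl,
    IsCoherent.isCoherentRotation hn (by omega) hacc hP hK0 hx,
    IsCoherent.isCoherentRotation hn (by omega) hacc' hP'' hK0 hx', ?_, ?_,
    h.hidden_left, h.hidden_right⟩
  · have := (hP.weight _).mpr ⟨(a.cast : ℤ), rfl⟩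
    exact this
  · refine (extChain_rotate_eq_iff _ _ _).mpr ⟨hs.symm, fun v => ?_⟩
    rw [hl]
    refine Q.lind_congr ?_
    rw [← hs]
    exact dvd_of_eq_of_dvd (by ring) hr
  · refine (extChain_rotate_eq_iff _ _ _).mpr ⟨hs'.symm, fun v => ?_⟩
    rw [hl']
    refine Q'.lind_congr ?_
    rw [h.s_eq, ← hs]
    exact dvd_of_eq_of_dvd (by ring) hr

theorem IsTwin.exists_isCoherent (hn : 2 ≤ n) (h : Q.IsTwin Q') (hw : Q.weights.length = n) :
    (∃ c, Q.IsCoherent n c Q.pos) ∧ ∃ c, Q'.IsCoherent n c Q.pos := by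
  have hw' := h.length_weights_eq
  obtain ⟨c, hc⟩ := (h.ears_left.isAccordion
    (three_le_of_one_lt_hidden h.hidden_left)).exists_isCoherent (by omega)
  obtain ⟨c', hc'⟩ := (h.ears_right.isAccordion
    (three_le_of_one_lt_hidden h.hidden_right)).exists_isCoherent (by omega)
  rw [hw] at hc
  rw [hw', hw, h.pos_eq] at hc'
  exact ⟨⟨c, hc⟩, c', hc'⟩

/-- An even type is all that is needed. For odd n, adding n corrects the parity; for even n, an ear
right after a weight guarantees it. -/
theorem IsTwin.isProduced (hn : 2 ≤ n) (h : Q.IsTwin Q') (hw : Q.weights.length = n)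
    (hp : n % 2 = 1 ∨ ∃ v, 2 < Q.lind v ∧ Q.lind (v + 1) = 1) : IsProduced n Q Q' := by
  obtain ⟨⟨c, hc⟩, c', hc'⟩ := h.exists_isCoherent hn hw
  rcases Nat.mod_two_eq_zero_or_one n with h2 | h2
  · obtain ⟨v, h3, h4⟩ := hp.resolve_left (by omega)
    obtain ⟨t, rfl⟩ := hc.even_of_ear_after (by omega) h3 h4
    exact h.isProduced_of_isCoherent hn hc hc'
  · rcases Int.emod_two_eq_zero_or_one c with h3 | h3
    · obtain ⟨t, rfl⟩ := Int.dvd_of_emod_eq_zero h3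
      exact h.isProduced_of_isCoherent hn hc hc'
    · obtain ⟨t, ht⟩ : (2 : ℤ) ∣ c + 1 * n := by omega
      have := hc.shift 1
      rw [ht] at this
      exact h.isProduced_of_isCoherent hn this hc'

/-- Only an odd type with n even resists a direct production. Then an ear precedes a weight, and it
follows one in the mirror image. -/
theorem isListedPair_iff (hn : 2 ≤ n) (Q Q' : FramedTriangulation) :
    IsListedPair n Q Q' ↔ Q.IsTwin Q' ∧ Q.weights.length = n := by
  constructor
  · rintro (h | h | ⟨R, R', hR, hR', h⟩)
    · exact IsProduced.isTwin hn h
    · obtain ⟨h1, h2⟩ := IsProduced.isTwin hn h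
      exact ⟨h1.symm, h1.length_weights_eq.trans h2⟩
    · obtain ⟨h1, h2⟩ := IsProduced.isTwin hn h
      rw [isMirror_iff] at hR hR'
      subst hR hR'
      rw [length_weights_mirror] at h2
      have := h1.mirror
      rw [mirror_mirror, mirror_mirror] at this
      exact ⟨this, h2⟩
  · rintro ⟨h, hw⟩
    by_cases h1 : n % 2 = 1 ∨ ∃ v, 2 < Q.lind v ∧ Q.lind (v + 1) = 1
    · exact Or.inl (h.isProduced hn hw h1)
    refine Or.inr (Or.inr ⟨Q.mirror, Q'.mirror, (isMirror_iff _ _).mpr rfl,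
      (isMirror_iff _ _).mpr rfl, h.mirror.isProduced hn
      ((length_weights_mirror Q).trans hw) (Or.inr ?_)⟩)
    push Not at h1
    obtain ⟨⟨c, hc⟩, -⟩ := h.exists_isCoherent hn hw
    rcases Int.emod_two_eq_zero_or_one c with h3 | h3
    · obtain ⟨t, rfl⟩ := Int.dvd_of_emod_eq_zero h3
      exact absurd ((hc.one _).mpr ⟨t, Or.inl ⟨by simp, rfl⟩⟩)
        (h1.2 _ ((hc.weight _).mpr ⟨t, rfl⟩))
    · obtain ⟨t, ht⟩ : (2 : ℤ) ∣ c - 1 := by omega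
      -- For c = 2t + 1 the vertex before the weight of label t + 1 is an ear; the reflection sends
      -- v to -v.
      refine ⟨-Q.pos (t + 1), ?_, ?_⟩
      · rw [lind_mirror, neg_neg, hc.weight]
        exact ⟨_, rfl⟩
      · rw [lind_mirror, hc.one]
        exact ⟨t, Or.inr ⟨by rw [show 2 * t + 1 - c = 0 by omega]; simp, by ring⟩⟩

end FramedTriangulation

end Wormhole

open Wormhole Wormhole.FramedTriangulation in
theorem corollary3p18 (n : ℕ) (hn : 2 ≤ n) :
    -- Step I: the families and the systems of their coherent graphs
    (∀ m : ℕ, m ≤ n - 1 → ∀ x : ZMod n → ℤ, (∀ i, 3 ≤ x i) →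
      (∃! P : FramedTriangulation, IsCoherentRotation n m x P) ∧
      ∀ P : FramedTriangulation, IsCoherentRotation n m x P →
        ∀ y : ZMod n → ℤ, (∀ i ∈ Finset.Icc 1 n, y ((i : ℕ) : ZMod n) = P.edgeLabel i) →
          SystemS n m x y) ∧
    -- Step II: the test for each `m`, and what is recorded
    (∀ m : ℕ, 1 ≤ m → m ≤ n - 1 →
      (IsConsistent n m ↔ ConsistencyTest n m) ∧
      (¬ IsConsistent n m → ∀ x : ZMod n → ℤ, (∀ i, 3 ≤ x i) →
        ∀ P P' : FramedTriangulation, IsCoherentRotation n 0 x P → IsCoherentRotation n m x P' →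
          ¬ IsCompanion P P') ∧
      (IsConsistent n m →
        (∀ x : ZMod n → ℤ, SolvesUnion n m x ↔ ParametricFormula n m x) ∧
        (∀ t : ℕ → ℤ, ∃! x : ZMod n → ℤ, SolvesUnion n m x ∧
          ∀ i ∈ Finset.Icc 1 (Nat.gcd n m), x ((i : ℕ) : ZMod n) = t i) ∧
        (∃ x : ZMod n → ℤ, SolvesUnion n m x ∧ ∀ i, 3 ≤ x i) ∧
        ∀ x : ZMod n → ℤ, (∀ i, 3 ≤ x i) →
          ∀ P P' : FramedTriangulation, IsCoherentRotation n 0 x P → IsCoherentRotation n m x P' →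
            (SolvesUnion n m x ↔ IsCompanion P P') ∧
            (SolvesUnion n m x → P.IsBasicWormhole ∧ P'.IsBasicWormhole))) ∧
    -- Step III: every admissible cyclic change of the hidden index is possible and gives companions
    (∀ m : ℕ, 1 ≤ m → m ≤ n - 1 → ∀ x : ZMod n → ℤ, (∀ i, 3 ≤ x i) → SolvesUnion n m x →
      ∀ P P' : FramedTriangulation, IsCoherentRotation n 0 x P → IsCoherentRotation n m x P' →
        P.s = P'.s ∧
        ∀ r : ℕ, 1 < P.entry (P.s + 1 + r) → 1 < P'.entry (P'.s + 1 + r) →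
          ∃ Q Q' : FramedTriangulation, IsCyclicChange r P Q ∧ IsCyclicChange r P' Q' ∧
            1 < Q.hidden ∧ 1 < Q'.hidden ∧ IsCompanion Q Q') ∧
    -- Output: all basic wormhole triangulations with `n` weights, and all companion pairs of them
    (∀ Q : FramedTriangulation, (Q.IsBasicWormhole ∧ Q.weights.length = n) ↔
      ∃ Q' : FramedTriangulation, IsListedPair n Q Q') ∧
    (∀ Q Q' : FramedTriangulation, (IsCompanion Q Q' ∧ Q.weights.length = n) ↔
      IsListedPair n Q Q') ∧
    -- where mirror images are not needed if `n` is odd, or if `Q` admits a standard frame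
    (∀ Q Q' : FramedTriangulation, IsCompanion Q Q' → Q.weights.length = n →
      (n % 2 = 1 ∨ Q.AdmitsStandardFrame) → IsProduced n Q Q') := by
  refine ⟨fun m hm x hx => ⟨?_, fun P hP y hy => hP.systemS hn hm hy⟩,
    fun m hm1 hm => ?_, fun m hm1 hm x _ hS P P' hP hP' => ?_, fun Q => ?_, fun Q Q' => ?_,
    fun Q Q' h hw hp => ?_⟩
  · obtain ⟨P, hP⟩ := exists_isCoherentRotation hn hm x hx
    exact ⟨P, hP, fun Q hQ => hQ.unique hn hm hP⟩
  · have : NeZero n := ⟨by omega⟩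
    refine ⟨isConsistent_iff m hn, fun hc x _ P P' hP hP' h => hc ⟨x, ?_⟩, fun hc =>
      ⟨solvesUnion_iff_parametricFormula m, existsUnique_solvesUnion hc,
        exists_solvesUnion_three_le hc, fun x _ P P' hP hP' => ?_⟩⟩
    · rwa [isCompanion_iff, ← IsCoherentRotation.isTwin_iff hn hm1 hm hP hP'] at h
    · have key : SolvesUnion n m x ↔ IsCompanion P P' := by
        rw [isCompanion_iff, IsCoherentRotation.isTwin_iff hn hm1 hm hP hP']
      refine ⟨key, fun h => ?_⟩
      have := key.mp h
      exact ⟨(isBasicWormhole_iff P).mpr ⟨P', this⟩, (isBasicWormhole_iff P').mpr ⟨P, this.symm⟩⟩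
  · have ht := (IsCoherentRotation.isTwin_iff hn hm1 hm hP hP').mp hS
    refine ⟨ht.s_eq.symm, fun r h1 h2 => ?_⟩
    obtain ⟨Q, hQ, hQh⟩ := P.exists_isCyclicChange r
    obtain ⟨Q', hQ', hQh'⟩ := P'.exists_isCyclicChange r
    rw [← hQh] at h1
    rw [← hQh'] at h2
    refine ⟨Q, Q', hQ, hQ', h1, h2, (isCompanion_iff Q Q').mpr ?_⟩
    rw [extChain_rotate_eq_iff] at hQ hQ'
    exact ht.rotate hQ.1 hQ.2 hQ'.1 hQ'.2 h1 h2
  · simp_rw [isBasicWormhole_iff, isListedPair_iff hn, isCompanion_iff, exists_and_right]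
  · rw [isListedPair_iff hn, isCompanion_iff]
  · rw [isCompanion_iff] at h
    refine h.isProduced hn hw (hp.imp_right ?_)
    rintro ⟨k, h1, h2⟩
    rw [entry_eq_lind] at h1 h2
    exact ⟨k, h1, by exact_mod_cast h2⟩
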